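/- **Setting.** Let $\mathbb T^3=[-\pi,\pi]^3$ with endpoints identified, with Lebesgue measure and coordinate derivatives $\partial_i$, $i=1,2,3$; $L^2=L^2(\mathbb T^3)$ and $\|f\|_{H^k}=\big(\sum_{|\vec\alpha|\le k}\|\partial_{\vec\alpha}f\|_{L^2}^2\big)^{1/2}$ (weak derivatives; $\|f\|_{H^k}=\infty$ if $f\notin H^k$). Greek indices run over $0,\dots,3$, Latin indices over $1,2,3$, $\partial_0=\partial_t$ (one-sided at $t=0$), and repeated indices are summed. Fix $\Lambda>0$, $\bar\varrho\ge 0$, an integer $N\ge4$, $c_1\ge1$ and $0<q\le 1/8$. Let $a$ be the solution of $a'=a\sqrt{\Lambda/3+\bar\varrho/(3a^3)}$, $a(0)=1$, on $[0,\infty)$, and $\Omega=\ln a$. On a slab $[0,T)\times\mathbb T^3$ consider a symmetric $g_{\mu\nu}$ of class $C^2$, a vectorfield $u^\mu$ and a function $\varrho$ of class $C^1$, with $g_{\alpha\beta}u^\alpha u^\beta=-1$ and $u^0>0$. Set $h_{jk}=e^{-2\Omega}g_{jk}$, let $g^{\mu\nu}$ be the inverse of $g_{\mu\nu}$, and put $\partial_{\mathbf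 u}=u^\mu\partial_\mu$, $\hat\square_g=g^{\alpha\beta}\partial_\alpha\partial_\beta$. Assume $$c_1^{-1}\delta_{ab}X^aX^b\le e^{-2\Omega}g_{ab}X^aX^b\le c_1\delta_{ab}X^aX^b\qquad\text{for all }X\in\mathbb R^3\text{ on the slab.}$$ Let the total norm $\mathbf S(t)$ be the sum of the following quantities at time $t$ (all free Latin indices are summed over $1,2,3$): * $e^{q\Omega}\|\partial_tg_{00}\|_{H^{N-1}}$, $e^{q\Omega}\|g_{00}+1\|_{H^{N-1}}$, $e^{(q-1)\Omega}\|\partial_ig_{00}\|_{H^{N-1}}$; * $e^{(q-1)\Omega}\|\partial_tg_{0j}\|_{H^{N-1}}$, $e^{(q-1)\Omega}\|g_{0j}\|_{H^{N-1}}$, $e^{(q-2)\Omega}\|\partial_ig_{0j}\|_{H^{N-1}}$; * $e^{q\Omega}\|\partial_th_{jk}\|_{H^{N-1}}$, $\|\partial_ih_{jk}\|_{H^{N-2}}$, $e^{(q-1)\Omega}\|\partial_ih_{jk}\|_{H^{N-1}}$; * $e^{(1+q)\Omega}\|u^j\|_{H^{N-1}}$, $\|\varrho-\bar\varrho\|_{H^{N-1}}$;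 * $e^{q\Omega}\|\partial_{\mathbf u}\partial_tg_{00}\|_{H^{N-1}}$, $e^{q\Omega}\|\partial_{\mathbf u}g_{00}\|_{H^{N-1}}$, $e^{(q-1)\Omega}\|\partial_{\mathbf u}\partial_ig_{00}\|_{H^{N-1}}$; * $e^{(q-1)\Omega}\|\partial_{\mathbf u}\partial_tg_{0j}\|_{H^{N-1}}$, $e^{(q-1)\Omega}\|\partial_{\mathbf u}g_{0j}\|_{H^{N-1}}$, $e^{(q-2)\Omega}\|\partial_{\mathbf u}\partial_ig_{0j}\|_{H^{N-1}}$; * $e^{q\Omega}\|\partial_{\mathbf u}\partial_th_{jk}\|_{H^{N-1}}$, $e^{q\Omega}\|\partial_{\mathbf u}h_{jk}\|_{H^{N-1}}$, $e^{q\Omega}\|\partial_{\mathbf u}\partial_ih_{jk}\|_{H^{N-2}}$, $e^{(q-1)\Omega}\|\partial_{\mathbf u}\partial_ih_{jk}\|_{H^{N-1}}$; * $e^{(1+q)\Omega}\|\partial_{\mathbf u}u^j\|_{H^{N-1}}$, $e^{q\Omega}\|\partial_{\mathbf u}\varrho\|_{H^{N-1}}$; * $e^{(q-1)\Omega}\|\partial_i\partial_tg_{00}\|_{H^{N-1}}$,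 $e^{(q-2)\Omega}\|\partial_i\partial_jg_{00}\|_{H^{N-1}}$, $e^{(q-2)\Omega}\|\partial_i\partial_tg_{0j}\|_{H^{N-1}}$, $e^{(q-3)\Omega}\|\partial_i\partial_jg_{0k}\|_{H^{N-1}}$, $e^{(q-1)\Omega}\|\partial_i\partial_th_{jk}\|_{H^{N-1}}$, $e^{(q-2)\Omega}\|\partial_i\partial_jh_{kl}\|_{H^{N-1}}$; * $e^{q\Omega}\|\partial_iu^j\|_{H^{N-1}}$. **Lemma (the key elliptic estimate).** There are constants $\epsilon'>0$ and $C>0$, depending only on $\Lambda,\bar\varrho,q,N,c_1$, such that for all $T$ and all $(g,u,\varrho)$ as above with $\mathbf S(t)\le\epsilon'$ for $t\in[0,T)$ the following holds. (No field equations for $(g,u,\varrho)$ are needed; in particular the lemma applies to solutions of the modified dust-Einstein equations with rescaled density $\varrho=e^{3\Omega}\rho$.) The matrix $$H^{ij}=e^{2\Omega}g^{ij}+e^{2\Omega}\frac{g^{00}u^iu^j}{(u^0)^2}-e^{2\Omega}g^{0i}\frac{u^j}{u^0}-e^{2\Omega}g^{0j}\frac{u^i}{u^0}$$ is symmetric and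 positive definite at every point of the slab. For every $v\in C^2([0,T),H^2(\mathbb T^3))$ and every $t\in[0,T)$, $$H^{ab}\partial_a\partial_bv=e^{2\Omega}\hat\square_gv-e^{2\Omega}\frac{g^{00}}{u^0}\partial_{\mathbf u}\partial_tv+e^{2\Omega}\Big\{\frac{g^{00}u^a}{(u^0)^2}-2\frac{g^{0a}}{u^0}\Big\}\partial_{\mathbf u}\partial_av$$ as an identity in $L^2$; moreover $\partial_t\partial_{\mathbf u}v$ (the derivative of $t\mapsto\partial_{\mathbf u}v(t)\in L^2$) and the weak derivatives $\partial_a\partial_{\mathbf u}v$ exist in $L^2$, and $$\sum_{a,b=1}^3\|\partial_a\partial_bv\|_{L^2}\le C\Big(e^{2\Omega}\|\hat\square_gv\|_{L^2}+e^{2\Omega}\|\partial_t\partial_{\mathbf u}v\|_{L^2}+\sum_{a=1}^3e^{(1-q)\Omega}\|\partial_a\partial_{\mathbf u}v\|_{L^2}+e^{(2-q)\Omega}\|\partial_tv\|_{L^2}+\sum_{a=1}^3e^{(1-q)\Omega}\|\partial_av\|_{L^2}\Big).$$ -/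

import Mathlib

open MeasureTheory Set Filter Topology
open scoped ENNReal ContDiff

noncomputable section

namespace DustEinstein

/-! ### The torus, smooth functions and partial derivatives -/

instance factTwoPiPos : Fact ((0 : ℝ) < 2 * Real.pi) := ⟨Real.two_pi_pos⟩

/-- The torus `[-π, π]³` with endpoints identified. Its `volume` is the product of the
Lebesgue measures of total mass `2π` on the circles. -/
abbrev T3 : Type := Fin 3 → AddCircle (2 * Real.pi)

/-- The covering map `ℝ³ → 𝕋³`. -/
def proj (y : Fin 3 → ℝ) : T3 := fun i => (y i : AddCircle (2 * Real.pi))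

/-- Smooth functions on the torus. -/
def SmoothT (φ : T3 → ℝ) : Prop := ContDiff ℝ ∞ (fun y : Fin 3 → ℝ => φ (proj y))

/-- The coordinate partial derivative `∂_i φ` (classical). -/
def pd (i : Fin 3) (φ : T3 → ℝ) : T3 → ℝ := fun x =>
  deriv (fun s : ℝ => φ (x + Pi.single i (s : AddCircle (2 * Real.pi)))) 0

/-- `∂_α φ = ∂_1^{α_1} ∂_2^{α_2} ∂_3^{α_3} φ` (classical). -/
def pdMulti (α : Fin 3 → ℕ) (φ : T3 → ℝ) : T3 → ℝ :=
  (pd 0)^[α 0] ((pd 1)^[α 1] ((pd 2)^[α 2] φ))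

/-- The multi-indices of order at most `k`. -/
def multiIdx (k : ℕ) : Finset (Fin 3 → ℕ) :=
  (Fintype.piFinset fun _ => Finset.range (k + 1)).filter fun α => ∑ i, α i ≤ k

theorem mem_multiIdx {k : ℕ} {α : Fin 3 → ℕ} : α ∈ multiIdx k ↔ ∑ i, α i ≤ k := by
  simp only [multiIdx, Finset.mem_filter, Fintype.mem_piFinset, Finset.mem_range,
    and_iff_right_iff_imp]
  intro h i
  have : α i ≤ ∑ j, α j := Finset.single_le_sum (fun _ _ => Nat.zero_le _) (Finset.mem_univ i)
  omega

/-! ### Sobolev spaces through weak derivatives -/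

/-- Real-valued `L²(𝕋³)`. -/
abbrev L2 : Type := Lp ℝ 2 (volume : Measure T3)

/-- `f'` is the weak derivative `∂_α f`. -/
def IsWeakDeriv (α : Fin 3 → ℕ) (f f' : L2) : Prop :=
  ∀ φ : T3 → ℝ, SmoothT φ →
    ∫ x, f x * pdMulti α φ x = (-1 : ℝ) ^ (∑ i, α i) * ∫ x, f' x * φ x

theorem proj_add_smul (y : Fin 3 → ℝ) (i : Fin 3) (s : ℝ) :
    proj y + Pi.single i (s : AddCircle (2 * Real.pi)) = proj (y + s • Pi.single i (1 : ℝ)) := by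
  funext j
  rcases eq_or_ne j i with rfl | h
  · simp [proj]
  · simp [proj, h]

theorem pd_proj {φ : T3 → ℝ} (hφ : SmoothT φ) (i : Fin 3) (y : Fin 3 → ℝ) :
    pd i φ (proj y) = fderiv ℝ (fun z => φ (proj z)) y (Pi.single i 1) := by
  have hd : DifferentiableAt ℝ (fun z : Fin 3 → ℝ => φ (proj z)) y :=
    (ContDiff.differentiable hφ (by simp)) y
  unfold pd
  simp only [proj_add_smul]
  exact hd.lineDeriv_eq_fderiv

theorem SmoothT.pd {φ : T3 → ℝ} (hφ : SmoothT φ) (i : Fin 3) : SmoothT (pd i φ) := by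
  have h : (fun y : Fin 3 → ℝ => DustEinstein.pd i φ (proj y)) =
      fun y => fderiv ℝ (fun z => φ (proj z)) y (Pi.single i 1) := by
    funext y; exact pd_proj hφ i y
  unfold SmoothT
  rw [h]
  exact (ContDiff.fderiv_right (m := ∞) hφ (by simp)).clm_apply contDiff_const

theorem SmoothT.pd_iterate {φ : T3 → ℝ} (hφ : SmoothT φ) (i : Fin 3) (n : ℕ) :
    SmoothT ((DustEinstein.pd i)^[n] φ) := by
  induction n with
  | zero => exact hφ
  | succ n ih => rw [Function.iterate_succ_apply']; exact ih.pd i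

theorem SmoothT.pdMulti {φ : T3 → ℝ} (hφ : SmoothT φ) (α : Fin 3 → ℕ) :
    SmoothT (pdMulti α φ) :=
  ((hφ.pd_iterate 2 _).pd_iterate 1 _).pd_iterate 0 _

theorem SmoothT.continuous {φ : T3 → ℝ} (hφ : SmoothT φ) : Continuous φ := by
  have hq : IsOpenQuotientMap proj :=
    IsOpenQuotientMap.piMap (fun _ : Fin 3 => QuotientAddGroup.isOpenQuotientMap_mk)
  exact hq.isQuotientMap.continuous_iff.mpr (ContDiff.continuous hφ)

theorem integrable_mul_smooth (f : L2) {φ : T3 → ℝ} (hφ : SmoothT φ) :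
    Integrable (fun x => f x * φ x) volume := by
  obtain ⟨C, hC⟩ := (isCompact_univ (X := T3)).exists_bound_of_continuousOn
    hφ.continuous.continuousOn
  exact ((Lp.memLp f).integrable (by norm_num)).mul_bdd (c := C)
    hφ.continuous.aestronglyMeasurable (ae_of_all _ fun x => hC x (mem_univ x))

theorem IsWeakDeriv.add {α : Fin 3 → ℕ} {f f' g g' : L2} (hf : IsWeakDeriv α f f')
    (hg : IsWeakDeriv α g g') : IsWeakDeriv α (f + g) (f' + g') := by
  intro φ hφ
  have h1 : ∀ (a b : L2) (ψ : T3 → ℝ), SmoothT ψ →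
      ∫ x, (a + b : L2) x * ψ x = (∫ x, a x * ψ x) + ∫ x, b x * ψ x := by
    intro a b ψ hψ
    rw [← integral_add (integrable_mul_smooth a hψ) (integrable_mul_smooth b hψ)]
    refine integral_congr_ae ?_
    filter_upwards [Lp.coeFn_add a b] with x hx
    rw [hx, Pi.add_apply, add_mul]
  rw [h1 _ _ _ (hφ.pdMulti α), h1 _ _ _ hφ, hf φ hφ, hg φ hφ, mul_add]

theorem IsWeakDeriv.smul {α : Fin 3 → ℕ} {f f' : L2} (c : ℝ) (hf : IsWeakDeriv α f f') :
    IsWeakDeriv α (c • f) (c • f') := by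
  intro φ hφ
  have h1 : ∀ (a : L2) (ψ : T3 → ℝ), ∫ x, (c • a : L2) x * ψ x = c * ∫ x, a x * ψ x := by
    intro a ψ
    rw [← integral_const_mul]
    refine integral_congr_ae ?_
    filter_upwards [Lp.coeFn_smul c a] with x hx
    rw [hx, Pi.smul_apply, smul_eq_mul, mul_assoc]
  rw [h1, h1, hf φ hφ]
  ring

theorem isWeakDeriv_zero (α : Fin 3 → ℕ) : IsWeakDeriv α 0 0 := by
  intro φ _
  have h1 : ∀ ψ : T3 → ℝ, ∫ x, (0 : L2) x * ψ x = 0 := by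
    intro ψ
    rw [← integral_zero T3 ℝ (μ := volume)]
    refine integral_congr_ae ?_
    filter_upwards [Lp.coeFn_zero ℝ 2 (volume : Measure T3)] with x hx
    rw [hx, Pi.zero_apply, zero_mul]
  rw [h1, h1, mul_zero]

/-- The `L²` norm of the weak derivative `∂_α f`, equal to `∞` when `f` is not in `L²` or has no
weak derivative `∂_α f` in `L²`. (The infimum runs over at most one value.) -/
def weakDerivNorm (α : Fin 3 → ℕ) (f : T3 → ℝ) : ℝ≥0∞ :=
  ⨅ (F : L2) (F' : L2) (_ : F =ᵐ[volume] f) (_ : IsWeakDeriv α F F'), ‖F'‖ₑ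

/-- The Sobolev norm `‖f‖_{H^k} = (∑_{|α| ≤ k} ‖∂_α f‖²_{L²})^{1/2}`, `∞` if `f ∉ H^k`. -/
def sobNorm (k : ℕ) (f : T3 → ℝ) : ℝ≥0∞ :=
  (∑ α ∈ multiIdx k, weakDerivNorm α f ^ 2) ^ (1 / 2 : ℝ)

/-- The index of the function itself among the multi-indices. -/
def zeroIdx (k : ℕ) : multiIdx k := ⟨0, mem_multiIdx.mpr (by simp)⟩

/-- The Sobolev space `H^k(𝕋³)`: an element is the family `(∂_α f)_{|α| ≤ k}` of the weak
derivatives of an `L²` function `f`, and the norm is `(∑_{|α| ≤ k} ‖∂_α f‖²_{L²})^{1/2}`. -/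
def sobolevSpace (k : ℕ) : Submodule ℝ (PiLp 2 (fun _ : multiIdx k => L2)) where
  carrier := {F | ∀ α : multiIdx k, IsWeakDeriv α.1 (F (zeroIdx k)) (F α)}
  add_mem' := fun hF hG α => (hF α).add (hG α)
  zero_mem' := fun α => isWeakDeriv_zero α.1
  smul_mem' := fun c _ hF α => (hF α).smul c

/-- `H²(𝕋³)`. -/
abbrev H2 : Type := sobolevSpace 2

/-- The `L²` function underlying an element of `H²`. -/
def H2.val (w : H2) : L2 := w.1 (zeroIdx 2)

/-- The weak derivative `∂_a w`. -/
def H2.d1 (a : Fin 3) (w : H2) : L2 :=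
  w.1 ⟨Pi.single a 1, mem_multiIdx.mpr (by simp)⟩

/-- The weak derivative `∂_a ∂_b w`. -/
def H2.d2 (a b : Fin 3) (w : H2) : L2 :=
  w.1 ⟨Pi.single a 1 + Pi.single b 1, mem_multiIdx.mpr (by simp [Finset.sum_add_distrib])⟩

/-- The product `f w` of a (continuous) function and an `L²` function; it is in `L²` whenever `f`
is continuous. -/
def mulL2 (f : T3 → ℝ) (w : L2) : L2 :=
  open Classical in
  if h : MemLp (fun x => f x * w x) 2 volume then h.toLp _ else 0

/-! ### Derivatives of spacetime fields -/

/-- `∂_t F` on `[0, ∞) × 𝕋³` (one-sided at `t = 0`). -/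
def dt (F : ℝ → T3 → ℝ) : ℝ → T3 → ℝ := fun t x => derivWithin (fun s => F s x) (Ici 0) t

/-- `∂_i F`. -/
def dx (i : Fin 3) (F : ℝ → T3 → ℝ) : ℝ → T3 → ℝ := fun t => pd i (F t)

/-- `∂_𝐮 F = u^μ ∂_μ F`. -/
def du (u : ℝ → T3 → Fin 4 → ℝ) (F : ℝ → T3 → ℝ) : ℝ → T3 → ℝ := fun t x =>
  u t x 0 * dt F t x + ∑ a : Fin 3, u t x a.succ * dx a F t x

/-- `F` is of class `C^n` on the slab `[0, T) × 𝕋³`. -/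
def ContDiffSlab (n : ℕ) (T : ℝ) (F : ℝ → T3 → ℝ) : Prop :=
  ContDiffOn ℝ n (fun p : ℝ × (Fin 3 → ℝ) => F p.1 (proj p.2)) (Ico 0 T ×ˢ univ)

/-! ### The background and the solution norms -/

/-- `a` is the scale factor of the FLRW background on `[0, ∞)`: it solves Friedmann's equation
`a' = a √(Λ/3 + ρ̄/(3a³))` with `a(0) = 1`. -/
structure IsScaleFactor (Λ rhoBar : ℝ) (a : ℝ → ℝ) : Prop where
  initial : a 0 = 1
  pos : ∀ t, 0 ≤ t → 0 < a t
  friedmann : ∀ t, 0 ≤ t →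
    HasDerivWithinAt a (a t * Real.sqrt (Λ / 3 + rhoBar / (3 * a t ^ 3))) (Ici 0) t

/-- `Ω(t) = ln a(t)`. -/
def Om (a : ℝ → ℝ) (t : ℝ) : ℝ := Real.log (a t)

/-- The weight `e^{cΩ(t)}` as a real number. -/
def ew (a : ℝ → ℝ) (c t : ℝ) : ℝ := Real.exp (c * Om a t)

/-- The weight `e^{cΩ(t)}` as an extended nonnegative number. -/
def eW (a : ℝ → ℝ) (c t : ℝ) : ℝ≥0∞ := ENNReal.ofReal (ew a c t)

/-- A covariant metric field `g_{μν}(t, x)`; index `0` is time, `a.succ` is the spatial index `a`. -/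
abbrev MetricField : Type := ℝ → T3 → Matrix (Fin 4) (Fin 4) ℝ

/-- `h_{jk} = e^{-2Ω} g_{jk}`. -/
def hRes (a : ℝ → ℝ) (g : MetricField) (j k : Fin 3) : ℝ → T3 → ℝ := fun t x =>
  ew a (-2) t * g t x j.succ k.succ

section Norms

variable (a : ℝ → ℝ) (q : ℝ) (N : ℕ) (rhoBar : ℝ) (g : MetricField) (u : ℝ → T3 → Fin 4 → ℝ)
  (rho : ℝ → T3 → ℝ) (t : ℝ)

/-- The norm of `g_{00}`. -/
def normG00 : ℝ≥0∞ :=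
  eW a q t * sobNorm (N - 1) (dt (fun t x => g t x 0 0) t)
  + eW a q t * sobNorm (N - 1) (fun x => g t x 0 0 + 1)
  + ∑ i : Fin 3, eW a (q - 1) t * sobNorm (N - 1) (dx i (fun t x => g t x 0 0) t)

/-- The norm of the `∂_𝐮` derivatives of `g_{00}`. -/
def normUG00 : ℝ≥0∞ :=
  eW a q t * sobNorm (N - 1) (du u (dt fun t x => g t x 0 0) t)
  + eW a q t * sobNorm (N - 1) (du u (fun t x => g t x 0 0) t)
  + ∑ i : Fin 3, eW a (q - 1) t * sobNorm (N - 1) (du u (dx i fun t x => g t x 0 0) t)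

/-- The elliptic norm of `g_{00}`. -/
def normEG00 : ℝ≥0∞ :=
  (∑ i : Fin 3, eW a (q - 1) t * sobNorm (N - 1) (dx i (dt fun t x => g t x 0 0) t))
  + ∑ i : Fin 3, ∑ j : Fin 3,
      eW a (q - 2) t * sobNorm (N - 1) (dx i (dx j fun t x => g t x 0 0) t)

/-- The norm of `g_{0j}`. -/
def normG0 : ℝ≥0∞ :=
  (∑ j : Fin 3, eW a (q - 1) t * sobNorm (N - 1) (dt (fun t x => g t x 0 j.succ) t))
  + (∑ j : Fin 3, eW a (q - 1) t * sobNorm (N - 1) (fun x => g t x 0 j.succ))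
  + ∑ i : Fin 3, ∑ j : Fin 3,
      eW a (q - 2) t * sobNorm (N - 1) (dx i (fun t x => g t x 0 j.succ) t)

/-- The norm of the `∂_𝐮` derivatives of `g_{0j}`. -/
def normUG0 : ℝ≥0∞ :=
  (∑ j : Fin 3, eW a (q - 1) t * sobNorm (N - 1) (du u (dt fun t x => g t x 0 j.succ) t))
  + (∑ j : Fin 3, eW a (q - 1) t * sobNorm (N - 1) (du u (fun t x => g t x 0 j.succ) t))
  + ∑ i : Fin 3, ∑ j : Fin 3,
      eW a (q - 2) t * sobNorm (N - 1) (du u (dx i fun t x => g t x 0 j.succ) t)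

/-- The elliptic norm of `g_{0j}`. -/
def normEG0 : ℝ≥0∞ :=
  (∑ i : Fin 3, ∑ j : Fin 3,
      eW a (q - 2) t * sobNorm (N - 1) (dx i (dt fun t x => g t x 0 j.succ) t))
  + ∑ i : Fin 3, ∑ j : Fin 3, ∑ k : Fin 3,
      eW a (q - 3) t * sobNorm (N - 1) (dx i (dx j fun t x => g t x 0 k.succ) t)

/-- The norm of `h_{jk}`. -/
def normH : ℝ≥0∞ :=
  (∑ j : Fin 3, ∑ k : Fin 3, eW a q t * sobNorm (N - 1) (dt (hRes a g j k) t))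
  + (∑ i : Fin 3, ∑ j : Fin 3, ∑ k : Fin 3, sobNorm (N - 2) (dx i (hRes a g j k) t))
  + ∑ i : Fin 3, ∑ j : Fin 3, ∑ k : Fin 3,
      eW a (q - 1) t * sobNorm (N - 1) (dx i (hRes a g j k) t)

/-- The norm of the `∂_𝐮` derivatives of `h_{jk}`. -/
def normUH : ℝ≥0∞ :=
  (∑ j : Fin 3, ∑ k : Fin 3, eW a q t * sobNorm (N - 1) (du u (dt (hRes a g j k)) t))
  + (∑ j : Fin 3, ∑ k : Fin 3, eW a q t * sobNorm (N - 1) (du u (hRes a g j k) t))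
  + (∑ i : Fin 3, ∑ j : Fin 3, ∑ k : Fin 3,
      eW a q t * sobNorm (N - 2) (du u (dx i (hRes a g j k)) t))
  + ∑ i : Fin 3, ∑ j : Fin 3, ∑ k : Fin 3,
      eW a (q - 1) t * sobNorm (N - 1) (du u (dx i (hRes a g j k)) t)

/-- The elliptic norm of `h_{jk}`. -/
def normEH : ℝ≥0∞ :=
  (∑ i : Fin 3, ∑ j : Fin 3, ∑ k : Fin 3,
      eW a (q - 1) t * sobNorm (N - 1) (dx i (dt (hRes a g j k)) t))
  + ∑ i : Fin 3, ∑ j : Fin 3, ∑ k : Fin 3, ∑ l : Fin 3,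
      eW a (q - 2) t * sobNorm (N - 1) (dx i (dx j (hRes a g k l)) t)

/-- The below-top-order norm of the velocity. -/
def normVel : ℝ≥0∞ :=
  ∑ j : Fin 3, eW a (1 + q) t * sobNorm (N - 1) (fun x => u t x j.succ)

/-- The top-order norm of the velocity. -/
def normTopVel : ℝ≥0∞ :=
  ∑ i : Fin 3, ∑ j : Fin 3,
    eW a q t * sobNorm (N - 1) (dx i (fun t x => u t x j.succ) t)

/-- The norm of the `∂_𝐮` derivative of the velocity. -/
def normUVel : ℝ≥0∞ :=
  ∑ j : Fin 3, eW a (1 + q) t * sobNorm (N - 1) (du u (fun t x => u t x j.succ) t)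

/-- The norm of the rescaled density. -/
def normDens : ℝ≥0∞ := sobNorm (N - 1) (fun x => rho t x - rhoBar)

/-- The norm of the `∂_𝐮` derivative of the rescaled density. -/
def normUDens : ℝ≥0∞ := eW a q t * sobNorm (N - 1) (du u rho t)

/-- The total solution norm `𝐒_(Total)(t)`; `rho` is the rescaled density `ϱ = e^{3Ω}ρ`. -/
def totalNorm : ℝ≥0∞ :=
  -- below-top-order norms of the metric and the fluid
  (normG00 a q N g t + normG0 a q N g t + normH a q N g t
    + normVel a q N u t + normDens N rhoBar rho t)
  -- norms of the `∂_𝐮` derivatives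
  + (normUG00 a q N g u t + normUG0 a q N g u t + normUH a q N g u t
    + normUVel a q N u t + normUDens a q N u rho t)
  -- elliptic norms of the metric
  + (normEG00 a q N g t + normEG0 a q N g t + normEH a q N g t)
  -- top-order norm of the velocity
  + normTopVel a q N u t

end Norms

/-- Classical regularity on `[0, T) × 𝕋³`, together with the algebraic conditions on the metric
and on the future-directed, unit-normalized four-velocity. -/
structure IsDustField (T : ℝ) (g : MetricField) (u : ℝ → T3 → Fin 4 → ℝ)
    (rho : ℝ → T3 → ℝ) : Prop where
  g_C2 : ∀ μ ν, ContDiffSlab 2 T fun t x => g t x μ ν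
  u_C1 : ∀ μ, ContDiffSlab 1 T fun t x => u t x μ
  rho_C1 : ContDiffSlab 1 T rho
  g_symm : ∀ t ∈ Ico 0 T, ∀ x, (g t x).IsSymm
  u_unit : ∀ t ∈ Ico 0 T, ∀ x, ∑ α, ∑ β, g t x α β * u t x α * u t x β = -1
  u_future : ∀ t ∈ Ico 0 T, ∀ x, 0 < u t x 0

/-- The bootstrap assumption `c₁⁻¹ |X|² ≤ e^{-2Ω} g_{ab} X^a X^b ≤ c₁ |X|²` on the slab. -/
def SpatialBootstrap (a : ℝ → ℝ) (T c₁ : ℝ) (g : MetricField) : Prop :=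
  ∀ t ∈ Ico 0 T, ∀ x, ∀ X : Fin 3 → ℝ,
    c₁⁻¹ * ∑ i, X i ^ 2 ≤ ew a (-2) t * ∑ i, ∑ j, g t x i.succ j.succ * X i * X j ∧
    ew a (-2) t * ∑ i, ∑ j, g t x i.succ j.succ * X i * X j ≤ c₁ * ∑ i, X i ^ 2

/-! ### Operators acting on curves in `H²` -/

/-- The components `g^{μν}` of the inverse metric. -/
def gInv (g : MetricField) (μ ν : Fin 4) (t : ℝ) (x : T3) : ℝ := (g t x)⁻¹ μ ν

/-- `H^{ij} = e^{2Ω} (g^{ij} + g^{00} u^i u^j / (u^0)² - g^{0i} u^j / u^0 - g^{0j} u^i / u^0)`. -/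
def Hup (a : ℝ → ℝ) (g : MetricField) (u : ℝ → T3 → Fin 4 → ℝ) (t : ℝ) (x : T3) :
    Matrix (Fin 3) (Fin 3) ℝ := Matrix.of fun i j =>
  ew a 2 t * gInv g i.succ j.succ t x
    + ew a 2 t * (gInv g 0 0 t x * u t x i.succ * u t x j.succ / (u t x 0) ^ 2)
    - ew a 2 t * gInv g 0 i.succ t x * (u t x j.succ / u t x 0)
    - ew a 2 t * gInv g 0 j.succ t x * (u t x i.succ / u t x 0)

/-- The time derivative of a curve `v : [0, T) → H²` (one-sided at `t = 0`). -/
def vt (v : ℝ → H2) : ℝ → H2 := fun t => derivWithin v (Ici 0) t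

/-- The first spacetime derivatives `∂_μ v(t) ∈ L²`. -/
def D1 (v : ℝ → H2) (μ : Fin 4) (t : ℝ) : L2 :=
  Fin.cases (vt v t).val (fun a => (v t).d1 a) μ

/-- The second spacetime derivatives `∂_μ ∂_ν v(t) ∈ L²`. -/
def D2 (v : ℝ → H2) (μ ν : Fin 4) (t : ℝ) : L2 :=
  Fin.cases
    (Fin.cases (vt (vt v) t).val (fun b => (vt v t).d1 b) ν)
    (fun a => Fin.cases ((vt v t).d1 a) (fun b => (v t).d2 a b) ν) μ

/-- The reduced wave operator `□̂_g v = g^{αβ} ∂_α ∂_β v`. -/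
def boxHat (g : MetricField) (v : ℝ → H2) (t : ℝ) : L2 :=
  ∑ α, ∑ β, mulL2 (gInv g α β t) (D2 v α β t)

/-- `∂_𝐮 v = u^ν ∂_ν v`. -/
def duV (u : ℝ → T3 → Fin 4 → ℝ) (v : ℝ → H2) (t : ℝ) : L2 :=
  ∑ ν, mulL2 (fun x => u t x ν) (D1 v ν t)

/-- `∂_𝐮 ∂_μ v = u^ν ∂_ν ∂_μ v`. -/
def duDV (u : ℝ → T3 → Fin 4 → ℝ) (v : ℝ → H2) (μ : Fin 4) (t : ℝ) : L2 :=
  ∑ ν, mulL2 (fun x => u t x ν) (D2 v ν μ t)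

end DustEinstein

end

open DustEinstein Set

namespace DustEinstein

open scoped ComplexConjugate

/-! ### Fourier analysis on the torus -/

/-! The identity is pure algebra: replacing `∂_t` by `(∂_𝐮 - u^a ∂_a) / u^0` in `g^{αβ} ∂_α ∂_β`
trades every second derivative involving `∂_t` for `∂_𝐮 ∂_μ`, and the purely spatial operator that
remains has the coefficients `H^{ij}` (up to the factor `e^{2Ω}`).

Ellipticity and the estimate are proved at a fixed time, from pointwise bounds alone. The Sobolev
embedding `H² ⊂ L^∞`, proved with Fourier series, turns smallness of the total norm into smallness
of a single parameter `d` governing all weighted components (`pointBounds_of_totalNorm`). In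
rescaled components `H^{ij}` is an inverse of `h_{ij}` up to an error `d` (`exists_approx_inverse`).
Since `h` is comparable to the identity, so is `H`, with a constant depending only on `c₁`
(`le_quad_Hup`). Since `∂_i h_{jk}` is small and the torus is bounded, `h` is nearly constant in
space, hence so is `H` (`abs_Hup_sub_le`).

Therefore no localization is needed: the coefficients are frozen at one point of the torus, the
constant coefficient operator is inverted as a Fourier multiplier (`H2.norm_d2_le`), and the error,
a small multiple of all second derivatives, is absorbed on the left (`H2.sum_norm_d2_le`).

What remains on the right contains `∂_𝐮 ∂_μ v` instead of `∂_μ ∂_𝐮 v`. The difference is `(∂_μ u^ν)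
∂_ν v`, so weighted bounds on the first derivatives of the velocity are needed. For `u^j` they
follow from the norms; for `u^0` they come from differentiating `g_{αβ} u^α u^β = -1` and solving
for `∂_μ u^0`, whose coefficient stays away from zero (`Comparable.abs_deriv_le`). -/

/-- The exponential monomial `x ↦ e^{i k·x}` on the torus. -/
noncomputable def expMon (k : Fin 3 → ℤ) : C(T3, ℂ) where
  toFun x := ∏ i, fourier (k i) (x i)
  continuous_toFun := by fun_prop

theorem expMon_neg (k : Fin 3 → ℤ) (x : T3) : expMon (-k) x = conj (expMon k x) := by
  simp only [expMon, Pi.neg_apply, fourier_neg, ContinuousMap.coe_mk, map_prod]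

theorem expMon_add (k l : Fin 3 → ℤ) (x : T3) :
    expMon (k + l) x = expMon k x * expMon l x := by
  simp only [expMon, Pi.add_apply, fourier_add, ContinuousMap.coe_mk, ← Finset.prod_mul_distrib]

theorem expMon_zero (x : T3) : expMon 0 x = 1 := by
  simp only [expMon, Pi.zero_apply, fourier_zero, Finset.prod_const_one, ContinuousMap.coe_mk]

theorem norm_expMon (k : Fin 3 → ℤ) (x : T3) : ‖expMon k x‖ = 1 := by
  simp only [expMon, fourier_apply, ContinuousMap.coe_mk, norm_prod, Circle.norm_coe,
      Finset.prod_const_one]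

theorem expMon_single (i : Fin 3) (x : T3) : expMon (Pi.single i 1) x = fourier 1 (x i) := by
  simp only [expMon, ContinuousMap.coe_mk]
  rw [Finset.prod_eq_single i]
  · simp only [Pi.single_eq_same]
  · intro j _ hj
    simp only [Pi.single_eq_of_ne hj, fourier_zero]
  · simp

/-- The star subalgebra of `C(𝕋³, ℂ)` generated by the exponential monomials. -/
noncomputable def expMonSubalgebra : StarSubalgebra ℂ C(T3, ℂ) where
  toSubalgebra := Algebra.adjoin ℂ (range expMon)
  star_mem' := by
    change Algebra.adjoin ℂ (range expMon) ≤ star (Algebra.adjoin ℂ (range expMon))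
    refine Algebra.adjoin_le ?_
    rintro _ ⟨n, rfl⟩
    refine Algebra.subset_adjoin ⟨-n, ?_⟩
    ext1 x
    simp only [expMon_neg, starRingEnd_apply, ContinuousMap.star_apply]

theorem expMonSubalgebra_coe :
    expMonSubalgebra.toSubalgebra.toSubmodule = Submodule.span ℂ (range expMon) := by
  apply Algebra.adjoin_eq_span_of_subset
  refine .trans (fun x ↦ Submonoid.closure_induction (fun _ ↦ id) ⟨0, ?_⟩ ?_)
    Submodule.subset_span
  · ext z
    simp only [expMon_zero, ContinuousMap.one_apply]
  · rintro _ _ _ _ ⟨m, rfl⟩ ⟨n, rfl⟩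
    refine ⟨m + n, ?_⟩
    ext z
    simp only [expMon_add, ContinuousMap.mul_apply]

theorem expMonSubalgebra_separatesPoints : expMonSubalgebra.SeparatesPoints := by
  intro x y hxy
  rw [Ne, funext_iff, not_forall] at hxy
  obtain ⟨i, hi⟩ := hxy
  refine ⟨fun z => expMon (Pi.single i 1) z,
    ⟨expMon (Pi.single i 1), Algebra.subset_adjoin (mem_range_self _), rfl⟩, ?_⟩
  simp only [expMon_single, fourier_one]
  intro h
  exact hi (AddCircle.injective_toCircle (by positivity) (Subtype.coe_injective h))

theorem span_expMon_closure_eq_top :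
    (Submodule.span ℂ (range expMon)).topologicalClosure = ⊤ := by
  rw [← expMonSubalgebra_coe]
  exact congr_arg (Subalgebra.toSubmodule <| StarSubalgebra.toSubalgebra ·)
    (ContinuousMap.starSubalgebra_topologicalClosure_eq_top_of_separatesPoints _
      expMonSubalgebra_separatesPoints)

theorem integral_expMon (k : Fin 3 → ℤ) :
    ∫ x, expMon k x = if k = 0 then ((2 * Real.pi) ^ 3 : ℂ) else 0 := by
  split_ifs with h
  · subst h
    simp only [expMon_zero]
    simp [Measure.real, volume_pi, Measure.pi_univ, Real.pi_nonneg]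
  · obtain ⟨i, hi⟩ := Function.ne_iff.mp h
    simp only [expMon, ContinuousMap.coe_mk]
    rw [MeasureTheory.integral_fintype_prod_volume_eq_prod (fun i y => fourier (k i) y)]
    apply Finset.prod_eq_zero (Finset.mem_univ i)
    -- In the factor with `k i ≠ 0`, translation by half a wavelength changes the sign of the
    -- integrand.
    exact integral_eq_zero_of_add_right_eq_neg
      (fourier_add_half_inv_index hi Real.two_pi_pos)

/-- The normalization constant `(2π)^{-3/2}`. -/
noncomputable def nrm : ℝ := (Real.sqrt ((2 * Real.pi) ^ 3))⁻¹

theorem nrm_pos : 0 < nrm := by unfold nrm; positivity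

theorem nrm_sq : nrm ^ 2 * (2 * Real.pi) ^ 3 = 1 := by
  unfold nrm
  rw [inv_pow, Real.sq_sqrt (by positivity)]
  field_simp

/-- The normalized exponential monomials as elements of `L²`. -/
noncomputable def expMonLp (k : Fin 3 → ℤ) : Lp ℂ 2 (volume : Measure T3) :=
  (nrm : ℂ) • ContinuousMap.toLp (E := ℂ) 2 volume ℂ (expMon k)

theorem orthonormal_expMonLp : Orthonormal ℂ expMonLp := by
  rw [orthonormal_iff_ite]
  intro m n
  simp only [expMonLp, inner_smul_left, inner_smul_right, ContinuousMap.inner_toLp, ← expMon_neg,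
    ← expMon_add, integral_expMon]
  have h : (nrm : ℂ) ^ 2 * (2 * Real.pi) ^ 3 = 1 := by exact_mod_cast nrm_sq
  have h2 : n + -m = 0 ↔ m = n := by
    rw [← sub_eq_add_neg, sub_eq_zero, eq_comm]
  simp only [h2, Complex.conj_ofReal]
  split_ifs
  · rw [← h]; ring
  · simp

theorem span_expMonLp_closure_eq_top :
    (Submodule.span ℂ (range expMonLp)).topologicalClosure = ⊤ := by
  have h1 : Submodule.span ℂ (range expMonLp) =
      Submodule.span ℂ (range fun k => ContinuousMap.toLp (E := ℂ) 2 (volume : Measure T3) ℂ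
        (expMon k)) := by
    apply le_antisymm
    · rw [Submodule.span_le]
      rintro _ ⟨k, rfl⟩
      exact Submodule.smul_mem _ _ (Submodule.subset_span ⟨k, rfl⟩)
    · rw [Submodule.span_le]
      rintro _ ⟨k, rfl⟩
      have : ContinuousMap.toLp (E := ℂ) 2 (volume : Measure T3) ℂ (expMon k)
          = (nrm : ℂ)⁻¹ • expMonLp k := by
        rw [expMonLp, inv_smul_smul₀]
        exact_mod_cast nrm_pos.ne'
      simp only [this]
      exact Submodule.smul_mem _ _ (Submodule.subset_span ⟨k, rfl⟩)
  rw [h1]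
  simpa only [Submodule.map_span, ContinuousLinearMap.coe_coe, ← range_comp, Function.comp_def]
    using (ContinuousMap.toLp_denseRange ℂ (volume : Measure T3) ℂ
      (p := 2) ENNReal.ofNat_ne_top).topologicalClosure_map_submodule span_expMon_closure_eq_top

/-- The Hilbert basis of exponential monomials. -/
noncomputable def expBasis : HilbertBasis (Fin 3 → ℤ) ℂ (Lp ℂ 2 (volume : Measure T3)) :=
  HilbertBasis.mk orthonormal_expMonLp span_expMonLp_closure_eq_top.ge

theorem coe_expBasis : ⇑expBasis = expMonLp := HilbertBasis.coe_mk _ _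

/-- The Fourier coefficient `∫ f e^{-i k·x}`. -/
noncomputable def coef (f : T3 → ℝ) (k : Fin 3 → ℤ) : ℂ := ∫ x, (f x : ℂ) * expMon (-k) x

theorem coef_congr {f g : T3 → ℝ} (h : f =ᵐ[volume] g) : coef f = coef g := by
  funext k
  refine integral_congr_ae ?_
  filter_upwards [h] with x hx
  rw [hx]

theorem inner_expBasis {f : T3 → ℝ} (hf : MemLp f 2 volume) (k : Fin 3 → ℤ) :
    inner ℂ (expBasis k) (hf.ofReal (K := ℂ)).toLp = (nrm : ℂ) * coef f k := by
  rw [coe_expBasis, expMonLp, inner_smul_left, Complex.conj_ofReal, L2.inner_def, coef]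
  congr 1
  refine integral_congr_ae ?_
  filter_upwards [ContinuousMap.coeFn_toLp (p := 2) (𝕜 := ℂ) volume (expMon k), (hf.ofReal (K := ℂ)).coeFn_toLp] with x h1 h2
  rw [h1, h2, expMon_neg]
  simp

/-- Parseval's identity. -/
theorem hasSum_coef_mul {f g : T3 → ℝ} (hf : MemLp f 2 volume) (hg : MemLp g 2 volume) :
    HasSum (fun k => (nrm : ℂ) ^ 2 * (conj (coef f k) * coef g k))
      ((∫ x, f x * g x : ℝ) : ℂ) := by
  have h := expBasis.hasSum_inner_mul_inner (hf.ofReal (K := ℂ)).toLp (hg.ofReal (K := ℂ)).toLp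
  have e1 : (fun k => (nrm : ℂ) ^ 2 * (conj (coef f k) * coef g k)) = fun k =>
      inner ℂ (hf.ofReal (K := ℂ)).toLp (expBasis k) *
        inner ℂ (expBasis k) (hg.ofReal (K := ℂ)).toLp := by
    funext k
    rw [inner_expBasis hg, ← inner_conj_symm, inner_expBasis hf, map_mul, Complex.conj_ofReal]
    ring
  have e2 : ((∫ x, f x * g x : ℝ) : ℂ) =
      inner ℂ (hf.ofReal (K := ℂ)).toLp (hg.ofReal (K := ℂ)).toLp := by
    rw [L2.inner_def]
    refine integral_ofReal.symm.trans ?_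
    refine integral_congr_ae ?_
    filter_upwards [(hf.ofReal (K := ℂ)).coeFn_toLp, (hg.ofReal (K := ℂ)).coeFn_toLp] with x h1 h2
    rw [h1, h2]
    simp [mul_comm]
  rw [e1, e2]
  exact h

theorem hasSum_sq_coef {f : T3 → ℝ} (hf : MemLp f 2 volume) :
    HasSum (fun k => nrm ^ 2 * ‖coef f k‖ ^ 2) (∫ x, f x ^ 2) := by
  have h := Complex.hasSum_re (hasSum_coef_mul hf hf)
  convert h using 1
  · funext k
    rw [← Complex.normSq_eq_conj_mul_self, Complex.normSq_eq_norm_sq]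
    norm_cast
  · simp only [Complex.ofReal_re, sq]

theorem norm_sq_L2 (f : L2) : ‖f‖ ^ 2 = ∫ x, f x ^ 2 := by
  rw [← real_inner_self_eq_norm_sq, L2.inner_def]
  simp [sq]

theorem hasSum_sq_coef_L2 (f : L2) :
    HasSum (fun k => nrm ^ 2 * ‖coef f k‖ ^ 2) (‖f‖ ^ 2) := by
  rw [norm_sq_L2]; exact hasSum_sq_coef (Lp.memLp f)

/-! ### Continuously differentiable functions on the torus -/

theorem isOpenQuotientMap_proj : IsOpenQuotientMap proj :=
  IsOpenQuotientMap.piMap (fun _ : Fin 3 => QuotientAddGroup.isOpenQuotientMap_mk)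

/-- Functions of class `C¹` on the torus. -/
def C1T (φ : T3 → ℝ) : Prop := ContDiff ℝ 1 (fun y : Fin 3 → ℝ => φ (proj y))

theorem SmoothT.c1T {φ : T3 → ℝ} (hφ : SmoothT φ) : C1T φ :=
  ContDiff.of_le hφ (by exact_mod_cast le_top)

theorem C1T.continuous {φ : T3 → ℝ} (hφ : C1T φ) : Continuous φ :=
  isOpenQuotientMap_proj.isQuotientMap.continuous_iff.mpr (ContDiff.continuous hφ)

theorem C1T.pd_proj {φ : T3 → ℝ} (hφ : C1T φ) (i : Fin 3) (y : Fin 3 → ℝ) :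
    pd i φ (proj y) = fderiv ℝ (fun z => φ (proj z)) y (Pi.single i 1) := by
  have hd : DifferentiableAt ℝ (fun z : Fin 3 → ℝ => φ (proj z)) y :=
    (ContDiff.differentiable hφ (by simp)) y
  unfold pd
  simp only [proj_add_smul]
  exact hd.lineDeriv_eq_fderiv

theorem C1T.continuous_pd {φ : T3 → ℝ} (hφ : C1T φ) (i : Fin 3) : Continuous (pd i φ) := by
  refine isOpenQuotientMap_proj.isQuotientMap.continuous_iff.mpr ?_
  have h : pd i φ ∘ proj = fun y => fderiv ℝ (fun z => φ (proj z)) y (Pi.single i 1) := by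
    funext y; exact hφ.pd_proj i y
  rw [h]
  exact (ContDiff.continuous_fderiv hφ (by simp)).clm_apply continuous_const

theorem proj_surjective : Function.Surjective proj := isOpenQuotientMap_proj.surjective

theorem C1T.hasDerivAt {φ : T3 → ℝ} (hφ : C1T φ) (i : Fin 3) (x : T3) (s : ℝ) :
    HasDerivAt (fun s : ℝ => φ (x + Pi.single i (s : AddCircle (2 * Real.pi))))
      (pd i φ (x + Pi.single i (s : AddCircle (2 * Real.pi)))) s := by
  obtain ⟨y, rfl⟩ := proj_surjective x
  simp only [proj_add_smul, hφ.pd_proj]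
  have hd : DifferentiableAt ℝ (fun z : Fin 3 → ℝ => φ (proj z)) (y + s • Pi.single i (1 : ℝ)) :=
    (ContDiff.differentiable hφ (by simp)) _
  have hl : HasDerivAt (fun s : ℝ => y + s • (Pi.single i (1 : ℝ) : Fin 3 → ℝ))
      (Pi.single i (1 : ℝ)) s := by
    simpa using ((hasDerivAt_id s).smul_const (Pi.single i (1 : ℝ) : Fin 3 → ℝ)).const_add y
  exact hd.hasFDerivAt.comp_hasDerivAt s hl

theorem C1T.hasDerivAt_zero {φ : T3 → ℝ} (hφ : C1T φ) (i : Fin 3) (x : T3) :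
    HasDerivAt (fun s : ℝ => φ (x + Pi.single i (s : AddCircle (2 * Real.pi))))
      (DustEinstein.pd i φ x) 0 := by
  simpa using hφ.hasDerivAt i x 0

theorem C1T.mul {φ ψ : T3 → ℝ} (hφ : C1T φ) (hψ : C1T ψ) : C1T (fun x => φ x * ψ x) :=
  ContDiff.mul hφ hψ

theorem C1T.pd_mul {φ ψ : T3 → ℝ} (hφ : C1T φ) (hψ : C1T ψ) (i : Fin 3) (x : T3) :
    pd i (fun x => φ x * ψ x) x = pd i φ x * ψ x + φ x * pd i ψ x := by
  have h := (hφ.hasDerivAt_zero i x).mul (hψ.hasDerivAt_zero i x)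
  have h2 := h.deriv
  simpa using! h2

theorem exists_bound {f : T3 → ℝ} (hf : Continuous f) : ∃ C, ∀ x, ‖f x‖ ≤ C := by
  obtain ⟨C, hC⟩ := (isCompact_univ (X := T3)).exists_bound_of_continuousOn hf.continuousOn
  exact ⟨C, fun x => hC x (mem_univ x)⟩

theorem integrable_of_continuous {f : T3 → ℝ} (hf : Continuous f) : Integrable f volume :=
  hf.integrable_of_hasCompactSupport (HasCompactSupport.of_compactSpace f)

theorem memLp_of_continuous {f : T3 → ℝ} (hf : Continuous f) : MemLp f 2 volume :=
  hf.memLp_of_hasCompactSupport (HasCompactSupport.of_compactSpace f)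

/-- The integral of a partial derivative over the torus vanishes. -/
theorem C1T.integral_pd {φ : T3 → ℝ} (hφ : C1T φ) (i : Fin 3) : ∫ x, pd i φ x = 0 := by
  obtain ⟨C, hC⟩ := exists_bound (hφ.continuous_pd i)
  -- Translation invariance makes the integral of the `s`-translate of `φ` constant in `s`;
  -- differentiating under the integral sign at `s = 0` produces the integral of `∂_i φ`.
  have h := (hasDerivAt_integral_of_dominated_loc_of_deriv_le (μ := (volume : Measure T3))
    (F := fun (s : ℝ) (x : T3) => φ (x + Pi.single i (s : AddCircle (2 * Real.pi))))
    (F' := fun (s : ℝ) (x : T3) => pd i φ (x + Pi.single i (s : AddCircle (2 * Real.pi))))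
    (x₀ := 0) (s := univ) (bound := fun _ => C) univ_mem
    (Eventually.of_forall fun s => (hφ.continuous.comp (by fun_prop)).aestronglyMeasurable)
    (integrable_of_continuous (hφ.continuous.comp (by fun_prop)))
    ((hφ.continuous_pd i).comp (by fun_prop)).aestronglyMeasurable
    (ae_of_all _ fun x s _ => hC _) (integrable_const C)
    (ae_of_all _ fun x s _ => hφ.hasDerivAt i x s)).2
  have hc : (fun s : ℝ => ∫ x : T3, φ (x + Pi.single i (s : AddCircle (2 * Real.pi)))) =
      fun _ => ∫ x, φ x := by
    funext s
    exact integral_add_right_eq_self (fun x : T3 => φ x)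
      (Pi.single i (s : AddCircle (2 * Real.pi)) : T3)
  rw [hc] at h
  have := h.unique (hasDerivAt_const 0 _)
  simpa using this

theorem C1T.integral_mul_pd {φ ψ : T3 → ℝ} (hφ : C1T φ) (hψ : C1T ψ) (i : Fin 3) :
    ∫ x, φ x * pd i ψ x = -∫ x, pd i φ x * ψ x := by
  have h := (hφ.mul hψ).integral_pd i
  simp only [hφ.pd_mul hψ] at h
  have h2 := integral_add
    (integrable_of_continuous ((hφ.continuous_pd i).mul hψ.continuous))
    (integrable_of_continuous (hφ.continuous.mul (hψ.continuous_pd i)))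
  simp only [Pi.mul_apply] at h2
  linarith

/-! ### Weak derivatives and Fourier coefficients -/

theorem expMon_proj (k : Fin 3 → ℤ) (y : Fin 3 → ℝ) :
    expMon k (proj y) = Complex.exp (∑ j, Complex.I * (k j : ℂ) * (y j : ℂ)) := by
  simp only [expMon, ContinuousMap.coe_mk, proj, fourier_coe_apply, Complex.exp_sum]
  refine Finset.prod_congr rfl fun j _ => ?_
  congr 1
  have : (Real.pi : ℂ) ≠ 0 := by exact_mod_cast Real.pi_ne_zero
  push_cast
  field_simp

/-- The real trigonometric function `Re (z e^{i k·x})`. -/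
noncomputable def trig (k : Fin 3 → ℤ) (z : ℂ) (x : T3) : ℝ := (z * expMon k x).re

theorem smoothT_trig (k : Fin 3 → ℤ) (z : ℂ) : SmoothT (trig k z) := by
  unfold SmoothT trig
  simp only [expMon_proj]
  have h : ∀ j, ContDiff ℝ ∞ fun y : Fin 3 → ℝ => ((y j : ℝ) : ℂ) := fun j =>
    Complex.ofRealCLM.contDiff.comp (contDiff_apply ℝ ℝ j)
  have h2 : ContDiff ℝ ∞ fun y : Fin 3 → ℝ =>
      z * Complex.exp (∑ j, Complex.I * (k j : ℂ) * (y j : ℂ)) :=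
    contDiff_const.mul (ContDiff.cexp (ContDiff.sum fun j _ => contDiff_const.mul (h j)))
  exact Complex.reCLM.contDiff.comp h2

theorem pd_trig (k : Fin 3 → ℤ) (z : ℂ) (i : Fin 3) :
    pd i (trig k z) = trig k (Complex.I * k i * z) := by
  funext x
  obtain ⟨y, rfl⟩ := proj_surjective x
  unfold pd
  simp only [proj_add_smul, trig, expMon_proj]
  have h1 : ∀ s : ℝ, (∑ j, Complex.I * (k j : ℂ) * (((y + s • (Pi.single i (1 : ℝ) : Fin 3 → ℝ)) j : ℝ) : ℂ)) =
      (∑ j, Complex.I * (k j : ℂ) * (y j : ℂ)) + Complex.I * (k i : ℂ) * s := by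
    intro s
    have : ∀ j, Complex.I * (k j : ℂ) * (((y + s • (Pi.single i (1 : ℝ) : Fin 3 → ℝ)) j : ℝ) : ℂ) =
        Complex.I * (k j : ℂ) * (y j : ℂ) + if j = i then Complex.I * (k j : ℂ) * s else 0 := by
      intro j
      by_cases h : j = i
      · subst h; simp; ring
      · simp [h]
    simp only [this, Finset.sum_add_distrib, Finset.sum_ite_eq', Finset.mem_univ, if_true]
  simp only [h1]
  set c := ∑ j, Complex.I * (k j : ℂ) * (y j : ℂ)
  have h2 : HasDerivAt (fun s : ℝ => z * Complex.exp (c + Complex.I * (k i : ℂ) * s))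
      (Complex.I * k i * z * Complex.exp c) 0 := by
    have h3 : HasDerivAt (fun s : ℂ => z * Complex.exp (c + Complex.I * (k i : ℂ) * s))
      (z * (Complex.exp (c + Complex.I * (k i : ℂ) * (0 : ℝ)) * (Complex.I * (k i : ℂ) * 1)))
        ((0 : ℝ) : ℂ) :=
      ((((hasDerivAt_id _).const_mul _).const_add c).cexp).const_mul z
    have h4 := h3.comp_ofReal
    convert h4 using 1
    simp; ring
  have h5 := (Complex.reCLM.hasFDerivAt.comp_hasDerivAt (0 : ℝ) h2).deriv
  simpa using! h5

theorem pd_iterate_trig (k : Fin 3 → ℤ) (z : ℂ) (i : Fin 3) (n : ℕ) :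
    (pd i)^[n] (trig k z) = trig k ((Complex.I * k i) ^ n * z) := by
  induction n with
  | zero => simp
  | succ n ih => rw [Function.iterate_succ_apply', ih, pd_trig]; congr 1; ring

theorem pdMulti_trig (k : Fin 3 → ℤ) (z : ℂ) (α : Fin 3 → ℕ) :
    pdMulti α (trig k z) = trig k ((∏ i, (Complex.I * k i) ^ α i) * z) := by
  unfold pdMulti
  rw [pd_iterate_trig, pd_iterate_trig, pd_iterate_trig, Fin.prod_univ_three]
  congr 1; ring

theorem integrable_mul_expMon {f : T3 → ℝ} (hf : Integrable f volume) (k : Fin 3 → ℤ) :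
    Integrable (fun x => (f x : ℂ) * expMon k x) volume := by
  refine (hf.ofReal (𝕜 := ℂ)).mul_bdd (c := 1) (expMon k).continuous.aestronglyMeasurable
    (ae_of_all _ fun x => (norm_expMon k x).le)

theorem integral_mul_trig {f : T3 → ℝ} (hf : Integrable f volume) (k : Fin 3 → ℤ) (z : ℂ) :
    ∫ x, f x * trig (-k) z x = (z * coef f k).re := by
  rw [coef, ← integral_const_mul, ← Complex.reCLM_apply,
    ← Complex.reCLM.integral_comp_comm ((integrable_mul_expMon hf (-k)).const_mul z)]
  refine integral_congr_ae (ae_of_all _ fun x => ?_)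
  simp only [trig, Complex.reCLM_apply]
  rw [show z * ((f x : ℂ) * expMon (-k) x) = (f x : ℂ) * (z * expMon (-k) x) by ring,
    Complex.re_ofReal_mul]

/-- Test functions are real, so the relation is tested against `Re (z e^{-i k·x})` with a free
complex factor `z`. Using plain integrable functions instead of elements of `L²` lets the same
argument serve classical derivatives in `C1T.coef_pd`. -/
theorem coef_of_weak {f f' : T3 → ℝ} (hf : Integrable f volume) (hf' : Integrable f' volume)
    {α : Fin 3 → ℕ} (h : ∀ φ : T3 → ℝ, SmoothT φ →
      ∫ x, f x * pdMulti α φ x = (-1 : ℝ) ^ (∑ i, α i) * ∫ x, f' x * φ x) (k : Fin 3 → ℤ) :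
    coef f' k = (∏ i, (Complex.I * k i) ^ α i) * coef f k := by
  have key : ∀ z : ℂ, (z * ((∏ i, (Complex.I * k i) ^ α i) * coef f k)).re =
      (z * coef f' k).re := by
    intro z
    have h1 := h _ (smoothT_trig (-k) z)
    rw [pdMulti_trig, integral_mul_trig hf, integral_mul_trig hf'] at h1
    have h2 : (∏ i, (Complex.I * ((-k) i : ℤ)) ^ α i) =
        ((-1 : ℝ) ^ (∑ i, α i) : ℝ) * ∏ i, (Complex.I * k i) ^ α i := by
      push_cast
      rw [← Finset.prod_pow_eq_pow_sum, ← Finset.prod_mul_distrib]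
      refine Finset.prod_congr rfl fun i _ => ?_
      rw [← mul_pow]; congr 1; simp
    rw [h2, mul_assoc, mul_assoc, Complex.re_ofReal_mul] at h1
    have h3 := mul_left_cancel₀ (pow_ne_zero _ (by norm_num)) h1
    rw [← h3]; congr 1; ring
  -- The choices `z = 1` and `z = -i` isolate the real and the imaginary part.
  have h1 := key 1
  have h2 := key (-Complex.I)
  apply Complex.ext
  · simpa using h1.symm
  · simpa using h2.symm

theorem IsWeakDeriv.coef {α : Fin 3 → ℕ} {f f' : L2} (h : IsWeakDeriv α f f') (k : Fin 3 → ℤ) :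
    coef f' k = (∏ i, (Complex.I * k i) ^ α i) * DustEinstein.coef f k :=
  coef_of_weak ((Lp.memLp f).integrable (by norm_num)) ((Lp.memLp f').integrable (by norm_num)) h k

theorem pdMulti_single (i : Fin 3) (φ : T3 → ℝ) : pdMulti (Pi.single i 1) φ = pd i φ := by
  fin_cases i <;> simp [pdMulti]

theorem prod_pow_single (k : Fin 3 → ℤ) (i : Fin 3) (n : ℕ) :
    ∏ j, (Complex.I * k j) ^ (Pi.single i n : Fin 3 → ℕ) j = (Complex.I * k i) ^ n := by
  rw [Finset.prod_eq_single i]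
  · simp
  · intro j _ hj; simp [hj]
  · simp

theorem C1T.coef_pd {φ : T3 → ℝ} (hφ : C1T φ) (i : Fin 3) (k : Fin 3 → ℤ) :
    coef (pd i φ) k = Complex.I * k i * coef φ k := by
  have h := coef_of_weak (integrable_of_continuous hφ.continuous)
    (integrable_of_continuous (hφ.continuous_pd i)) (α := Pi.single i 1) (fun ψ hψ => by
      rw [pdMulti_single, hφ.integral_mul_pd hψ.c1T]; simp) k
  rw [h, prod_pow_single, pow_one]

/-- By Parseval, integration by parts is the fact that `i k_i` is purely imaginary. This enlarges
the class of test functions from smooth to `C¹`, as the product rule with a merely `C¹` coefficient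
requires. -/
theorem integral_mul_pd_of_coef {f f' : L2} {i : Fin 3}
    (h : ∀ k, coef f' k = Complex.I * k i * coef f k) {φ : T3 → ℝ} (hφ : C1T φ) :
    ∫ x, f x * pd i φ x = -∫ x, f' x * φ x := by
  have h1 := hasSum_coef_mul (Lp.memLp f) (memLp_of_continuous (hφ.continuous_pd i))
  have h2 := (hasSum_coef_mul (Lp.memLp f') (memLp_of_continuous hφ.continuous)).neg
  have h3 : (fun k => (nrm : ℂ) ^ 2 * (conj (coef f k) * coef (pd i φ) k)) =
      fun k => -((nrm : ℂ) ^ 2 * (conj (coef f' k) * coef φ k)) := by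
    funext k
    rw [hφ.coef_pd, h k]
    simp only [map_mul, Complex.conj_I, map_intCast]
    ring
  rw [h3] at h1
  exact_mod_cast h1.unique h2

/-- First-order weak derivatives become Fourier multipliers, so that they can be composed and
compared by algebra in the frequency variable. -/
theorem isWeakDeriv_single_iff {f f' : L2} {i : Fin 3} :
    IsWeakDeriv (Pi.single i 1) f f' ↔ ∀ k, coef f' k = Complex.I * k i * coef f k := by
  refine ⟨fun h k => by rw [h.coef, prod_pow_single, pow_one], fun h φ hφ => ?_⟩
  rw [pdMulti_single, integral_mul_pd_of_coef h hφ.c1T]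
  simp

theorem IsWeakDeriv.integral_mul_pd {f f' : L2} {i : Fin 3} (h : IsWeakDeriv (Pi.single i 1) f f')
    {φ : T3 → ℝ} (hφ : C1T φ) : ∫ x, f x * pd i φ x = -∫ x, f' x * φ x :=
  integral_mul_pd_of_coef (isWeakDeriv_single_iff.1 h) hφ

/-! ### Multiplication by continuous functions -/

theorem memLp_mul {f : T3 → ℝ} (hf : Continuous f) (w : L2) :
    MemLp (fun x => f x * w x) 2 volume := by
  obtain ⟨C, hC⟩ := exists_bound hf
  refine MemLp.of_le_mul (c := C) (Lp.memLp w)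
    (hf.aestronglyMeasurable.mul (Lp.aestronglyMeasurable w)) (ae_of_all _ fun x => ?_)
  rw [norm_mul]
  exact mul_le_mul_of_nonneg_right (hC x) (norm_nonneg _)

theorem coeFn_mulL2 {f : T3 → ℝ} (hf : Continuous f) (w : L2) :
    mulL2 f w =ᵐ[volume] fun x => f x * w x := by
  rw [mulL2, dif_pos (memLp_mul hf w)]
  exact MemLp.coeFn_toLp _

theorem norm_mulL2_le {f : T3 → ℝ} (hf : Continuous f) (w : L2) {C : ℝ}
    (hC : ∀ x, |f x| ≤ C) : ‖mulL2 f w‖ ≤ C * ‖w‖ := by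
  refine Lp.norm_le_mul_norm_of_ae_le_mul ?_
  filter_upwards [coeFn_mulL2 hf w] with x hx
  rw [hx, norm_mul]
  exact mul_le_mul_of_nonneg_right (hC x) (norm_nonneg _)

/-- The product rule for a `C¹` function and a weakly differentiable function. -/
theorem IsWeakDeriv.mulL2 {f : T3 → ℝ} (hf : C1T f) {w w' : L2} {i : Fin 3}
    (h : IsWeakDeriv (Pi.single i 1) w w') :
    IsWeakDeriv (Pi.single i 1) (mulL2 f w)
      (DustEinstein.mulL2 (pd i f) w + DustEinstein.mulL2 f w') := by
  intro φ hφ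
  -- The weak derivative of `w` is tested against `f φ`, which is only `C¹`.
  have h1 := h.integral_mul_pd (hf.mul hφ.c1T)
  simp only [hf.pd_mul hφ.c1T] at h1
  have e1 : ∫ x, DustEinstein.mulL2 f w x * pdMulti (Pi.single i 1) φ x =
      ∫ x, w x * (f x * pd i φ x) := by
    rw [pdMulti_single]
    refine integral_congr_ae ?_
    filter_upwards [coeFn_mulL2 hf.continuous w] with x hx
    rw [hx]; ring
  have e2 : ∫ x, (DustEinstein.mulL2 (pd i f) w + DustEinstein.mulL2 f w' : L2) x * φ x =
      (∫ x, w x * (pd i f x * φ x)) + ∫ x, w' x * (f x * φ x) := by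
    rw [← integral_add]
    · refine integral_congr_ae ?_
      filter_upwards [Lp.coeFn_add (DustEinstein.mulL2 (pd i f) w) (DustEinstein.mulL2 f w'),
        coeFn_mulL2 (hf.continuous_pd i) w, coeFn_mulL2 hf.continuous w'] with x h1 h2 h3
      rw [h1, Pi.add_apply, h2, h3]; ring
    · exact (Lp.memLp w).integrable_mul
        (memLp_of_continuous ((hf.continuous_pd i).mul hφ.continuous))
    · exact (Lp.memLp w').integrable_mul
        (memLp_of_continuous (hf.continuous.mul hφ.continuous))
  have e3 : ∫ x, w x * (pd i f x * φ x + f x * pd i φ x) =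
      (∫ x, w x * (pd i f x * φ x)) + ∫ x, w x * (f x * pd i φ x) := by
    rw [← integral_add]
    · simp only [mul_add]
    · exact (Lp.memLp w).integrable_mul
        (memLp_of_continuous ((hf.continuous_pd i).mul hφ.continuous))
    · exact (Lp.memLp w).integrable_mul
        (memLp_of_continuous (hf.continuous.mul (hφ.pd i).continuous))
  rw [e1, e2]
  simp only [Finset.sum_pi_single', Finset.mem_univ, if_true, pow_one]
  rw [e3] at h1
  linarith

/-! ### The Sobolev inequality -/

/-- The summable Sobolev weight `(1 + |k|²)⁻¹` on the frequencies. -/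
noncomputable def sobWeight (k : Fin 3 → ℤ) : ℝ := (1 + ∑ i, (k i : ℝ) ^ 2)⁻¹

theorem sobWeight_pos (k : Fin 3 → ℤ) : 0 < sobWeight k := by unfold sobWeight; positivity

theorem summable_one_add_sq_rpow : Summable fun n : ℤ => (1 + (n : ℝ) ^ 2) ^ (-(2 / 3) : ℝ) := by
  refine Summable.of_norm_bounded_eventually
    (Real.summable_abs_int_rpow (b := 4 / 3) (by norm_num)) ?_
  -- The comparison with `|n| ^ (-4/3)` fails only at `n = 0`, where the real power is `0` by
  -- convention.
  refine (Set.finite_singleton (0 : ℤ)).subset fun n hn => ?_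
  by_contra h0
  apply hn
  have h1 : (0 : ℝ) < |(n : ℝ)| := abs_pos.2 (by exact_mod_cast h0)
  change ‖(1 + (n : ℝ) ^ 2) ^ (-(2 / 3) : ℝ)‖ ≤ |(n : ℝ)| ^ (-(4 / 3) : ℝ)
  rw [Real.norm_of_nonneg (by positivity),
    show (-(4 / 3) : ℝ) = (2 : ℕ) * (-(2 / 3)) by norm_num, Real.rpow_mul h1.le, Real.rpow_natCast,
    sq_abs]
  exact Real.rpow_le_rpow_of_nonpos (by rw [← sq_abs]; positivity) (by linarith) (by norm_num)

/-- The power `-2` of `1 + |k|²` is split into three powers `-2/3`, one per coordinate. Each is at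
most `(1 + k_i²)^{-2/3}`, so the series is dominated by a product of three convergent
one-dimensional series. -/
theorem summable_sobWeight_sq : Summable fun k => sobWeight k ^ 2 := by
  set p : ℤ → ℝ := fun n => (1 + (n : ℝ) ^ 2) ^ (-(2 / 3) : ℝ)
  have hp : ∀ n, 0 ≤ p n := fun n => by positivity
  have h2 : Summable fun z : ℤ × ℤ => p z.1 * p z.2 :=
    summable_one_add_sq_rpow.mul_of_nonneg summable_one_add_sq_rpow hp hp
  have h3 : Summable fun z : ℤ × ℤ × ℤ => p z.1 * (p z.2.1 * p z.2.2) :=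
    summable_one_add_sq_rpow.mul_of_nonneg h2 hp fun z => mul_nonneg (hp _) (hp _)
  have h4 := h3.comp_injective (i := fun k : Fin 3 → ℤ => (k 0, k 1, k 2)) (by
    intro k l h
    simp only [Prod.mk.injEq] at h
    funext i
    fin_cases i
    exacts [h.1, h.2.1, h.2.2])
  refine Summable.of_nonneg_of_le (fun k => by positivity) (fun k => ?_) h4
  have hS : ∀ i, 1 + (k i : ℝ) ^ 2 ≤ 1 + ∑ j, (k j : ℝ) ^ 2 := fun i => by
    have := Finset.single_le_sum (f := fun j => (k j : ℝ) ^ 2) (fun _ _ => sq_nonneg _)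
      (Finset.mem_univ i)
    linarith
  have hle : ∀ i, (1 + ∑ j, (k j : ℝ) ^ 2) ^ (-(2 / 3) : ℝ) ≤ p (k i) := fun i =>
    Real.rpow_le_rpow_of_nonpos (by positivity) (hS i) (by norm_num)
  have hpos : 0 < 1 + ∑ j, (k j : ℝ) ^ 2 := by positivity
  have h5 : sobWeight k ^ 2 = (1 + ∑ j, (k j : ℝ) ^ 2) ^ (-(2 / 3) : ℝ) *
      ((1 + ∑ j, (k j : ℝ) ^ 2) ^ (-(2 / 3) : ℝ) * (1 + ∑ j, (k j : ℝ) ^ 2) ^ (-(2 / 3) : ℝ)) := by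
    rw [← Real.rpow_add hpos, ← Real.rpow_add hpos, sobWeight, inv_pow, ← Real.rpow_natCast,
      ← Real.rpow_neg hpos.le]
    norm_num
  rw [h5]
  simp only [Function.comp_def]
  gcongr <;> exact hle _

/-- The `ℓ²` norm of the Sobolev weight. -/
noncomputable def sobWeightNorm : ℝ := Real.sqrt (∑' k, sobWeight k ^ 2)

theorem summable_weight_mul {c : (Fin 3 → ℤ) → ℝ} (hc : ∀ k, 0 ≤ c k) {S : ℝ}
    (hS : 0 ≤ S) (h : HasSum (fun k => nrm ^ 2 * c k ^ 2) (S ^ 2)) :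
    Summable (fun k => sobWeight k * c k) ∧
      ∑' k, sobWeight k * c k ≤ sobWeightNorm * (nrm⁻¹ * S) := by
  have hn := nrm_pos
  have h1 : HasSum (fun k => c k ^ 2) ((nrm⁻¹ * S) ^ 2) := by
    have e1 : (fun k => c k ^ 2) = fun k => nrm⁻¹ ^ 2 * (nrm ^ 2 * c k ^ 2) := by
      funext k; field_simp
    rw [e1, mul_pow]
    exact h.mul_left (nrm⁻¹ ^ 2)
  have h2 := Real.summable_and_inner_le_Lp_mul_Lq_tsum_of_nonneg (p := 2) (q := 2)
    (f := sobWeight) (g := c) Real.HolderConjugate.two_two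
    (fun k => (sobWeight_pos k).le) hc (by simpa using summable_sobWeight_sq)
    (by simpa using h1.summable)
  refine ⟨h2.1, h2.2.trans (le_of_eq ?_)⟩
  simp only [Real.rpow_ofNat]
  rw [h1.tsum_eq, ← Real.sqrt_eq_rpow, ← Real.sqrt_eq_rpow, Real.sqrt_sq (by positivity),
    sobWeightNorm]

/-- With absolutely summable coefficients the Fourier series converges uniformly; its sum is `f`,
because it converges to `f` in `L²` and `f` is continuous. The bound then holds at every point, not
only almost everywhere. -/
theorem abs_le_tsum_coef {f : T3 → ℝ} (hf : Continuous f) (h : Summable fun k => ‖coef f k‖)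
    (x : T3) : |f x| ≤ nrm ^ 2 * ∑' k, ‖coef f k‖ := by
  let F : C(T3, ℂ) := ⟨fun x => (f x : ℂ), by fun_prop⟩
  have hn : ∀ k, ‖expMon k‖ ≤ 1 := fun k =>
    (ContinuousMap.norm_le _ zero_le_one).2 fun x => (norm_expMon k x).le
  have hs : Summable fun k => ((nrm : ℂ) ^ 2 * coef f k) • expMon k := by
    refine Summable.of_norm_bounded (h.mul_left (nrm ^ 2)) fun k => ?_
    rw [norm_smul, norm_mul, norm_pow, Complex.norm_real, Real.norm_of_nonneg nrm_pos.le]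
    exact mul_le_of_le_one_right (by positivity) (hn k)
  have hL : ContinuousMap.toLp (E := ℂ) 2 (volume : Measure T3) ℂ F =
      ((memLp_of_continuous hf).ofReal (K := ℂ)).toLp := by
    apply Lp.ext
    filter_upwards [ContinuousMap.coeFn_toLp (p := 2) (𝕜 := ℂ) (volume : Measure T3) F,
      ((memLp_of_continuous hf).ofReal (K := ℂ)).coeFn_toLp] with x h1 h2
    rw [h1, h2]; rfl
  have hsum : HasSum (fun k => ((nrm : ℂ) ^ 2 * coef f k) • expMon k) F := by
    refine ContinuousMap.hasSum_of_hasSum_Lp (p := 2) (𝕜 := ℂ) (μ := (volume : Measure T3)) hs ?_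
    have h1 := expBasis.hasSum_repr (ContinuousMap.toLp (E := ℂ) 2 (volume : Measure T3) ℂ F)
    refine h1.congr_fun fun k => ?_
    rw [HilbertBasis.repr_apply_apply, hL, inner_expBasis (memLp_of_continuous hf), coe_expBasis, expMonLp, smul_smul]
    refine (map_smul (ContinuousMap.toLp (E := ℂ) 2 (volume : Measure T3) ℂ) _ _).trans ?_
    congr 1
    ring
  have hx : HasSum (fun k => ((nrm : ℂ) ^ 2 * coef f k) • expMon k x) (f x : ℂ) :=
    (ContinuousMap.evalCLM ℂ x).hasSum hsum
  have := tsum_of_norm_bounded (h.mul_left (nrm ^ 2)).hasSum (f := fun k =>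
    ((nrm : ℂ) ^ 2 * coef f k) • expMon k x) (fun k => by
      rw [norm_smul, norm_mul, norm_pow, Complex.norm_real, Real.norm_of_nonneg nrm_pos.le,
        norm_expMon, mul_one])
  rw [hx.tsum_eq, Complex.norm_real, Real.norm_eq_abs, tsum_mul_left] at this
  exact this

/-- The constant of the Sobolev embedding `H²(𝕋³) ⊂ L^∞(𝕋³)`. -/
noncomputable def sobConst : ℝ := 4 * nrm * sobWeightNorm + 1

theorem sobConst_pos : 0 < sobConst := by
  have := nrm_pos
  unfold sobConst sobWeightNorm; positivity

/-- The strict inequality is what allows actual weak derivatives to be extracted from the infimum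
defining `weakDerivNorm`. The nonstrict version follows by enlarging `B` slightly. -/
theorem abs_le_of_sobNorm_lt {k : ℕ} (hk : 2 ≤ k) {f : T3 → ℝ} (hf : Continuous f) {B : ℝ}
    (h : sobNorm k f < ENNReal.ofReal B) (x : T3) : |f x| ≤ sobConst * B := by
  have hB : 0 < B := by
    by_contra hB
    rw [ENNReal.ofReal_of_nonpos (not_lt.1 hB)] at h
    exact not_lt_bot h
  have hα : ∀ α ∈ multiIdx k, weakDerivNorm α f < ENNReal.ofReal B := by
    intro α hα
    refine lt_of_le_of_lt ?_ h
    rw [sobNorm]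
    calc weakDerivNorm α f = (weakDerivNorm α f ^ 2) ^ (1 / 2 : ℝ) := by
          rw [← ENNReal.rpow_natCast, ← ENNReal.rpow_mul]; norm_num
      _ ≤ _ := by
          gcongr
          exact Finset.single_le_sum (f := fun α => weakDerivNorm α f ^ 2)
            (fun _ _ => zero_le) hα
  have hrep : ∀ α ∈ multiIdx k, ∃ F' : L2, ‖F'‖ ≤ B ∧
      ∀ k, coef F' k = (∏ i, (Complex.I * k i) ^ α i) * coef f k := by
    intro α hα'
    have := hα α hα'
    simp only [weakDerivNorm, iInf_lt_iff] at this
    obtain ⟨F, F', hF, hF', hlt⟩ := this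
    refine ⟨F', ?_, fun k => ?_⟩
    · rw [← ofReal_norm] at hlt
      exact ((ENNReal.ofReal_lt_ofReal_iff hB).1 hlt).le
    · rw [hF'.coef, coef_congr hF]
  obtain ⟨F, hFB, hF⟩ := hrep 0 (mem_multiIdx.2 (by simp))
  have hrep2 : ∀ i : Fin 3, ∃ F' : L2, ‖F'‖ ≤ B ∧
      ∀ k, coef F' k = (Complex.I * k i) ^ 2 * coef f k := by
    intro i
    obtain ⟨F', h1, h2⟩ := hrep (Pi.single i 2) (mem_multiIdx.2 (by simpa using hk))
    exact ⟨F', h1, fun k => by rw [h2, prod_pow_single]⟩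
  choose G hGB hG using hrep2
  have sF := summable_weight_mul (fun k => norm_nonneg _) (norm_nonneg F) (hasSum_sq_coef_L2 F)
  have sG := fun i => summable_weight_mul (fun k => norm_nonneg _) (norm_nonneg (G i))
    (hasSum_sq_coef_L2 (G i))
  -- Multiply and divide by `1 + |k|²`: only `f` itself and its three pure second derivatives enter,
  -- and Cauchy–Schwarz against the square-summable weight handles each.
  have hdec : ∀ k, ‖coef f k‖ = sobWeight k * ‖coef F k‖ + ∑ i, sobWeight k * ‖coef (G i) k‖ := by
    intro k
    rw [hF k]
    simp only [hG]
    simp only [Pi.zero_apply, pow_zero, Finset.prod_const_one, one_mul, norm_mul, norm_pow,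
      Complex.norm_I, Complex.norm_intCast, sq_abs]
    rw [← Finset.mul_sum, ← Finset.sum_mul, ← mul_add, ← one_add_mul, ← mul_assoc, sobWeight,
      inv_mul_cancel₀ (by positivity), one_mul]
  have hsum : Summable fun k => ‖coef f k‖ := by
    simp only [hdec]
    exact sF.1.add (summable_sum fun i _ => (sG i).1)
  refine (abs_le_tsum_coef hf hsum x).trans ?_
  -- The factor `4` counts `f` and its three pure second derivatives. The extra `1` in `sobConst`
  -- only makes that constant evidently positive.
  have htot : ∑' k, ‖coef f k‖ ≤ 4 * (sobWeightNorm * (nrm⁻¹ * B)) := by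
    simp only [hdec]
    rw [sF.1.tsum_add (summable_sum fun i _ => (sG i).1),
      Summable.tsum_finsetSum fun i _ => (sG i).1]
    have hb : ∀ b ≤ B, sobWeightNorm * (nrm⁻¹ * b) ≤ sobWeightNorm * (nrm⁻¹ * B) := by
      intro b hb
      have := nrm_pos
      have : 0 ≤ sobWeightNorm := Real.sqrt_nonneg _
      gcongr
    have h1 := sF.2.trans (hb _ hFB)
    have h2 := Finset.sum_le_sum fun i (_ : i ∈ (Finset.univ : Finset (Fin 3))) =>
      (sG i).2.trans (hb _ (hGB i))
    simp only [Finset.sum_const, Finset.card_univ, Fintype.card_fin] at h2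
    norm_num at h2
    linarith
  have hn := nrm_pos
  calc nrm ^ 2 * ∑' k, ‖coef f k‖ ≤ nrm ^ 2 * (4 * (sobWeightNorm * (nrm⁻¹ * B))) := by gcongr
    _ = 4 * nrm * sobWeightNorm * B := by field_simp
    _ ≤ sobConst * B := by unfold sobConst; nlinarith

/-- The Sobolev embedding `H^k(𝕋³) ⊂ L^∞(𝕋³)` for `k ≥ 2`. -/
theorem abs_le_of_sobNorm_le {k : ℕ} (hk : 2 ≤ k) {f : T3 → ℝ} (hf : Continuous f) {B : ℝ}
    (hB : 0 ≤ B) (h : sobNorm k f ≤ ENNReal.ofReal B) (x : T3) : |f x| ≤ sobConst * B := by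
  have h1 : ∀ η > 0, |f x| ≤ sobConst * B + η := by
    intro η hη
    have hK := sobConst_pos
    have := abs_le_of_sobNorm_lt hk hf (B := B + η / sobConst) (h.trans_lt
      ((ENNReal.ofReal_lt_ofReal_iff (by positivity)).2 (by linarith [div_pos hη hK]))) x
    rw [mul_add, mul_div_cancel₀ _ hK.ne'] at this
    exact this
  exact le_of_forall_pos_le_add h1

/-! ### The constant coefficient elliptic estimate -/

theorem coef_add (f g : L2) (k : Fin 3 → ℤ) : coef (f + g : L2) k = coef f k + coef g k := by
  rw [coef, coef, coef, ← integral_add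
    (integrable_mul_expMon ((Lp.memLp f).integrable (by norm_num)) _)
    (integrable_mul_expMon ((Lp.memLp g).integrable (by norm_num)) _)]
  refine integral_congr_ae ?_
  filter_upwards [Lp.coeFn_add f g] with x hx
  rw [hx, Pi.add_apply]; push_cast; ring

theorem coef_smul (c : ℝ) (f : L2) (k : Fin 3 → ℤ) : coef (c • f : L2) k = c * coef f k := by
  rw [coef, coef, ← integral_const_mul]
  refine integral_congr_ae ?_
  filter_upwards [Lp.coeFn_smul c f] with x hx
  rw [hx, Pi.smul_apply, smul_eq_mul]; push_cast; ring

/-- The Fourier coefficient as a linear functional. -/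
noncomputable def coefLM (k : Fin 3 → ℤ) : L2 →ₗ[ℝ] ℂ where
  toFun f := coef f k
  map_add' f g := coef_add f g k
  map_smul' c f := by simp [coef_smul]

theorem H2.coef_d1 (w : H2) (a : Fin 3) (k : Fin 3 → ℤ) :
    coef (w.d1 a) k = Complex.I * k a * coef w.val k := by
  have h : IsWeakDeriv (Pi.single a 1) w.val (w.d1 a) :=
    w.2 ⟨Pi.single a 1, mem_multiIdx.mpr (by simp)⟩
  rw [h.coef, prod_pow_single, pow_one]

theorem H2.coef_d2 (w : H2) (a b : Fin 3) (k : Fin 3 → ℤ) :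
    coef (w.d2 a b) k = -((k a : ℝ) * (k b : ℝ) : ℝ) * coef w.val k := by
  have h : IsWeakDeriv (Pi.single a 1 + Pi.single b 1) w.val (w.d2 a b) :=
    w.2 ⟨Pi.single a 1 + Pi.single b 1, mem_multiIdx.mpr (by simp [Finset.sum_add_distrib])⟩
  rw [h.coef]
  simp only [Pi.add_apply, pow_add, Finset.prod_mul_distrib]
  rw [prod_pow_single, prod_pow_single]
  push_cast
  linear_combination (k a : ℂ) * k b * coef w.val k * Complex.I_sq

theorem H2.isWeakDeriv_val (w : H2) (a : Fin 3) : IsWeakDeriv (Pi.single a 1) w.val (w.d1 a) :=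
  isWeakDeriv_single_iff.2 (w.coef_d1 a)

/-- An element of `H²` records each derivative as a weak derivative of the underlying function; that
they are also iterated derivatives of one another is read off from the Fourier coefficients. -/
theorem H2.isWeakDeriv_d1 (w : H2) (a b : Fin 3) :
    IsWeakDeriv (Pi.single a 1) (w.d1 b) (w.d2 a b) := by
  refine isWeakDeriv_single_iff.2 fun k => ?_
  rw [w.coef_d2, w.coef_d1]
  push_cast
  linear_combination -(k a : ℂ) * k b * coef w.val k * Complex.I_sq

theorem H2.d2_comm (w : H2) (a b : Fin 3) : w.d2 a b = w.d2 b a := by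
  have h : (⟨Pi.single a 1 + Pi.single b 1, mem_multiIdx.mpr (by simp [Finset.sum_add_distrib])⟩ :
      multiIdx 2) = ⟨Pi.single b 1 + Pi.single a 1, mem_multiIdx.mpr
        (by simp [Finset.sum_add_distrib])⟩ := Subtype.ext (add_comm _ _)
  unfold H2.d2
  rw [h]

/-- The elliptic estimate for operators with constant coefficients. -/
theorem H2.norm_d2_le (w : H2) {A : Fin 3 → Fin 3 → ℝ} {l : ℝ} (hl : 0 < l)
    (hA : ∀ X : Fin 3 → ℝ, l * ∑ i, X i ^ 2 ≤ ∑ i, ∑ j, A i j * X i * X j) (a b : Fin 3) :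
    ‖w.d2 a b‖ ≤ l⁻¹ * ‖∑ i, ∑ j, A i j • w.d2 i j‖ := by
  set L : L2 := ∑ i, ∑ j, A i j • w.d2 i j
  have hL : ∀ k, coef L k = -((∑ i, ∑ j, A i j * k i * k j : ℝ) : ℂ) * coef w.val k := by
    intro k
    have h1 : coef L k = ∑ i, ∑ j, (A i j : ℂ) * coef (w.d2 i j) k := by
      change coefLM k L = _
      simp only [L, map_sum, map_smul]
      rfl
    rw [h1]
    simp only [w.coef_d2]
    push_cast
    rw [← Finset.sum_neg_distrib, Finset.sum_mul]
    refine Finset.sum_congr rfl fun i _ => ?_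
    rw [← Finset.sum_neg_distrib, Finset.sum_mul]
    exact Finset.sum_congr rfl fun j _ => by ring
  -- The estimate holds frequency by frequency, since `|k_a k_b| ≤ |k|² ≤ l⁻¹ ∑ A_{ij} k_i k_j`.
  -- Parseval then sums it.
  have hpt : ∀ k, ‖coef (w.d2 a b) k‖ ≤ l⁻¹ * ‖coef L k‖ := by
    intro k
    rw [hL, w.coef_d2, norm_mul, norm_mul, norm_neg, norm_neg, Complex.norm_real,
      Complex.norm_real, ← mul_assoc]
    refine mul_le_mul_of_nonneg_right ?_ (norm_nonneg _)
    have h1 := hA fun i => (k i : ℝ)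
    have h2 : |(k a : ℝ) * k b| ≤ ∑ i, (k i : ℝ) ^ 2 := by
      rw [abs_le]
      have e1 : (k a : ℝ) ^ 2 ≤ ∑ i, (k i : ℝ) ^ 2 := Finset.single_le_sum
        (f := fun i => (k i : ℝ) ^ 2) (fun _ _ => sq_nonneg _) (Finset.mem_univ a)
      have e2 : (k b : ℝ) ^ 2 ≤ ∑ i, (k i : ℝ) ^ 2 := Finset.single_le_sum
        (f := fun i => (k i : ℝ) ^ 2) (fun _ _ => sq_nonneg _) (Finset.mem_univ b)
      constructor <;> nlinarith [sq_nonneg ((k a : ℝ) + k b), sq_nonneg ((k a : ℝ) - k b)]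
    rw [Real.norm_eq_abs, Real.norm_eq_abs]
    refine h2.trans ((le_inv_mul_iff₀ hl).2 (h1.trans (le_abs_self _)))
  have h1 := hasSum_sq_coef_L2 (w.d2 a b)
  have h2 := (hasSum_sq_coef_L2 L).mul_left (l⁻¹ ^ 2)
  have h3 : ‖w.d2 a b‖ ^ 2 ≤ l⁻¹ ^ 2 * ‖L‖ ^ 2 := by
    refine hasSum_le (fun k => ?_) h1 h2
    calc nrm ^ 2 * ‖coef (w.d2 a b) k‖ ^ 2 ≤ nrm ^ 2 * (l⁻¹ * ‖coef L k‖) ^ 2 := by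
          gcongr; exact hpt k
      _ = _ := by ring
  rw [← mul_pow] at h3
  exact (pow_le_pow_iff_left₀ (norm_nonneg _) (by positivity) two_ne_zero).1 h3

/-! ### Calculus on the slab -/

/-- Time derivatives are taken within `[0, ∞)`, while regularity is known on `[0, T)`; the two agree
locally at every `t < T`. -/
theorem Ico_mem_nhdsWithin_Ici {T t : ℝ} (ht : t ∈ Ico 0 T) : Ico 0 T ∈ 𝓝[Ici 0] t := by
  rw [← Ici_inter_Iio]
  exact inter_mem_nhdsWithin _ (Iio_mem_nhds ht.2)

theorem uniqueDiffOn_slab (T : ℝ) :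
    UniqueDiffOn ℝ (Ico 0 T ×ˢ (univ : Set (Fin 3 → ℝ))) :=
  (uniqueDiffOn_Ico 0 T).prod uniqueDiffOn_univ

section Slab

variable {n : ℕ} {T : ℝ} {F G : ℝ → T3 → ℝ}

theorem ContDiffSlab.hasDerivWithinAt_aux (hF : ContDiffSlab (n + 1) T F) {t : ℝ}
    (ht : t ∈ Ico 0 T) (y : Fin 3 → ℝ) :
    HasDerivWithinAt (fun s => F s (proj y))
      (fderivWithin ℝ (fun p : ℝ × (Fin 3 → ℝ) => F p.1 (proj p.2)) (Ico 0 T ×ˢ univ) (t, y) (1, 0))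
      (Ici 0) t := by
  have h1 := (ContDiffOn.differentiableOn hF (by simp) (t, y) ⟨ht, mem_univ _⟩).hasFDerivWithinAt
  have h2 : HasDerivWithinAt (fun s : ℝ => (s, y)) ((1 : ℝ), (0 : Fin 3 → ℝ)) (Ico 0 T) t :=
    (hasDerivWithinAt_id t _).prodMk (hasDerivWithinAt_const _ _ _)
  exact (h1.comp_hasDerivWithinAt t h2 (show MapsTo (fun s : ℝ => (s, y)) (Ico 0 T)
    (Ico 0 T ×ˢ univ) from fun s hs => ⟨hs, mem_univ _⟩)).mono_of_mem_nhdsWithin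
    (Ico_mem_nhdsWithin_Ici ht)

theorem ContDiffSlab.hasDerivWithinAt (hF : ContDiffSlab (n + 1) T F) {t : ℝ}
    (ht : t ∈ Ico 0 T) (x : T3) :
    HasDerivWithinAt (fun s => F s x) (dt F t x) (Ici 0) t := by
  obtain ⟨y, rfl⟩ := proj_surjective x
  exact (hF.hasDerivWithinAt_aux ht y).differentiableWithinAt.hasDerivWithinAt

theorem ContDiffSlab.dt (hF : ContDiffSlab (n + 1) T F) : ContDiffSlab n T (dt F) := by
  have h1 := (ContDiffOn.fderivWithin (m := n) hF (uniqueDiffOn_slab T)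
    (by exact_mod_cast le_rfl)).clm_apply
    (contDiffOn_const (c := ((1 : ℝ), (0 : Fin 3 → ℝ))))
  refine h1.congr fun p hp => ?_
  exact (hF.hasDerivWithinAt_aux hp.1 p.2).derivWithin (uniqueDiffOn_Ici 0 _ hp.1.1)

theorem ContDiffSlab.slice (hF : ContDiffSlab n T F) {t : ℝ} (ht : t ∈ Ico 0 T) :
    ContDiff ℝ n (fun y : Fin 3 → ℝ => F t (proj y)) := by
  rw [← contDiffOn_univ]
  exact ContDiffOn.comp hF (t := Ico 0 T ×ˢ univ) (f := fun y : Fin 3 → ℝ => (t, y))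
    (contDiff_prodMk_right t).contDiffOn fun y _ => ⟨ht, mem_univ _⟩

theorem ContDiffSlab.c1T (hF : ContDiffSlab (n + 1) T F) {t : ℝ} (ht : t ∈ Ico 0 T) :
    C1T (F t) :=
  ContDiff.of_le (hF.slice ht) (by simp)

theorem ContDiffSlab.continuous (hF : ContDiffSlab n T F) {t : ℝ} (ht : t ∈ Ico 0 T) :
    Continuous (F t) :=
  isOpenQuotientMap_proj.isQuotientMap.continuous_iff.mpr (hF.slice ht).continuous

theorem ContDiffSlab.dx (hF : ContDiffSlab (n + 1) T F) (i : Fin 3) :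
    ContDiffSlab n T (dx i F) := by
  have h1 := (ContDiffOn.fderivWithin (m := n) hF (uniqueDiffOn_slab T)
    (by exact_mod_cast le_rfl)).clm_apply
    (contDiffOn_const (c := ((0 : ℝ), (Pi.single i 1 : Fin 3 → ℝ))))
  refine h1.congr fun p hp => ?_
  have h2 := (ContDiffOn.differentiableOn hF (by simp) p hp).hasFDerivWithinAt
  have h3 : HasFDerivWithinAt (fun y : Fin 3 → ℝ => (p.1, y))
      (ContinuousLinearMap.inr ℝ ℝ (Fin 3 → ℝ)) univ p.2 :=
    (hasFDerivAt_prodMk_right p.1 p.2).hasFDerivWithinAt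
  have h4 : HasFDerivWithinAt (fun y : Fin 3 → ℝ => F p.1 (proj y)) _ univ p.2 :=
    HasFDerivWithinAt.comp (g := fun p : ℝ × (Fin 3 → ℝ) => F p.1 (proj p.2)) p.2 h2 h3
      (show MapsTo (fun y : Fin 3 → ℝ => (p.1, y)) univ (Ico 0 T ×ˢ univ) from
        fun y _ => ⟨hp.1, mem_univ _⟩)
  rw [hasFDerivWithinAt_univ] at h4
  change pd i (F p.1) (proj p.2) = _
  rw [(hF.c1T hp.1).pd_proj, h4.fderiv]
  simp

end Slab

/-! ### Curves of continuous functions -/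

/-- A continuous function on the torus as a bundled map (`0` if the function is not continuous). -/
noncomputable def toC (f : T3 → ℝ) : C(T3, ℝ) :=
  open Classical in if h : Continuous f then ⟨f, h⟩ else 0

theorem toC_apply {f : T3 → ℝ} (hf : Continuous f) (x : T3) : toC f x = f x := by
  rw [toC, dif_pos hf]; rfl

/-- The closed fundamental cube is compact and of bounded size: the first gives uniformity in `x`,
the second the oscillation bound for functions with small gradient. -/
theorem exists_proj_eq (x : T3) : ∃ y ∈ Icc (0 : Fin 3 → ℝ) (fun _ => 2 * Real.pi), proj y = x := by
  have h : ∀ i, ∃ r ∈ Icc (0 : ℝ) (2 * Real.pi), (r : AddCircle (2 * Real.pi)) = x i := by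
    intro i
    have h1 : x i ∈ ((↑) : ℝ → AddCircle (2 * Real.pi)) '' Icc 0 (0 + 2 * Real.pi) := by
      rw [AddCircle.coe_image_Icc_eq]; trivial
    simpa using! h1
  choose y hy hyx using h
  exact ⟨y, ⟨fun i => (hy i).1, fun i => (hy i).2⟩, funext hyx⟩

/-- Joint continuity becomes uniform in `x` by compactness of the fundamental cube. It is applied
with a time derivative in the place of `F`. -/
theorem ContDiffSlab.eventually_dt_close {T : ℝ} {F : ℝ → T3 → ℝ} (hF : ContDiffSlab 0 T F) {t : ℝ}
    (ht : t ∈ Ico 0 T) {c : ℝ} (hc : 0 < c) :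
    ∀ᶠ s in 𝓝 t, s ∈ Ico 0 T → ∀ x, |F s x - F t x| < c := by
  have h1 : ContinuousOn (fun p : ℝ × (Fin 3 → ℝ) => F p.1 (proj p.2)) (Ico 0 T ×ˢ univ) :=
    ContDiffOn.continuousOn hF
  have h2 : ContinuousOn (fun p : ℝ × (Fin 3 → ℝ) => F t (proj p.2)) (Ico 0 T ×ˢ univ) :=
    (((hF.slice ht).continuous).comp continuous_snd).continuousOn
  have h3 := (h1.sub h2).abs
  have h4 : ∀ᶠ s in 𝓝 t, ∀ y ∈ Icc (0 : Fin 3 → ℝ) (fun _ => 2 * Real.pi),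
      s ∈ Ico 0 T → |F s (proj y) - F t (proj y)| < c := by
    refine isCompact_Icc.eventually_forall_of_forall_eventually fun y _ => ?_
    have h5 := (h3 (t, y) ⟨ht, mem_univ _⟩).eventually_lt_const (u := c) (by simpa using hc)
    filter_upwards [eventually_nhdsWithin_iff.1 h5] with z hz hz1
    exact hz ⟨hz1, mem_univ _⟩
  filter_upwards [h4] with s hs hsT x
  obtain ⟨y, hy, rfl⟩ := exists_proj_eq x
  exact hs y hy hsT

/-- A `C¹` coefficient is a differentiable curve in the sup norm: the mean value inequality is
applied to `z ↦ F z x - z ∂_t F(t, x)`, whose derivative is small near `t` uniformly in `x`. The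
product rule in `L²` then becomes that of a continuous bilinear map. -/
theorem ContDiffSlab.hasDerivWithinAt_toC {T : ℝ} {F : ℝ → T3 → ℝ} (hF : ContDiffSlab 1 T F)
    {t : ℝ} (ht : t ∈ Ico 0 T) :
    HasDerivWithinAt (fun s => toC (F s)) (toC (DustEinstein.dt F t)) (Ici 0) t := by
  refine HasDerivWithinAt.mono_of_mem_nhdsWithin ?_ (Ico_mem_nhdsWithin_Ici ht)
  rw [hasDerivWithinAt_iff_isLittleO, Asymptotics.isLittleO_iff]
  intro c hc
  obtain ⟨r, hr, hball⟩ := Metric.eventually_nhds_iff_ball.1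
    ((ContDiffSlab.dt (n := 0) hF).eventually_dt_close ht hc)
  filter_upwards [self_mem_nhdsWithin, mem_nhdsWithin_of_mem_nhds (Metric.ball_mem_nhds t hr)]
    with s hs hsb
  refine (ContinuousMap.norm_le _ (by positivity)).2 fun x => ?_
  simp only [ContinuousMap.sub_apply, ContinuousMap.smul_apply, toC_apply (hF.continuous hs),
    toC_apply (hF.continuous ht), toC_apply ((ContDiffSlab.dt (n := 0) hF).continuous ht), smul_eq_mul]
  have hconv : Convex ℝ (Ico 0 T ∩ Metric.ball t r) :=
    (convex_Ico 0 T).inter (convex_ball t r)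
  have hd : ∀ z ∈ Ico 0 T ∩ Metric.ball t r,
      HasDerivWithinAt (fun z => F z x - z * DustEinstein.dt F t x)
        (DustEinstein.dt F z x - DustEinstein.dt F t x) (Ico 0 T ∩ Metric.ball t r) z := by
    intro z hz
    have h1 := (ContDiffSlab.hasDerivWithinAt (n := 0) hF hz.1 x).mono
      (fun z hz => hz.1.1 : Ico 0 T ∩ Metric.ball t r ⊆ Ici 0)
    simpa using! h1.sub ((hasDerivWithinAt_id z _).mul_const (DustEinstein.dt F t x))
  have := hconv.norm_image_sub_le_of_norm_hasDerivWithin_le hd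
    (fun z hz => (hball z hz.2 hz.1 x).le) ⟨ht, Metric.mem_ball_self hr⟩ ⟨hs, hsb⟩
  have e : F s x - F t x - (s - t) * DustEinstein.dt F t x =
      F s x - s * DustEinstein.dt F t x - (F t x - t * DustEinstein.dt F t x) := by ring
  rw [e]
  exact this

/-- Multiplication of `L²` functions by continuous functions. -/
noncomputable def mulCLM : C(T3, ℝ) →L[ℝ] L2 →L[ℝ] L2 :=
  LinearMap.mkContinuous₂ (LinearMap.mk₂ ℝ (fun f w => mulL2 f w)
    (fun f g w => by
      apply Lp.ext
      filter_upwards [coeFn_mulL2 (f + g).continuous w, coeFn_mulL2 f.continuous w,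
        coeFn_mulL2 g.continuous w, Lp.coeFn_add (mulL2 f w) (mulL2 g w)] with x h1 h2 h3 h4
      rw [h1, h4, Pi.add_apply, h2, h3, ContinuousMap.add_apply, add_mul])
    (fun c f w => by
      apply Lp.ext
      filter_upwards [coeFn_mulL2 (c • f).continuous w, coeFn_mulL2 f.continuous w,
        Lp.coeFn_smul c (mulL2 f w)] with x h1 h2 h3
      rw [h1, h3, Pi.smul_apply, h2, ContinuousMap.smul_apply, smul_eq_mul, smul_eq_mul, mul_assoc])
    (fun f w v => by
      apply Lp.ext
      filter_upwards [coeFn_mulL2 f.continuous (w + v), coeFn_mulL2 f.continuous w,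
        coeFn_mulL2 f.continuous v, Lp.coeFn_add (mulL2 f w) (mulL2 f v), Lp.coeFn_add w v]
        with x h1 h2 h3 h4 h5
      rw [h1, h4, Pi.add_apply, h2, h3, h5, Pi.add_apply, mul_add])
    (fun c f w => by
      apply Lp.ext
      filter_upwards [coeFn_mulL2 f.continuous (c • w), coeFn_mulL2 f.continuous w,
        Lp.coeFn_smul c (mulL2 f w), Lp.coeFn_smul c w] with x h1 h2 h3 h4
      rw [h1, h3, Pi.smul_apply, h2, h4, Pi.smul_apply, smul_eq_mul, smul_eq_mul]
      ring))
    1 (fun f w => by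
      rw [one_mul]
      exact norm_mulL2_le f.continuous w fun x => f.norm_coe_le_norm x)

theorem mulL2_eq_mulCLM {f : T3 → ℝ} (hf : Continuous f) (w : L2) :
    mulL2 f w = mulCLM (toC f) w := by
  have : ((toC f : C(T3, ℝ)) : T3 → ℝ) = f := funext (toC_apply hf)
  change _ = mulL2 (toC f) w
  rw [this]

/-- The product rule for a `C¹` coefficient and a curve in `L²`. -/
theorem ContDiffSlab.hasDerivWithinAt_mulL2 {T : ℝ} {F : ℝ → T3 → ℝ} (hF : ContDiffSlab 1 T F)
    {t : ℝ} (ht : t ∈ Ico 0 T) {w : ℝ → L2} {w' : L2} (hw : HasDerivWithinAt w w' (Ici 0) t) :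
    HasDerivWithinAt (fun s => mulL2 (F s) (w s))
      (mulL2 (DustEinstein.dt F t) (w t) + mulL2 (F t) w') (Ici 0) t := by
  have h1 := (mulCLM.hasFDerivWithinAt.comp_hasDerivWithinAt (s := Ici 0) t
    (t := univ) (hF.hasDerivWithinAt_toC ht) (mapsTo_univ _ _))
  have h2 := HasDerivWithinAt.clm_apply h1 hw
  have h3 : mulL2 (DustEinstein.dt F t) (w t) + mulL2 (F t) w' =
      mulCLM (toC (DustEinstein.dt F t)) (w t) + mulCLM (toC (F t)) w' := by
    rw [mulL2_eq_mulCLM ((ContDiffSlab.dt (n := 0) hF).continuous ht),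
      mulL2_eq_mulCLM (hF.continuous ht)]
  rw [h3]
  refine HasDerivWithinAt.mono_of_mem_nhdsWithin (t := Ico 0 T) ?_ (Ico_mem_nhdsWithin_Ici ht)
  refine (h2.mono fun s hs => hs.1).congr (fun s hs => mulL2_eq_mulCLM (hF.continuous hs) _)
    (mulL2_eq_mulCLM (hF.continuous ht) _)

/-- A function on the torus with small gradient has small oscillation. -/
theorem C1T.abs_sub_le {φ : T3 → ℝ} (hφ : C1T φ) {B : ℝ} (hB : ∀ i x, |pd i φ x| ≤ B) (x x' : T3) :
    |φ x - φ x'| ≤ 24 * B := by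
  have hB0 : 0 ≤ B := (abs_nonneg _).trans (hB 0 0)
  obtain ⟨y, hy, rfl⟩ := exists_proj_eq x
  obtain ⟨z, hz, rfl⟩ := exists_proj_eq x'
  have h1 : ∀ p : Fin 3 → ℝ, ‖fderiv ℝ (fun y => φ (proj y)) p‖ ≤ 3 * B := by
    intro p
    refine ContinuousLinearMap.opNorm_le_bound _ (by positivity) fun v => ?_
    have : fderiv ℝ (fun y => φ (proj y)) p v = ∑ i, v i * pd i φ (proj p) := by
      have hv : v = ∑ i, v i • (Pi.single i 1 : Fin 3 → ℝ) := by
        ext j; simp [Finset.sum_apply, Pi.single_apply]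
      conv_lhs => rw [hv]
      simp only [hφ.pd_proj, map_sum, map_smul, smul_eq_mul]
    rw [this]
    refine (norm_sum_le _ _).trans ?_
    calc ∑ i, ‖v i * pd i φ (proj p)‖ ≤ ∑ i : Fin 3, ‖v‖ * B := by
          refine Finset.sum_le_sum fun i _ => ?_
          rw [norm_mul]
          exact mul_le_mul (norm_le_pi_norm v i) (hB i _) (norm_nonneg _) (norm_nonneg _)
      _ = 3 * B * ‖v‖ := by simp; ring
  have h2 := convex_univ.norm_image_sub_le_of_norm_fderiv_le (𝕜 := ℝ) (C := 3 * B)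
    (fun p _ => (ContDiff.differentiable hφ (by simp)) p) (fun p _ => h1 p) (mem_univ z) (mem_univ y)
  -- The constant `24` is `3 * 8`: the gradient has norm at most `3 B` against the sup norm, and the
  -- cube has side `2π ≤ 8`.
  have h3 : ‖y - z‖ ≤ 8 := by
    have hpi : 2 * Real.pi ≤ 8 := by linarith [Real.pi_le_four]
    refine (pi_norm_le_iff_of_nonneg (by norm_num)).2 fun i => ?_
    rw [Real.norm_eq_abs, Pi.sub_apply, abs_le]
    have h1 := hy.1 i; have h2 := hy.2 i; have h3 := hz.1 i; have h4 := hz.2 i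
    simp only [Pi.zero_apply] at h1 h3
    constructor <;> linarith
  calc |φ (proj y) - φ (proj z)| ≤ 3 * B * ‖y - z‖ := h2
    _ ≤ 3 * B * 8 := by gcongr
    _ = 24 * B := by ring

/-! ### Pointwise algebra -/

/-- The symmetric matrix `h` is comparable to the identity, with constant `c`. -/
structure Comparable (c : ℝ) (h : Fin 3 → Fin 3 → ℝ) : Prop where
  symm : ∀ i j, h i j = h j i
  lower : ∀ X : Fin 3 → ℝ, c⁻¹ * ∑ i, X i ^ 2 ≤ ∑ i, ∑ j, h i j * X i * X j
  upper : ∀ X : Fin 3 → ℝ, ∑ i, ∑ j, h i j * X i * X j ≤ c * ∑ i, X i ^ 2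

section Comparable

variable {c : ℝ} {h : Fin 3 → Fin 3 → ℝ}

theorem Comparable.nonneg (hh : Comparable c h) (hc : 1 ≤ c) (X : Fin 3 → ℝ) :
    0 ≤ ∑ i, ∑ j, h i j * X i * X j :=
  le_trans (by positivity) (hh.lower X)

theorem Comparable.quad_single (i : Fin 3) :
    ∑ k, ∑ l, h k l * (Pi.single i 1 : Fin 3 → ℝ) k * (Pi.single i 1 : Fin 3 → ℝ) l = h i i := by
  simp [Pi.single_apply]

theorem Comparable.abs_le (hh : Comparable c h) (hc : 1 ≤ c) (i j : Fin 3) : |h i j| ≤ c := by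
  have hdiag : ∀ i, 0 ≤ h i i ∧ h i i ≤ c := by
    intro i
    have h1 := hh.nonneg hc (Pi.single i 1)
    have h2 := hh.upper (Pi.single i 1)
    rw [Comparable.quad_single] at h1 h2
    refine ⟨h1, h2.trans (le_of_eq ?_)⟩
    simp [Pi.single_apply]
  by_cases hij : i = j
  · subst hij
    rw [_root_.abs_of_nonneg (hdiag i).1]
    exact (hdiag i).2
  -- Polarization: the upper bound is tested on `e_i + e_j` and `e_i - e_j`, and the nonnegative
  -- diagonal entries are dropped.
  · have key : ∀ e : ℝ, e ^ 2 = 1 → h i i + h j j + 2 * e * h i j ≤ 2 * c := by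
      intro e he
      have h1 := hh.upper (Pi.single i 1 + e • Pi.single j 1)
      have e1 : ∑ k, ∑ l, h k l * (Pi.single i 1 + e • Pi.single j 1 : Fin 3 → ℝ) k *
          (Pi.single i 1 + e • Pi.single j 1 : Fin 3 → ℝ) l =
          h i i + e * h i j + e * h j i + e ^ 2 * h j j := by
        simp [Pi.single_apply, mul_add, add_mul, Finset.sum_add_distrib]
        ring
      have e2 : ∑ k, (Pi.single i 1 + e • Pi.single j 1 : Fin 3 → ℝ) k ^ 2 = 1 + e ^ 2 := by
        simp [Pi.single_apply, add_sq, Finset.sum_add_distrib, Ne.symm hij, ite_pow]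
      rw [e1, e2, he, hh.symm j i] at h1
      linarith
    have k1 := key 1 (by norm_num)
    have k2 := key (-1) (by norm_num)
    have := hdiag i
    have := hdiag j
    rw [_root_.abs_le]
    constructor <;> linarith

/-- If `r h = s` then `r` is controlled by `s`. -/
theorem Comparable.solve (hh : Comparable c h) (hc : 1 ≤ c) {r s : Fin 3 → ℝ} {σ : ℝ}
    (hσ : 0 ≤ σ) (hs : ∀ j, |s j| ≤ σ) (heq : ∀ j, ∑ i, r i * h i j = s j) (j : Fin 3) :
    |r j| ≤ 2 * c * σ := by
  set R := ∑ i, r i ^ 2 with hR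
  have hR0 : 0 ≤ R := by positivity
  have h1 := hh.lower r
  -- Pairing the equation with `r` gives `c⁻¹ |r|² ≤ s · r`, whence `|r|² ≤ 3 c² σ²` by
  -- Cauchy–Schwarz; the final `2` rounds up `√3`.
  have h2 : ∑ i, ∑ j, h i j * r i * r j = ∑ j, s j * r j := by
    rw [Finset.sum_comm]
    refine Finset.sum_congr rfl fun j _ => ?_
    rw [← heq, Finset.sum_mul]
    exact Finset.sum_congr rfl fun i _ => by ring
  have h3 : ∑ j, s j ^ 2 ≤ 3 * σ ^ 2 := by
    calc ∑ j, s j ^ 2 ≤ ∑ _j : Fin 3, σ ^ 2 := Finset.sum_le_sum fun j _ => by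
          rw [← sq_abs]; exact pow_le_pow_left₀ (abs_nonneg _) (hs j) 2
      _ = 3 * σ ^ 2 := by simp
  have h4 := Finset.sum_mul_sq_le_sq_mul_sq Finset.univ s r
  rw [h2] at h1
  have h5 : R ≤ c * ∑ j, s j * r j := by
    rwa [inv_mul_le_iff₀ (by linarith)] at h1
  have h6 : R ^ 2 ≤ c ^ 2 * ((3 * σ ^ 2) * R) := by
    calc R ^ 2 ≤ (c * ∑ j, s j * r j) ^ 2 := pow_le_pow_left₀ hR0 h5 2
      _ = c ^ 2 * (∑ j, s j * r j) ^ 2 := by ring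
      _ ≤ c ^ 2 * ((∑ j, s j ^ 2) * R) := by gcongr
      _ ≤ _ := by gcongr
  have h7 : R ≤ 3 * c ^ 2 * σ ^ 2 := by
    rcases hR0.eq_or_lt with h0 | h0
    · rw [← h0]; positivity
    · have : R * R ≤ (3 * c ^ 2 * σ ^ 2) * R := by nlinarith
      exact le_of_mul_le_mul_right this h0
  have h8 : r j ^ 2 ≤ R := Finset.single_le_sum (f := fun i => r i ^ 2)
    (fun _ _ => sq_nonneg _) (Finset.mem_univ j)
  refine abs_le_of_sq_le_sq ?_ (by positivity)
  nlinarith [mul_nonneg (sq_nonneg c) (sq_nonneg σ)]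

variable {H E : Fin 3 → Fin 3 → ℝ} {e : ℝ}

theorem Comparable.abs_inv_le (hh : Comparable c h) (hc : 1 ≤ c)
    (hE : ∀ i j, |E i j| ≤ e) (he1 : e ≤ 1)
    (hH : ∀ i k, ∑ j, H i j * h j k = (if i = k then 1 else 0) + E i k) (i j : Fin 3) :
    |H i j| ≤ 4 * c := by
  have := hh.solve hc (r := fun j => H i j) (σ := 2) (by norm_num) (fun k => by
    refine (abs_add_le (if i = k then (1 : ℝ) else 0) (E i k)).trans ?_
    have : |if i = k then (1 : ℝ) else 0| ≤ 1 := by split_ifs <;> simp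
    linarith [hE i k]) (fun k => hH i k) j
  linarith

/-- An approximate inverse of a matrix comparable to the identity is positive definite. -/
theorem Comparable.le_quad_inv (hh : Comparable c h) (hc : 1 ≤ c) (he : 0 ≤ e)
    (hE : ∀ i j, |E i j| ≤ e) (hec : 100 * c ^ 2 * e ≤ 1) (hHs : ∀ i j, H i j = H j i)
    (hH : ∀ i k, ∑ j, H i j * h j k = (if i = k then 1 else 0) + E i k) (X : Fin 3 → ℝ) :
    (144 * c ^ 3)⁻¹ * ∑ i, X i ^ 2 ≤ ∑ i, ∑ j, H i j * X i * X j := by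
  -- With `Z = H X` and `W = Eᵀ X` one has `h Z = X + W`. So `X · Z` is the quadratic form of `h` at
  -- `Z`, bounded below by `c⁻¹ |Z|²`, minus the small term `W · Z`, and `|X|` is controlled by
  -- `|Z|`.
  set Z : Fin 3 → ℝ := fun i => ∑ j, H i j * X j
  set W : Fin 3 → ℝ := fun k => ∑ i, E i k * X i
  set x := ∑ i, X i ^ 2
  set z := ∑ i, Z i ^ 2
  set w := ∑ i, W i ^ 2
  have hx0 : 0 ≤ x := by positivity
  have hz0 : 0 ≤ z := by positivity
  have hw0 : 0 ≤ w := by positivity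
  have hZ : ∀ k, ∑ i, h k i * Z i = X k + W k := by
    intro k
    have : ∑ i, h k i * Z i = ∑ j, (∑ i, H j i * h i k) * X j := by
      simp only [Z, Finset.mul_sum, Finset.sum_mul]
      rw [Finset.sum_comm]
      refine Finset.sum_congr rfl fun j _ => Finset.sum_congr rfl fun i _ => ?_
      rw [hh.symm k i, hHs i j]; ring
    rw [this]
    simp only [hH, add_mul, Finset.sum_add_distrib, W]
    simp
  have hcs : ∀ (A : Fin 3 → Fin 3 → ℝ) (B : ℝ) (Y : Fin 3 → ℝ), (∀ i j, |A i j| ≤ B) →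
      ∑ k, (∑ i, A i k * Y i) ^ 2 ≤ 9 * B ^ 2 * ∑ i, Y i ^ 2 := by
    intro A B Y hA
    calc ∑ k, (∑ i, A i k * Y i) ^ 2 ≤ ∑ k : Fin 3, (3 * B ^ 2) * ∑ i, Y i ^ 2 := by
          refine Finset.sum_le_sum fun k _ =>
            (Finset.sum_mul_sq_le_sq_mul_sq Finset.univ (fun i => A i k) Y).trans ?_
          refine mul_le_mul_of_nonneg_right ?_ (by positivity)
          calc ∑ i, A i k ^ 2 ≤ ∑ _i : Fin 3, B ^ 2 := Finset.sum_le_sum fun i _ => by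
                rw [← sq_abs]; exact pow_le_pow_left₀ (abs_nonneg _) (hA i k) 2
            _ = 3 * B ^ 2 := by simp
      _ = _ := by simp; ring
  have hw : w ≤ 9 * e ^ 2 * x := hcs E e X hE
  have hhz : ∑ k, (X k + W k) ^ 2 ≤ 9 * c ^ 2 * z := by
    have := hcs (fun i k => h k i) c Z fun i k => hh.abs_le hc k i
    simpa only [hZ] using this
  have hxle : x ≤ 2 * (9 * c ^ 2 * z) + 2 * w := by
    have : x ≤ 2 * ∑ k, (X k + W k) ^ 2 + 2 * w := by
      simp only [x, w, Finset.mul_sum]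
      rw [← Finset.sum_add_distrib]
      refine Finset.sum_le_sum fun k _ => ?_
      nlinarith [sq_nonneg (X k + 2 * W k)]
    linarith
  have hquad : ∑ i, ∑ j, H i j * X i * X j = ∑ i, X i * Z i := by
    refine Finset.sum_congr rfl fun i _ => ?_
    simp only [Z, Finset.mul_sum]
    exact Finset.sum_congr rfl fun j _ => by ring
  have hZh : c⁻¹ * z ≤ ∑ i, X i * Z i + ∑ i, W i * Z i := by
    refine (hh.lower Z).trans (le_of_eq ?_)
    rw [← Finset.sum_add_distrib]
    refine Finset.sum_congr rfl fun i _ => ?_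
    rw [← add_mul, ← hZ, Finset.sum_mul]
    exact Finset.sum_congr rfl fun j _ => by ring
  -- Young's inequality, weighted so that exactly half of `c⁻¹ |Z|²` survives.
  have hWZ : ∑ i, W i * Z i ≤ (2 * c)⁻¹ * z + c / 2 * w := by
    simp only [z, w, Finset.mul_sum]
    rw [← Finset.sum_add_distrib]
    refine Finset.sum_le_sum fun i _ => ?_
    have h0 : 0 ≤ (2 * c)⁻¹ * (Z i - c * W i) ^ 2 := by positivity
    have h1 : (2 * c)⁻¹ * (Z i - c * W i) ^ 2 =
        (2 * c)⁻¹ * Z i ^ 2 - W i * Z i + c / 2 * W i ^ 2 := by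
      field_simp; ring
    linarith
  rw [hquad]
  have hcpos : 0 < c := by linarith
  have he2 : 10000 * c ^ 4 * e ^ 2 ≤ 1 := by
    have : (100 * c ^ 2 * e) ^ 2 ≤ 1 := pow_le_one₀ (by positivity) hec
    nlinarith
  have hc4 : e ^ 2 ≤ c ^ 4 * e ^ 2 := le_mul_of_one_le_left (sq_nonneg _) (one_le_pow₀ hc)
  have hx36 : x ≤ 36 * c ^ 2 * z := by
    have : 18 * e ^ 2 * x ≤ 1 / 2 * x := mul_le_mul_of_nonneg_right (by linarith) hx0
    linarith
  have hmain : (2 * c)⁻¹ * z - c / 2 * w ≤ ∑ i, X i * Z i := by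
    have : c⁻¹ * z = (2 * c)⁻¹ * z + (2 * c)⁻¹ * z := by field_simp; ring
    linarith
  refine le_trans ?_ hmain
  -- Here `72 c³ = 2 c * 36 c²` combines the surviving half with the bound of `X` by `Z`. Half of
  -- this lower bound pays for `W`, which leaves `144 c³`.
  have h1 : (72 * c ^ 3)⁻¹ * x ≤ (2 * c)⁻¹ * z := by
    rw [inv_mul_le_iff₀ (by positivity)]
    calc x ≤ 36 * c ^ 2 * z := hx36
      _ = _ := by field_simp; ring
  have h2 : c / 2 * w ≤ (144 * c ^ 3)⁻¹ * x := by
    rw [le_inv_mul_iff₀ (by positivity)]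
    calc 144 * c ^ 3 * (c / 2 * w) ≤ 144 * c ^ 3 * (c / 2 * (9 * e ^ 2 * x)) := by gcongr
      _ = (648 * (c ^ 4 * e ^ 2)) * x := by ring
      _ ≤ 1 * x := mul_le_mul_of_nonneg_right (by linarith) hx0
      _ = x := one_mul x
  have h3 : (72 * c ^ 3)⁻¹ * x = (144 * c ^ 3)⁻¹ * x + (144 * c ^ 3)⁻¹ * x := by
    field_simp; ring
  linarith

/-- The oscillation of an approximate inverse. -/
theorem Comparable.abs_inv_sub_le {h' H' E' : Fin 3 → Fin 3 → ℝ} {o : ℝ} (hh : Comparable c h)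
    (hh' : Comparable c h') (hc : 1 ≤ c)
    (he1 : e ≤ 1) (ho : ∀ i j, |h i j - h' i j| ≤ o)
    (hE : ∀ i j, |E i j| ≤ e) (hE' : ∀ i j, |E' i j| ≤ e)
    (hH : ∀ i k, ∑ j, H i j * h j k = (if i = k then 1 else 0) + E i k)
    (hH' : ∀ i k, ∑ j, H' i j * h' j k = (if i = k then 1 else 0) + E' i k) (i j : Fin 3) :
    |H i j - H' i j| ≤ 2 * c * (2 * e + 12 * c * o) := by
  have he : 0 ≤ e := (abs_nonneg _).trans (hE 0 0)
  have ho0 : 0 ≤ o := (abs_nonneg _).trans (ho 0 0)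
  -- Each row of `H - H'` solves `(H - H') h = E - E' - H' (h - h')`, so the oscillation of `h`
  -- controls that of `H`.
  refine hh.solve hc (r := fun j => H i j - H' i j)
    (s := fun k => E i k - E' i k - ∑ j, H' i j * (h j k - h' j k)) (by positivity) ?_ ?_ j
  · intro k
    have h1 : |∑ j, H' i j * (h j k - h' j k)| ≤ 12 * c * o := by
      refine (Finset.abs_sum_le_sum_abs _ _).trans ?_
      calc ∑ j, |H' i j * (h j k - h' j k)| ≤ ∑ _j : Fin 3, 4 * c * o := by
            refine Finset.sum_le_sum fun j _ => ?_
            rw [abs_mul]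
            exact mul_le_mul (hh'.abs_inv_le hc hE' he1 hH' i j) (ho j k) (abs_nonneg _)
              (by positivity)
        _ = 12 * c * o := by simp; ring
    have h2 := abs_sub (E i k) (E' i k)
    have h3 := abs_sub (E i k - E' i k) (∑ j, H' i j * (h j k - h' j k))
    linarith [hE i k, hE' i k]
  · intro k
    have h1 := hH i k
    have h2 := hH' i k
    simp only [sub_mul, mul_sub, Finset.sum_sub_distrib]
    linarith

/-! The algebraic relations between the rescaled components of a metric, of its inverse and of
the four-velocity. -/

variable {g₀ u₀ α d : ℝ} {b U β : Fin 3 → ℝ} {γ : Fin 3 → Fin 3 → ℝ}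

theorem abs_sum_mul_le {f g : Fin 3 → ℝ} {A B : ℝ} (hf : ∀ i, |f i| ≤ A) (hg : ∀ i, |g i| ≤ B) :
    |∑ i, f i * g i| ≤ 3 * (A * B) := by
  have hA : 0 ≤ A := (abs_nonneg _).trans (hf 0)
  refine (Finset.abs_sum_le_sum_abs _ _).trans ?_
  calc ∑ i, |f i * g i| ≤ ∑ _i : Fin 3, A * B := Finset.sum_le_sum fun i _ => by
        rw [abs_mul]; exact mul_le_mul (hf i) (hg i) (abs_nonneg _) hA
    _ = _ := by simp

/-- Pairing the spatial relations with `β` and inserting the time relation gives `0 ≤ -α (1 - g₀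
α)`. Since `g₀ ≤ -1/2`, this reads `α² / 2 ≤ -α`, so `α` lies in `[-2, 0]` whatever the size of the
shift `b`. -/
theorem Comparable.abs_inv_zero_zero_le (hh : Comparable c h) (hc : 1 ≤ c)
    (hg₀ : |g₀ + 1| ≤ 1 / 2)
    (h0 : g₀ * α + ∑ j, b j * β j = 1) (h1 : ∀ j, b j * α + ∑ k, h j k * β k = 0) :
    |α| ≤ 2 := by
  have h2 := hh.nonneg hc β
  have h3 : ∑ i, ∑ j, h i j * β i * β j = -α * ∑ j, b j * β j := by
    rw [Finset.mul_sum]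
    refine Finset.sum_congr rfl fun i _ => ?_
    have := h1 i
    calc ∑ j, h i j * β i * β j = β i * ∑ j, h i j * β j := by
          rw [Finset.mul_sum]; exact Finset.sum_congr rfl fun j _ => by ring
      _ = _ := by rw [show ∑ k, h i k * β k = -(b i * α) by linarith]; ring
  have h4 : ∑ j, b j * β j = 1 - g₀ * α := by linarith
  rw [h3, h4] at h2
  rw [_root_.abs_le] at hg₀ ⊢
  have h5 : α ^ 2 / 2 ≤ -α := by nlinarith [sq_nonneg α]
  constructor <;> nlinarith

theorem Comparable.abs_inv_zero_le (hh : Comparable c h) (hc : 1 ≤ c) (hα : |α| ≤ 2)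
    {σ : ℝ} (hb : ∀ j, |b j| ≤ σ) (h1 : ∀ j, b j * α + ∑ k, h j k * β k = 0) (j : Fin 3) :
    |β j| ≤ 4 * c * σ := by
  have hσ : 0 ≤ σ := (abs_nonneg _).trans (hb 0)
  have := hh.solve hc (r := β) (s := fun j => -(b j * α)) (σ := 2 * σ) (by positivity)
    (fun j => by
      rw [abs_neg, abs_mul]
      nlinarith [hb j, abs_nonneg (b j), abs_nonneg α])
    (fun j => by
      have := h1 j
      rw [show ∑ i, β i * h i j = ∑ k, h j k * β k from
        Finset.sum_congr rfl fun k _ => by rw [hh.symm k j]; ring]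
      linarith) j
  linarith

theorem small_of_small (hc : 1 ≤ c) (hd : 0 ≤ d) (hdc : 100 * c ^ 2 * d ≤ 1) :
    d ≤ 1 / 100 ∧ c * d ≤ 1 / 100 := by
  have h1 : c * d ≤ c ^ 2 * d := by nlinarith [mul_nonneg (by linarith : 0 ≤ c) hd]
  have h2 : d ≤ c * d := le_mul_of_one_le_left hd hc
  constructor <;> linarith

/-- The normalization is a quadratic equation for `u₀` close to `-u₀² = -1`; positivity of `u₀`
selects the root near `1`. -/
theorem Comparable.four_velocity (hh : Comparable c h) (hc : 1 ≤ c)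
    (hdc : 100 * c ^ 2 * d ≤ 1) (hg₀ : |g₀ + 1| ≤ d) (hb : ∀ j, |b j| ≤ d) (hU : ∀ j, |U j| ≤ d)
    (hu₀ : 0 < u₀)
    (hunit : g₀ * u₀ ^ 2 + 2 * u₀ * ∑ j, b j * U j + ∑ i, ∑ j, h i j * U i * U j = -1) :
    1 / 2 ≤ u₀ ∧ u₀ ≤ 2 := by
  have hd : 0 ≤ d := (abs_nonneg _).trans hg₀
  obtain ⟨hd1, hd2⟩ := small_of_small hc hd hdc
  have h1 := abs_sum_mul_le hb hU
  have h2 := hh.nonneg hc U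
  have h3 : ∑ i, ∑ j, h i j * U i * U j ≤ 3 * (c * d) * d := by
    refine (hh.upper U).trans ?_
    have : ∑ i, U i ^ 2 ≤ 3 * d ^ 2 := by
      calc ∑ j, U j ^ 2 ≤ ∑ _j : Fin 3, d ^ 2 := Finset.sum_le_sum fun j _ => by
            rw [← sq_abs]; exact pow_le_pow_left₀ (abs_nonneg _) (hU j) 2
        _ = 3 * d ^ 2 := by simp
    nlinarith
  have h4 : 3 * (c * d) * d ≤ 1 / 100 := by nlinarith [mul_nonneg (by linarith : 0 ≤ c) hd]
  have h5 : 3 * (d * d) ≤ 1 / 1000 := by nlinarith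
  rw [_root_.abs_le] at hg₀ h1
  have h6 : u₀ * ∑ j, b j * U j ≤ u₀ * (1 / 1000) := by gcongr; linarith
  have h7 : u₀ * (-(1 / 1000)) ≤ u₀ * ∑ j, b j * U j := by gcongr; linarith
  have h8 : -(101 / 100) * u₀ ^ 2 ≤ g₀ * u₀ ^ 2 :=
    mul_le_mul_of_nonneg_right (by linarith) (sq_nonneg _)
  have h9 : g₀ * u₀ ^ 2 ≤ -(99 / 100) * u₀ ^ 2 :=
    mul_le_mul_of_nonneg_right (by linarith) (sq_nonneg _)
  constructor
  · by_contra hlt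
    push Not at hlt
    nlinarith
  · by_contra hlt
    push Not at hlt
    nlinarith

/-- The matrix `H^{ij}` is an approximate inverse of `h_{ij}`. -/
theorem Comparable.approx_inverse (hh : Comparable c h) (hc : 1 ≤ c)
    (hdc : 100 * c ^ 2 * d ≤ 1) (hb : ∀ j, |b j| ≤ d) (hU : ∀ j, |U j| ≤ d)
    (hu₀ : 1 / 2 ≤ u₀) (hα : |α| ≤ 2) (hβ : ∀ j, |β j| ≤ 4 * c * d)
    (hγ : ∀ i k, ∑ j, γ i j * h j k + β i * b k = if i = k then 1 else 0)
    (hH : ∀ i j, H i j = γ i j + α * U i * U j / u₀ ^ 2 - β i * (U j / u₀) - β j * (U i / u₀)) :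
    ∃ E : Fin 3 → Fin 3 → ℝ, (∀ i j, |E i j| ≤ d) ∧
      ∀ i k, ∑ j, H i j * h j k = (if i = k then 1 else 0) + E i k := by
  have hd : 0 ≤ d := (abs_nonneg _).trans (hb 0)
  -- The part of `H` coming from the velocity. Every term has two factors among `U / u₀` and `β`, so
  -- `R` is quadratically small.
  set R : Fin 3 → Fin 3 → ℝ := fun i j =>
    α * (U i / u₀) * (U j / u₀) - β i * (U j / u₀) - β j * (U i / u₀)
  have hUu : ∀ j, |U j / u₀| ≤ 2 * d := by
    intro j
    rw [abs_div, abs_of_pos (by linarith : 0 < u₀), div_le_iff₀ (by linarith)]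
    nlinarith [hU j]
  have hR : ∀ i j, |R i j| ≤ 24 * c * d ^ 2 := by
    intro i j
    have h1 : |α * (U i / u₀) * (U j / u₀)| ≤ 2 * (2 * d) * (2 * d) := by
      rw [abs_mul, abs_mul]
      gcongr <;> apply hUu
    have h2 : ∀ i j, |β i * (U j / u₀)| ≤ 4 * c * d * (2 * d) := by
      intro i j
      rw [abs_mul]
      gcongr
      exacts [hβ i, hUu j]
    have h3 := abs_sub (α * (U i / u₀) * (U j / u₀)) (β i * (U j / u₀))
    have h4 := abs_sub (α * (U i / u₀) * (U j / u₀) - β i * (U j / u₀)) (β j * (U i / u₀))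
    have h5 := h2 i j
    have h6 := h2 j i
    have h7 : d ^ 2 ≤ c * d ^ 2 := le_mul_of_one_le_left (sq_nonneg _) hc
    simp only [R]
    nlinarith
  refine ⟨fun i k => -(β i * b k) + ∑ j, R i j * h j k, fun i k => ?_, fun i k => ?_⟩
  · have h1 : |∑ j, R i j * h j k| ≤ 3 * (24 * c * d ^ 2 * c) :=
      abs_sum_mul_le (fun j => hR i j) fun j => hh.abs_le hc j k
    have h2 : |β i * b k| ≤ 4 * c * d * d := by
      rw [abs_mul]
      gcongr
      exacts [hβ i, hb k]
    have h3 := abs_add_le (-(β i * b k)) (∑ j, R i j * h j k)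
    rw [abs_neg] at h3
    have h4 : c * d ^ 2 ≤ c ^ 2 * d ^ 2 := by
      rw [sq c, mul_assoc]
      exact le_mul_of_one_le_left (by positivity) hc
    -- The total error is at most `76 c² d²`; the smallness of `c² d` brings it below `d`.
    have h5 : 100 * (c ^ 2 * d ^ 2) ≤ d := by nlinarith
    nlinarith
  · have h1 := hγ i k
    have h2 : ∑ j, H i j * h j k = ∑ j, γ i j * h j k + ∑ j, R i j * h j k := by
      rw [← Finset.sum_add_distrib]
      refine Finset.sum_congr rfl fun j _ => ?_
      rw [hH, ← add_mul]
      congr 1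
      simp only [R]
      field_simp
      ring
    rw [h2]; linarith

/-- Control of the derivative of `u⁰` by differentiating the normalization condition. -/
theorem Comparable.abs_deriv_le (hh : Comparable c h) (hc : 1 ≤ c)
    (hdc : 100 * c ^ 2 * d ≤ 1) (hg₀ : |g₀ + 1| ≤ d) (hb : ∀ j, |b j| ≤ d) (hU : ∀ j, |U j| ≤ d)
    (hu₀ : 1 / 2 ≤ u₀ ∧ u₀ ≤ 2) {s K τ g₀' : ℝ} {b' U' : Fin 3 → ℝ} {h' : Fin 3 → Fin 3 → ℝ}
    (hK : 0 ≤ K) (hUs : ∀ j, |U j| ≤ s) (hg' : |g₀'| ≤ s) (hb' : ∀ j, |b' j| ≤ s)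
    (hh' : ∀ i j, |h' i j| ≤ K) (hU' : ∀ j, |U' j| ≤ 3 * s)
    (heq : g₀' * u₀ ^ 2 + 2 * u₀ * ∑ j, b' j * U j + ∑ i, ∑ j, h' i j * U i * U j
      + 2 * ((g₀ * u₀ + ∑ j, b j * U j) * τ + ∑ j, (b j * u₀ + ∑ k, h j k * U k) * U' j) = 0) :
    |τ| ≤ (100 + 18 * K) * s := by
  have hd : 0 ≤ d := (abs_nonneg _).trans hg₀
  have hs : 0 ≤ s := (abs_nonneg _).trans hg'
  obtain ⟨hd1, hd2⟩ := small_of_small hc hd hdc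
  have hu0 : |u₀| ≤ 2 := by rw [abs_of_pos] <;> linarith
  have e1 : |g₀' * u₀ ^ 2| ≤ s * 2 ^ 2 := by
    rw [abs_mul, abs_pow]; gcongr
  have hU1 : ∀ j, |U j| ≤ 1 := fun j => (hU j).trans (by linarith)
  have e2 : |2 * u₀ * ∑ j, b' j * U j| ≤ 2 * 2 * (3 * (s * 1)) := by
    rw [abs_mul, abs_mul, abs_two]
    gcongr
    exact abs_sum_mul_le hb' hU1
  -- The derivative of `h` is merely bounded by `K`; smallness comes from one velocity factor,
  -- bounded by `s`, while the other is bounded by `1`.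
  have e3 : |∑ i, ∑ j, h' i j * U i * U j| ≤ 9 * K * s := by
    refine (Finset.abs_sum_le_sum_abs _ _).trans ?_
    calc ∑ i, |∑ j, h' i j * U i * U j| ≤ ∑ _i : Fin 3, 3 * ((K * 1) * s) := by
          refine Finset.sum_le_sum fun i _ => ?_
          refine abs_sum_mul_le (f := fun j => h' i j * U i) (fun j => ?_) hUs
          rw [abs_mul]
          exact mul_le_mul (hh' i j) (hU1 i) (abs_nonneg _) hK
      _ = 9 * K * s := by simp; ring
  have e4 : ∀ j, |b j * u₀ + ∑ k, h j k * U k| ≤ 1 := by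
    intro j
    have h1 := abs_add_le (b j * u₀) (∑ k, h j k * U k)
    have h2 : |b j * u₀| ≤ d * 2 := by rw [abs_mul]; gcongr; exact hb j
    have h3 := abs_sum_mul_le (fun k => hh.abs_le hc j k) hU
    linarith
  have e5 := abs_sum_mul_le e4 hU'
  -- The coefficient of the unknown `τ` is the lowered component `u_0`, close to `-u₀`; dividing by
  -- it solves for `τ`.
  have e6 : 1 / 4 ≤ |g₀ * u₀ + ∑ j, b j * U j| := by
    have h1 := abs_sum_mul_le hb hU
    rw [_root_.abs_le] at h1 hg₀
    have h2 : d * d ≤ 1 / 100 * (1 / 100) := by gcongr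
    refine le_trans ?_ (neg_le_abs _)
    nlinarith
  have e7 : |(g₀ * u₀ + ∑ j, b j * U j) * τ| ≤ (25 + 9 / 2 * K) * s := by
    rw [_root_.abs_le] at e1 e2 e3 e5 ⊢
    constructor <;> linarith
  rw [abs_mul] at e7
  nlinarith [abs_nonneg τ]

end Comparable

/-! ### The scale factor -/

section Weights

variable {Λ rhoBar : ℝ} {a : ℝ → ℝ} {t : ℝ}

theorem ew_pos (a : ℝ → ℝ) (c t : ℝ) : 0 < ew a c t := Real.exp_pos _

theorem ew_add (a : ℝ → ℝ) (c d t : ℝ) : ew a (c + d) t = ew a c t * ew a d t := by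
  unfold ew; rw [← Real.exp_add]; ring_nf

theorem ew_zero (a : ℝ → ℝ) (t : ℝ) : ew a 0 t = 1 := by simp [ew]

theorem ew_mul_eq {c d e : ℝ} (h : c + d = e) : ew a c t * ew a d t = ew a e t := by
  rw [← ew_add, h]

theorem ew_mul_neg (a : ℝ → ℝ) (c t : ℝ) : ew a c t * ew a (-c) t = 1 := by
  rw [ew_mul_eq (add_neg_cancel c), ew_zero]

theorem IsScaleFactor.one_le (ha : IsScaleFactor Λ rhoBar a) (ht : 0 ≤ t) : 1 ≤ a t := by
  have hmono : MonotoneOn a (Ici 0) := by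
    refine monotoneOn_of_deriv_nonneg (convex_Ici 0)
      (fun s hs => (ha.friedmann s hs).continuousWithinAt) (fun s hs => ?_) (fun s hs => ?_)
    · rw [interior_Ici] at hs
      exact ((ha.friedmann s hs.le).hasDerivAt (Ici_mem_nhds hs)).differentiableAt.differentiableWithinAt
    · rw [interior_Ici] at hs
      rw [((ha.friedmann s hs.le).hasDerivAt (Ici_mem_nhds hs)).deriv]
      exact mul_nonneg (ha.pos s hs.le).le (Real.sqrt_nonneg _)
  have := hmono (mem_Ici.2 le_rfl) ht ht
  rwa [ha.initial] at this

theorem IsScaleFactor.ew_mono (ha : IsScaleFactor Λ rhoBar a) (ht : 0 ≤ t) {c d : ℝ} (h : c ≤ d) :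
    ew a c t ≤ ew a d t :=
  Real.exp_le_exp.2 (mul_le_mul_of_nonneg_right h (Real.log_nonneg (ha.one_le ht)))

theorem IsScaleFactor.ew_le_one (ha : IsScaleFactor Λ rhoBar a) (ht : 0 ≤ t) {c : ℝ} (h : c ≤ 0) :
    ew a c t ≤ 1 := by
  rw [← ew_zero a t]; exact ha.ew_mono ht h

theorem IsScaleFactor.one_le_ew (ha : IsScaleFactor Λ rhoBar a) (ht : 0 ≤ t) {c : ℝ} (h : 0 ≤ c) :
    1 ≤ ew a c t := by
  rw [← ew_zero a t]; exact ha.ew_mono ht h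

theorem IsScaleFactor.hasDerivWithinAt_ew (ha : IsScaleFactor Λ rhoBar a) (ht : 0 ≤ t) (c : ℝ) :
    HasDerivWithinAt (ew a c)
      (c * Real.sqrt (Λ / 3 + rhoBar / (3 * a t ^ 3)) * ew a c t) (Ici 0) t := by
  have h1 := (((ha.friedmann t ht).log (ha.pos t ht).ne').const_mul c).exp
  have hpos := ha.pos t ht
  refine h1.congr_deriv ?_
  unfold ew Om
  field_simp

theorem IsScaleFactor.sqrt_le (ha : IsScaleFactor Λ rhoBar a) (hr : 0 ≤ rhoBar) (ht : 0 ≤ t) :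
    Real.sqrt (Λ / 3 + rhoBar / (3 * a t ^ 3)) ≤ Real.sqrt (Λ / 3 + rhoBar) := by
  refine Real.sqrt_le_sqrt ?_
  have h1 : 1 ≤ a t ^ 3 := one_le_pow₀ (ha.one_le ht)
  have : rhoBar / (3 * a t ^ 3) ≤ rhoBar := div_le_self hr (by linarith)
  linarith

end Weights

/-! ### Pointwise bounds from the norms -/

/-- The pointwise bounds on the metric and the velocity at time `t`. -/
structure PointBounds (a : ℝ → ℝ) (q d : ℝ) (g : MetricField) (u : ℝ → T3 → Fin 4 → ℝ)
    (t : ℝ) : Prop where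
  g00 : ∀ x, |g t x 0 0 + 1| ≤ d * ew a (-q) t
  dt_g00 : ∀ x, |dt (fun t x => g t x 0 0) t x| ≤ d * ew a (-q) t
  dx_g00 : ∀ i x, |dx i (fun t x => g t x 0 0) t x| ≤ d * ew a (-(q - 1)) t
  g0 : ∀ j x, |g t x 0 (Fin.succ j)| ≤ d * ew a (-(q - 1)) t
  dt_g0 : ∀ j x, |dt (fun t x => g t x 0 (Fin.succ j)) t x| ≤ d * ew a (-(q - 1)) t
  dx_g0 : ∀ i j x, |dx i (fun t x => g t x 0 (Fin.succ j)) t x| ≤ d * ew a (-(q - 2)) t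
  dt_h : ∀ j k x, |dt (hRes a g j k) t x| ≤ d * ew a (-q) t
  dx_h : ∀ i j k x, |dx i (hRes a g j k) t x| ≤ d
  vel : ∀ j x, |u t x (Fin.succ j)| ≤ d * ew a (-(1 + q)) t
  du_vel : ∀ j x, |du u (fun t x => u t x (Fin.succ j)) t x| ≤ d * ew a (-(1 + q)) t
  dx_vel : ∀ i j x, |dx i (fun t x => u t x (Fin.succ j)) t x| ≤ d * ew a (-q) t

theorem abs_le_of_weighted {a : ℝ → ℝ} {c t ε : ℝ} (hε : 0 ≤ ε) {k : ℕ} (hk : 2 ≤ k)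
    {f : T3 → ℝ} (hf : Continuous f) (h : eW a c t * sobNorm k f ≤ ENNReal.ofReal ε) (x : T3) :
    |f x| ≤ sobConst * ε * ew a (-c) t := by
  have h1 : sobNorm k f ≤ ENNReal.ofReal (ε * ew a (-c) t) := by
    have e1 : sobNorm k f = eW a (-c) t * (eW a c t * sobNorm k f) := by
      rw [← mul_assoc, eW, eW, ← ENNReal.ofReal_mul (ew_pos _ _ _).le, mul_comm (ew a (-c) t),
        ew_mul_neg, ENNReal.ofReal_one, one_mul]
    rw [e1, mul_comm ε, ENNReal.ofReal_mul (ew_pos _ _ _).le]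
    exact mul_le_mul_right h _
  have := abs_le_of_sobNorm_le hk hf (mul_nonneg hε (ew_pos _ _ _).le) h1 x
  linarith

section Extraction

variable {a : ℝ → ℝ} {q : ℝ} {N : ℕ} {rhoBar : ℝ} {T : ℝ} {g : MetricField}
  {u : ℝ → T3 → Fin 4 → ℝ} {rho : ℝ → T3 → ℝ} {t : ℝ}

theorem le_sum_one {f : Fin 3 → ℝ≥0∞} (i : Fin 3) : f i ≤ ∑ i, f i :=
  Finset.single_le_sum (fun _ _ => zero_le) (Finset.mem_univ i)

theorem le_sum_two {f : Fin 3 → Fin 3 → ℝ≥0∞} (i j : Fin 3) : f i j ≤ ∑ i, ∑ j, f i j :=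
  (le_sum_one j).trans (le_sum_one (f := fun i => ∑ j, f i j) i)

theorem le_sum_three {f : Fin 3 → Fin 3 → Fin 3 → ℝ≥0∞} (i j k : Fin 3) :
    f i j k ≤ ∑ i, ∑ j, ∑ k, f i j k :=
  (le_sum_two j k).trans (le_sum_one (f := fun i => ∑ j, ∑ k, f i j k) i)

theorem continuous_du {F : ℝ → T3 → ℝ} (hu : ∀ μ, ContDiffSlab 1 T fun t x => u t x μ)
    (hF : ContDiffSlab 1 T F) (ht : t ∈ Ico 0 T) : Continuous (du u F t) := by
  unfold du
  refine (((hu 0).continuous ht).mul ((ContDiffSlab.dt (n := 0) hF).continuous ht)).add ?_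
  exact continuous_finsetSum _ fun i _ => ((hu i.succ).continuous ht).mul
    ((ContDiffSlab.dx (n := 0) hF i).continuous ht)

theorem c1T_hRes (hg : ∀ μ ν, ContDiffSlab 2 T fun t x => g t x μ ν) (ht : t ∈ Ico 0 T)
    (j k : Fin 3) : C1T (hRes a g j k t) :=
  ContDiff.mul contDiff_const (ContDiffSlab.c1T (n := 1) (hg j.succ k.succ) ht)

theorem hasDerivWithinAt_hRes {Λ : ℝ} (ha : IsScaleFactor Λ rhoBar a)
    (hg : ∀ μ ν, ContDiffSlab 2 T fun t x => g t x μ ν) (ht : t ∈ Ico 0 T)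
    (j k : Fin 3) (x : T3) :
    HasDerivWithinAt (fun s => hRes a g j k s x)
      (-2 * Real.sqrt (Λ / 3 + rhoBar / (3 * a t ^ 3)) * ew a (-2) t * g t x j.succ k.succ
        + ew a (-2) t * dt (fun t x => g t x j.succ k.succ) t x) (Ici 0) t :=
  (ha.hasDerivWithinAt_ew ht.1 (-2)).mul
    (ContDiffSlab.hasDerivWithinAt (n := 1) (hg j.succ k.succ) ht x)

theorem dt_hRes {Λ : ℝ} (ha : IsScaleFactor Λ rhoBar a)
    (hg : ∀ μ ν, ContDiffSlab 2 T fun t x => g t x μ ν) (ht : t ∈ Ico 0 T)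
    (j k : Fin 3) (x : T3) :
    dt (hRes a g j k) t x =
      -2 * Real.sqrt (Λ / 3 + rhoBar / (3 * a t ^ 3)) * hRes a g j k t x
        + ew a (-2) t * dt (fun t x => g t x j.succ k.succ) t x := by
  have := (hasDerivWithinAt_hRes ha hg ht j k x).derivWithin (uniqueDiffOn_Ici 0 _ ht.1)
  unfold dt at this ⊢
  rw [this, hRes]; ring

/-- Friedmann's equation supplies the time derivative of the weight, so the explicit formula
suffices and no slab regularity of `h` has to be established. -/
theorem continuous_dt_hRes {Λ : ℝ} (ha : IsScaleFactor Λ rhoBar a)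
    (hg : ∀ μ ν, ContDiffSlab 2 T fun t x => g t x μ ν) (ht : t ∈ Ico 0 T)
    (j k : Fin 3) : Continuous (dt (hRes a g j k) t) := by
  have h : dt (hRes a g j k) t = fun x => _ := funext fun x => dt_hRes ha hg ht j k x
  rw [h]
  exact (continuous_const.mul (c1T_hRes hg ht j k).continuous).add
    (continuous_const.mul ((ContDiffSlab.dt (n := 1) (hg j.succ k.succ)).continuous ht))

theorem pointBounds_of_totalNorm {Λ : ℝ} (ha : IsScaleFactor Λ rhoBar a) (hN : 4 ≤ N)
    (hf : IsDustField T g u rho) (ht : t ∈ Ico 0 T) {ε : ℝ} (hε : 0 ≤ ε)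
    (h : totalNorm a q N rhoBar g u rho t ≤ ENNReal.ofReal ε) :
    PointBounds a q (sobConst * ε) g u t := by
  have hN1 : 2 ≤ N - 1 := by omega
  have hN2 : 2 ≤ N - 2 := by omega
  unfold totalNorm at h
  have hA := (le_add_right (le_add_right (le_add_right le_rfl))).trans h
  have hB := (le_add_right (le_add_right (le_add_left le_rfl))).trans h
  have hTop := (le_add_left le_rfl).trans h
  have hG00 := (le_add_right (le_add_right (le_add_right (le_add_right le_rfl)))).trans hA
  have hG0 := (le_add_right (le_add_right (le_add_right (le_add_left le_rfl)))).trans hA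
  have hH := (le_add_right (le_add_right (le_add_left le_rfl))).trans hA
  have hV := (le_add_right (le_add_left le_rfl)).trans hA
  have hUV := (le_add_right (le_add_left le_rfl)).trans hB
  have g1 : ∀ μ ν, ContDiffSlab 1 T (dt fun t x => g t x μ ν) := fun μ ν =>
    ContDiffSlab.dt (n := 1) (hf.g_C2 μ ν)
  have g2 : ∀ i μ ν, ContDiffSlab 1 T (dx i fun t x => g t x μ ν) := fun i μ ν =>
    ContDiffSlab.dx (n := 1) (hf.g_C2 μ ν) i
  unfold normG00 at hG00
  unfold normG0 at hG0
  unfold normH at hH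
  unfold normVel at hV
  unfold normUVel at hUV
  unfold normTopVel at hTop
  constructor
  · exact fun x => abs_le_of_weighted hε hN1 (((hf.g_C2 0 0).continuous ht).add continuous_const)
      ((le_add_right (le_add_left le_rfl)).trans hG00) x
  · exact fun x => abs_le_of_weighted hε hN1 ((g1 0 0).continuous ht)
      ((le_add_right (le_add_right le_rfl)).trans hG00) x
  · exact fun i x => abs_le_of_weighted hε hN1 ((g2 i 0 0).continuous ht)
      ((le_sum_one i).trans ((le_add_left le_rfl).trans hG00)) x
  · exact fun j x => abs_le_of_weighted hε hN1 ((hf.g_C2 0 j.succ).continuous ht)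
      ((le_sum_one j).trans ((le_add_right (le_add_left le_rfl)).trans hG0)) x
  · exact fun j x => abs_le_of_weighted hε hN1 ((g1 0 j.succ).continuous ht)
      ((le_sum_one j).trans ((le_add_right (le_add_right le_rfl)).trans hG0)) x
  · exact fun i j x => abs_le_of_weighted hε hN1 ((g2 i 0 j.succ).continuous ht)
      ((le_sum_two i j).trans ((le_add_left le_rfl).trans hG0)) x
  · exact fun j k x => abs_le_of_weighted hε hN1 (continuous_dt_hRes ha hf.g_C2 ht j k)
      ((le_sum_two j k).trans ((le_add_right (le_add_right le_rfl)).trans hH)) x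
  -- The unweighted `H^{N-2}` norm is used here, which requires `N ≥ 4`. The `H^{N-1}` norm carries
  -- the weight `e^{(q-1)Ω}` and would allow `∂_i h_{jk}` to grow, destroying the small oscillation
  -- of `h`.
  · exact fun i j k x => abs_le_of_sobNorm_le hN2 ((c1T_hRes hf.g_C2 ht j k).continuous_pd i) hε
      ((le_sum_three i j k).trans ((le_add_right (le_add_left le_rfl)).trans hH)) x
  · exact fun j x => abs_le_of_weighted hε hN1 ((hf.u_C1 j.succ).continuous ht)
      ((le_sum_one j).trans hV) x
  · exact fun j x => abs_le_of_weighted hε hN1 (continuous_du hf.u_C1 (hf.u_C1 j.succ) ht)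
      ((le_sum_one j).trans hUV) x
  · exact fun i j x => abs_le_of_weighted hε hN1
      ((ContDiffSlab.dx (n := 0) (hf.u_C1 j.succ) i).continuous ht)
      ((le_sum_two i j).trans hTop) x

end Extraction

/-! ### Inverse metric, four-velocity and ellipticity of `H` under the pointwise bounds -/

section Geometry

variable {Λ rhoBar a q c d} {T : ℝ} {g : MetricField} {u : ℝ → T3 → Fin 4 → ℝ} {rho : ℝ → T3 → ℝ}
  {t : ℝ}

theorem comparable_hRes (hf : IsDustField T g u rho) (hb : SpatialBootstrap a T c g)
    (ht : t ∈ Ico 0 T) (x : T3) : Comparable c fun i j => hRes a g i j t x := by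
  have e : ∀ X : Fin 3 → ℝ, ∑ i, ∑ j, hRes a g i j t x * X i * X j =
      ew a (-2) t * ∑ i : Fin 3, ∑ j : Fin 3, g t x i.succ j.succ * X i * X j := by
    intro X
    simp only [hRes, Finset.mul_sum]
    exact Finset.sum_congr rfl fun i _ => Finset.sum_congr rfl fun j _ => by ring
  refine ⟨fun i j => ?_, fun X => ?_, fun X => ?_⟩
  · simp only [hRes, (hf.g_symm t ht x).apply i.succ j.succ]
  · rw [e]; exact (hb t ht x X).1
  · rw [e]; exact (hb t ht x X).2

/-- For a null vector `Y`, the spatial rows paired with `Y` and the time row give `∑ M_{ij} Y^i Y^j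
= M_{00} (Y^0)² ≤ 0`. Positivity kills the spatial part, and then the time row kills `Y^0`. -/
theorem det_ne_zero_of_spatial {M : Matrix (Fin 4) (Fin 4) ℝ} (hs : M.IsSymm) (h0 : M 0 0 < 0)
    (hpos : ∀ X : Fin 3 → ℝ, X ≠ 0 → 0 < ∑ i : Fin 3, ∑ j : Fin 3, M i.succ j.succ * X i * X j) :
    M.det ≠ 0 := by
  intro hdet
  obtain ⟨Y, hY, hMY⟩ := Matrix.exists_mulVec_eq_zero_iff.2 hdet
  have h1 : M 0 0 * Y 0 + ∑ j : Fin 3, M 0 j.succ * Y j.succ = 0 := by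
    have := congrFun hMY 0
    simpa [Matrix.mulVec, dotProduct, Fin.sum_univ_succ (n := 3)] using this
  have h2 : ∀ i : Fin 3, M 0 i.succ * Y 0 + ∑ j : Fin 3, M i.succ j.succ * Y j.succ = 0 := by
    intro i
    have := congrFun hMY i.succ
    rw [← hs.apply 0 i.succ]
    simpa only [Matrix.mulVec, dotProduct, Fin.sum_univ_succ (n := 3), Pi.zero_apply] using this
  have h3 : ∑ i : Fin 3, ∑ j : Fin 3, M i.succ j.succ * Y i.succ * Y j.succ
      = M 0 0 * Y 0 ^ 2 := by
    have : ∀ i : Fin 3, ∑ j : Fin 3, M i.succ j.succ * Y i.succ * Y j.succ =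
        -Y 0 * (M 0 i.succ * Y i.succ) := by
      intro i
      have e : ∑ j : Fin 3, M i.succ j.succ * Y i.succ * Y j.succ =
          Y i.succ * ∑ j : Fin 3, M i.succ j.succ * Y j.succ := by
        rw [Finset.mul_sum]; exact Finset.sum_congr rfl fun j _ => by ring
      rw [e]; linear_combination Y i.succ * h2 i
    simp only [this]
    rw [← Finset.mul_sum]
    linear_combination -Y 0 * h1
  by_cases hX : (fun i : Fin 3 => Y i.succ) = 0
  · have h4 : Y 0 = 0 := by
      have h5 : ∀ j : Fin 3, Y j.succ = 0 := fun j => congrFun hX j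
      simp only [h5, mul_zero, Finset.sum_const_zero, add_zero] at h1
      exact (mul_eq_zero.1 h1).resolve_left h0.ne
    apply hY
    funext μ
    refine Fin.cases h4 (fun j => congrFun hX j) μ
  · have h4 := hpos _ hX
    rw [h3] at h4
    nlinarith [sq_nonneg (Y 0)]

variable (ha : IsScaleFactor Λ rhoBar a) (hq : 0 < q) (hc : 1 ≤ c) (hdc : 100 * c ^ 2 * d ≤ 1)
  (hf : IsDustField T g u rho) (hb : SpatialBootstrap a T c g) (ht : t ∈ Ico 0 T)
  (hp : PointBounds a q d g u t)

include hp in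
theorem PointBounds.nonneg : 0 ≤ d := by
  have := (abs_nonneg _).trans (hp.g00 0)
  exact nonneg_of_mul_nonneg_left this (ew_pos _ _ _)

include ha hq hp ht in
theorem PointBounds.weight_le : d * ew a (-q) t ≤ d :=
  mul_le_of_le_one_right hp.nonneg (ha.ew_le_one ht.1 (by linarith))

include hp ha hq ht in
theorem PointBounds.abs_g00_le (x : T3) : |g t x 0 0 + 1| ≤ d :=
  (hp.g00 x).trans (hp.weight_le ha hq ht)

include ha hq hc hdc hf hb ht hp in
theorem det_metric_ne_zero (x : T3) : (g t x).det ≠ 0 := by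
  have hd := (small_of_small hc hp.nonneg hdc).1
  have h1 := hp.abs_g00_le ha hq ht x
  rw [abs_le] at h1
  refine det_ne_zero_of_spatial (hf.g_symm t ht x) (by linarith) fun X hX => ?_
  have h2 := (hb t ht x X).1
  have h3 : 0 < ∑ i, X i ^ 2 := by
    obtain ⟨i, hi⟩ := Function.ne_iff.1 hX
    exact Finset.sum_pos' (fun _ _ => sq_nonneg _) ⟨i, Finset.mem_univ _, by
      simp only [Pi.zero_apply] at hi; positivity⟩
  have h4 : 0 < c⁻¹ * ∑ i, X i ^ 2 := by positivity
  exact pos_of_mul_pos_right (h4.trans_le h2) (ew_pos _ _ _).le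

theorem gInv_symm (hs : (g t x).IsSymm) (μ ν : Fin 4) : gInv g μ ν t x = gInv g ν μ t x := by
  unfold gInv
  conv_lhs => rw [← Matrix.transpose_apply (g t x)⁻¹, Matrix.transpose_nonsing_inv, hs.eq]

include ha hq hc hdc hf hb ht hp in
theorem continuous_gInv (μ ν : Fin 4) : Continuous (gInv g μ ν t) := by
  have hcont : Continuous fun x => g t x :=
    continuous_matrix fun μ ν => (hf.g_C2 μ ν).continuous ht
  have h : gInv g μ ν t = fun x => ((g t x).det)⁻¹ * (g t x).adjugate μ ν := by
    funext x
    simp [gInv, Matrix.inv_def]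
  rw [h]
  exact (hcont.matrix_det.inv₀ fun x => det_metric_ne_zero ha hq hc hdc hf hb ht hp x).mul
    (hcont.matrix_adjugate.matrix_elem μ ν)

theorem gInv_relations {x : T3} (hs : (g t x).IsSymm) (hdet : (g t x).det ≠ 0) :
    (g t x 0 0 * gInv g 0 0 t x + ∑ j : Fin 3, g t x 0 j.succ * gInv g 0 j.succ t x = 1) ∧
    (∀ j : Fin 3, g t x 0 j.succ * gInv g 0 0 t x +
      ∑ k : Fin 3, g t x j.succ k.succ * gInv g 0 k.succ t x = 0) ∧
    (∀ i k : Fin 3, ∑ j : Fin 3, gInv g i.succ j.succ t x * g t x j.succ k.succ +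
      gInv g 0 i.succ t x * g t x 0 k.succ = if i = k then 1 else 0) := by
  have h1 := Matrix.mul_nonsing_inv (g t x) (isUnit_iff_ne_zero.2 hdet)
  have h2 := Matrix.nonsing_inv_mul (g t x) (isUnit_iff_ne_zero.2 hdet)
  refine ⟨?_, fun j => ?_, fun i k => ?_⟩
  · have := congrFun (congrFun h1 0) 0
    simp only [Matrix.mul_apply, Fin.sum_univ_succ (n := 3), Matrix.one_apply_eq] at this
    rw [← this]
    simp only [gInv_symm hs 0 (Fin.succ _)]
    rfl
  · have := congrFun (congrFun h1 j.succ) 0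
    simp only [Matrix.mul_apply, Fin.sum_univ_succ (n := 3)] at this
    rw [Matrix.one_apply_ne (Fin.succ_ne_zero j)] at this
    rw [← this, hs.apply j.succ 0]
    simp only [gInv_symm hs 0 (Fin.succ _)]
    rfl
  · have := congrFun (congrFun h2 i.succ) k.succ
    simp only [Matrix.mul_apply, Fin.sum_univ_succ (n := 3)] at this
    rw [Matrix.one_apply, add_comm] at this
    simp only [Fin.succ_inj] at this
    rw [← this, gInv_symm hs 0 i.succ]
    rfl

include hp in
-- The balanced components are `e^{-Ω} g_{0j}`, `h_{jk}`, `e^{Ω} u^j`, `e^{Ω} g^{0j}` and `e^{2Ω}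
-- g^{jk}`: in them the metric relations contain no weights, and the matrix lemmas apply uniformly
-- in time.
theorem PointBounds.abs_shift_le (j : Fin 3) (x : T3) :
    |ew a (-1) t * g t x 0 j.succ| ≤ d * ew a (-q) t := by
  rw [abs_mul, abs_of_pos (ew_pos _ _ _), ← ew_mul_eq (by ring : -1 + -(q - 1) = -q)]
  nlinarith [hp.g0 j x, ew_pos a (-1) t]

include hp in
theorem PointBounds.abs_vel_le (j : Fin 3) (x : T3) :
    |ew a 1 t * u t x j.succ| ≤ d * ew a (-q) t := by
  rw [abs_mul, abs_of_pos (ew_pos _ _ _), ← ew_mul_eq (by ring : 1 + -(1 + q) = -q)]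
  nlinarith [hp.vel j x, ew_pos a 1 t]

theorem ew_neg_two (a : ℝ → ℝ) (t : ℝ) : ew a (-2) t = ew a (-1) t * ew a (-1) t := by
  rw [ew_mul_eq]; norm_num

theorem ew_two (a : ℝ → ℝ) (t : ℝ) : ew a 2 t = ew a 1 t * ew a 1 t := by
  rw [ew_mul_eq]; norm_num

theorem ew_neg_one_mul (a : ℝ → ℝ) (t : ℝ) : ew a (-1) t * ew a 1 t = 1 := by
  rw [mul_comm, ew_mul_neg]

include ha hq hc hdc hf hb ht hp in
theorem abs_gInv_zero_zero_le (x : T3) : |gInv g 0 0 t x| ≤ 2 := by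
  obtain ⟨r1, r2, -⟩ := gInv_relations (hf.g_symm t ht x)
    (det_metric_ne_zero ha hq hc hdc hf hb ht hp x)
  have hd := (small_of_small hc hp.nonneg hdc).1
  have hk := ew_neg_one_mul a t
  refine (comparable_hRes hf hb ht x).abs_inv_zero_zero_le hc (g₀ := g t x 0 0)
    (b := fun j => ew a (-1) t * g t x 0 j.succ) (β := fun j => ew a 1 t * gInv g 0 j.succ t x)
    ((hp.abs_g00_le ha hq ht x).trans (by linarith)) ?_ ?_
  · refine Eq.trans ?_ r1
    congr 1
    refine Finset.sum_congr rfl fun j _ => ?_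
    linear_combination g t x 0 j.succ * gInv g 0 j.succ t x * hk
  · intro j
    have := r2 j
    rw [show ∑ k, hRes a g j k t x * (ew a 1 t * gInv g 0 k.succ t x) =
      ew a (-1) t * ∑ k : Fin 3, g t x j.succ k.succ * gInv g 0 k.succ t x from ?_]
    · linear_combination ew a (-1) t * this
    · rw [Finset.mul_sum]
      refine Finset.sum_congr rfl fun k _ => ?_
      rw [hRes, ew_neg_two]
      linear_combination ew a (-1) t * g t x j.succ k.succ * gInv g 0 k.succ t x * hk

include ha hq hc hdc hf hb ht hp in
theorem abs_gInv_zero_le (j : Fin 3) (x : T3) :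
    |ew a 1 t * gInv g 0 j.succ t x| ≤ 4 * c * (d * ew a (-q) t) := by
  obtain ⟨-, r2, -⟩ := gInv_relations (hf.g_symm t ht x)
    (det_metric_ne_zero ha hq hc hdc hf hb ht hp x)
  have hk := ew_neg_one_mul a t
  refine (comparable_hRes hf hb ht x).abs_inv_zero_le hc
    (abs_gInv_zero_zero_le ha hq hc hdc hf hb ht hp x)
    (b := fun j => ew a (-1) t * g t x 0 j.succ) (β := fun j => ew a 1 t * gInv g 0 j.succ t x)
    (fun j => hp.abs_shift_le j x) ?_ j
  intro j
  have := r2 j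
  rw [show ∑ k, hRes a g j k t x * (ew a 1 t * gInv g 0 k.succ t x) =
    ew a (-1) t * ∑ k : Fin 3, g t x j.succ k.succ * gInv g 0 k.succ t x from ?_]
  · linear_combination ew a (-1) t * this
  · rw [Finset.mul_sum]
    refine Finset.sum_congr rfl fun k _ => ?_
    rw [hRes, ew_neg_two]
    linear_combination ew a (-1) t * g t x j.succ k.succ * gInv g 0 k.succ t x * hk

/-- The normalization condition in rescaled components, at a time `s` with weights from time `t`. -/
theorem unit_rescaled (hf : IsDustField T g u rho) {s : ℝ} (hs : s ∈ Ico 0 T) (t : ℝ) (x : T3) :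
    g s x 0 0 * u s x 0 ^ 2
      + 2 * u s x 0 * ∑ j : Fin 3, (ew a (-1) t * g s x 0 j.succ) * (ew a 1 t * u s x j.succ)
      + ∑ i : Fin 3, ∑ j : Fin 3, (ew a (-2) t * g s x i.succ j.succ) * (ew a 1 t * u s x i.succ)
        * (ew a 1 t * u s x j.succ) = -1 := by
  have hk := ew_neg_one_mul a t
  have h := hf.u_unit s hs x
  have e1 : ∀ j : Fin 3, (ew a (-1) t * g s x 0 j.succ) * (ew a 1 t * u s x j.succ) =
      g s x 0 j.succ * u s x j.succ := fun j => by
    linear_combination g s x 0 j.succ * u s x j.succ * hk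
  have e2 : ∀ i j : Fin 3, (ew a (-2) t * g s x i.succ j.succ) * (ew a 1 t * u s x i.succ)
      * (ew a 1 t * u s x j.succ) = g s x i.succ j.succ * u s x i.succ * u s x j.succ := fun i j => by
    rw [ew_neg_two]
    linear_combination g s x i.succ j.succ * u s x i.succ * u s x j.succ *
      (ew a (-1) t * ew a 1 t + 1) * hk
  simp only [e1, e2]
  rw [← h]
  simp only [Fin.sum_univ_succ (n := 3), Finset.sum_add_distrib, Finset.mul_sum]
  simp only [fun i : Fin 3 => (hf.g_symm s hs x).apply 0 i.succ]
  have e3 : ∀ i : Fin 3, 2 * u s x 0 * (g s x 0 i.succ * u s x i.succ) =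
      g s x 0 i.succ * u s x 0 * u s x i.succ + g s x 0 i.succ * u s x i.succ * u s x 0 :=
    fun i => by ring
  simp only [e3, Finset.sum_add_distrib]
  ring

include ha hq hc hdc hf hb ht hp in
theorem abs_four_velocity (x : T3) : 1 / 2 ≤ u t x 0 ∧ u t x 0 ≤ 2 :=
  (comparable_hRes hf hb ht x).four_velocity hc hdc (hp.abs_g00_le ha hq ht x)
    (fun j => (hp.abs_shift_le j x).trans (hp.weight_le ha hq ht))
    (fun j => (hp.abs_vel_le j x).trans (hp.weight_le ha hq ht)) (hf.u_future t ht x)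
    (unit_rescaled hf ht t x)

include ha hq hc hdc hf hb ht hp in
theorem exists_approx_inverse (x : T3) : ∃ E : Fin 3 → Fin 3 → ℝ, (∀ i j, |E i j| ≤ d) ∧
    ∀ i k, ∑ j, Hup a g u t x i j * hRes a g j k t x = (if i = k then 1 else 0) + E i k := by
  obtain ⟨-, -, r3⟩ := gInv_relations (hf.g_symm t ht x)
    (det_metric_ne_zero ha hq hc hdc hf hb ht hp x)
  have hk := ew_neg_one_mul a t
  have hu := abs_four_velocity ha hq hc hdc hf hb ht hp x
  have hu0 : u t x 0 ≠ 0 := by linarith [hu.1]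
  have hw := hp.weight_le ha hq ht
  refine (comparable_hRes hf hb ht x).approx_inverse hc hdc
    (γ := fun i j => ew a 2 t * gInv g i.succ j.succ t x)
    (β := fun j => ew a 1 t * gInv g 0 j.succ t x)
    (fun j => (hp.abs_shift_le j x).trans hw) (fun j => (hp.abs_vel_le j x).trans hw)
    hu.1 (abs_gInv_zero_zero_le ha hq hc hdc hf hb ht hp x)
    (fun j => (abs_gInv_zero_le ha hq hc hdc hf hb ht hp j x).trans (by gcongr)) ?_ ?_
  · intro i k
    rw [← r3 i k]
    congr 1
    · refine Finset.sum_congr rfl fun j _ => ?_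
      rw [hRes, ew_two, ew_neg_two]
      linear_combination gInv g i.succ j.succ t x * g t x j.succ k.succ *
        (ew a (-1) t * ew a 1 t + 1) * hk
    · linear_combination gInv g 0 i.succ t x * g t x 0 k.succ * hk
  · intro i j
    simp only [Hup, Matrix.of_apply, ew_two]
    field_simp

theorem Hup_symm (hf : IsDustField T g u rho) (ht : t ∈ Ico 0 T) (x : T3) (i j : Fin 3) :
    Hup a g u t x i j = Hup a g u t x j i := by
  simp only [Hup, Matrix.of_apply]
  rw [gInv_symm (hf.g_symm t ht x) i.succ j.succ]
  ring

include ha hq hc hdc hf hb ht hp in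
theorem le_quad_Hup (x : T3) (X : Fin 3 → ℝ) :
    (144 * c ^ 3)⁻¹ * ∑ i, X i ^ 2 ≤ ∑ i, ∑ j, Hup a g u t x i j * X i * X j := by
  obtain ⟨E, hE, hH⟩ := exists_approx_inverse ha hq hc hdc hf hb ht hp x
  exact (comparable_hRes hf hb ht x).le_quad_inv hc hp.nonneg hE hdc (Hup_symm hf ht x) hH X

include ha hq hc hdc hf hb ht hp in
theorem Hup_posDef (x : T3) : (Hup a g u t x).PosDef := by
  refine Matrix.PosDef.of_dotProduct_mulVec_pos ?_ fun X hX => ?_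
  · ext i j
    simp [Hup_symm hf ht x i j]
  · have h1 := le_quad_Hup ha hq hc hdc hf hb ht hp x X
    have h3 : 0 < ∑ i, X i ^ 2 := by
      obtain ⟨i, hi⟩ := Function.ne_iff.1 hX
      exact Finset.sum_pos' (fun _ _ => sq_nonneg _) ⟨i, Finset.mem_univ _, by
        simp only [Pi.zero_apply] at hi; positivity⟩
    have h4 : 0 < (144 * c ^ 3)⁻¹ * ∑ i, X i ^ 2 := by positivity
    refine (h4.trans_le h1).trans_le (le_of_eq ?_)
    simp only [dotProduct, Matrix.mulVec, Finset.mul_sum, Pi.star_apply, star_trivial]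
    exact Finset.sum_congr rfl fun i _ => Finset.sum_congr rfl fun j _ => by ring

include ha hq hc hdc hf hb ht hp in
theorem abs_Hup_sub_le (x x' : T3) (i j : Fin 3) :
    |Hup a g u t x i j - Hup a g u t x' i j| ≤ 600 * c ^ 2 * d := by
  obtain ⟨E, hE, hH⟩ := exists_approx_inverse ha hq hc hdc hf hb ht hp x
  obtain ⟨E', hE', hH'⟩ := exists_approx_inverse ha hq hc hdc hf hb ht hp x'
  have hd := (small_of_small hc hp.nonneg hdc).1
  have hd0 := hp.nonneg
  have := (comparable_hRes hf hb ht x).abs_inv_sub_le (comparable_hRes hf hb ht x') hc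
    (o := 24 * d) (by linarith) (fun i j =>
      (c1T_hRes hf.g_C2 ht i j).abs_sub_le (fun k y => hp.dx_h k i j y) x x') hE hE' hH hH' i j
  -- With oscillation `24 d` of `h` and error `d`, the bound is `4 c d + 576 c² d`.
  refine this.trans ?_
  have : c * d ≤ c ^ 2 * d := by
    rw [sq, mul_assoc]; exact le_mul_of_one_le_left (by positivity) hc
  nlinarith

end Geometry

/-! ### Derivatives of the four-velocity -/

/-- The set `S` is arbitrary so that the one-sided time derivative (`Ici 0`) and a spatial
derivative along a line (`univ`) are covered at once. -/
theorem deriv_normalization {S : Set ℝ} {r : ℝ} (hS : UniqueDiffWithinAt ℝ S r) {g₀ u₀ : ℝ → ℝ}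
    {b U : Fin 3 → ℝ → ℝ} {h : Fin 3 → Fin 3 → ℝ → ℝ} {g₀' τ : ℝ} {b' U' : Fin 3 → ℝ}
    {h' : Fin 3 → Fin 3 → ℝ} (hg₀ : HasDerivWithinAt g₀ g₀' S r)
    (hu₀ : HasDerivWithinAt u₀ τ S r) (hb : ∀ j, HasDerivWithinAt (b j) (b' j) S r)
    (hU : ∀ j, HasDerivWithinAt (U j) (U' j) S r)
    (hh : ∀ i j, HasDerivWithinAt (h i j) (h' i j) S r) (hsymm : ∀ i j, h i j r = h j i r)
    (hunit : ∀ᶠ s in 𝓝[S] r, g₀ s * u₀ s ^ 2 + 2 * u₀ s * ∑ j, b j s * U j s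
      + ∑ i, ∑ j, h i j s * U i s * U j s = -1)
    (hunit' : g₀ r * u₀ r ^ 2 + 2 * u₀ r * ∑ j, b j r * U j r
      + ∑ i, ∑ j, h i j r * U i r * U j r = -1) :
    g₀' * u₀ r ^ 2 + 2 * u₀ r * ∑ j, b' j * U j r + ∑ i, ∑ j, h' i j * U i r * U j r
      + 2 * ((g₀ r * u₀ r + ∑ j, b j r * U j r) * τ
        + ∑ j, (b j r * u₀ r + ∑ k, h j k r * U k r) * U' j) = 0 := by
  have h1 := ((hg₀.mul (hu₀.pow 2)).add ((hu₀.const_mul 2).mul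
    (HasDerivWithinAt.fun_sum fun j (_ : j ∈ Finset.univ) => (hb j).mul (hU j)))).add
    (HasDerivWithinAt.fun_sum fun i (_ : i ∈ Finset.univ) =>
      HasDerivWithinAt.fun_sum fun j (_ : j ∈ Finset.univ) => ((hh i j).mul (hU i)).mul (hU j))
  have h2 := (hasDerivWithinAt_const r S (-1 : ℝ)).congr_of_eventuallyEq hunit hunit'
  have h3 := hS.eq_deriv _ h1 h2
  simp only [Fin.sum_univ_three, Pi.mul_apply, Pi.pow_apply] at h3 ⊢
  rw [← h3]
  simp only [hsymm 1 0, hsymm 2 0, hsymm 2 1]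
  push_cast
  ring

section Geometry

variable {Λ rhoBar a q c d} {T : ℝ} {g : MetricField} {u : ℝ → T3 → Fin 4 → ℝ} {rho : ℝ → T3 → ℝ}
  {t : ℝ}

/-- The constant in the bounds for the derivatives of `u⁰`. -/
noncomputable def velConst (Λ rhoBar c : ℝ) : ℝ :=
  100 + 18 * (1 + 2 * Real.sqrt (Λ / 3 + rhoBar) * c)

theorem velConst_nonneg (hc : 1 ≤ c) : 1 ≤ velConst Λ rhoBar c := by
  have : 0 ≤ Real.sqrt (Λ / 3 + rhoBar) * c := mul_nonneg (Real.sqrt_nonneg _) (by linarith)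
  unfold velConst; linarith

variable (ha : IsScaleFactor Λ rhoBar a) (hr : 0 ≤ rhoBar) (hq : 0 < q) (hc : 1 ≤ c)
  (hdc : 100 * c ^ 2 * d ≤ 1)
  (hf : IsDustField T g u rho) (hb : SpatialBootstrap a T c g) (ht : t ∈ Ico 0 T)
  (hp : PointBounds a q d g u t)

include ha hq hc hdc hf hb ht hp in
-- The norms control `∂_𝐮 u^j` and `∂_i u^j` but not `∂_t u^j`, which is recovered from `u^0 ∂_t u^j
-- = ∂_𝐮 u^j - u^i ∂_i u^j` and `u^0 ≥ 1/2`.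
theorem abs_dt_vel_le (j : Fin 3) (x : T3) :
    |ew a 1 t * dt (fun t x => u t x j.succ) t x| ≤ 3 * ew a (-q) t := by
  have hu := abs_four_velocity ha hq hc hdc hf hb ht hp x
  have hd := (small_of_small hc hp.nonneg hdc).1
  have hd0 := hp.nonneg
  have hq1 := ha.ew_le_one ht.1 (by linarith : -q ≤ 0)
  have hqpos := ew_pos a (-q) t
  have h1 : |ew a 1 t * du u (fun t x => u t x j.succ) t x| ≤ d * ew a (-q) t := by
    rw [abs_mul, abs_of_pos (ew_pos _ _ _), ← ew_mul_eq (by ring : 1 + -(1 + q) = -q)]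
    nlinarith [hp.du_vel j x, ew_pos a 1 t]
  have h2 := abs_sum_mul_le (fun i => hp.abs_vel_le i x) (fun i => hp.dx_vel i j x)
  have h3 : u t x 0 * (ew a 1 t * dt (fun t x => u t x j.succ) t x) =
      ew a 1 t * du u (fun t x => u t x j.succ) t x -
        ∑ i : Fin 3, (ew a 1 t * u t x i.succ) * dx i (fun t x => u t x j.succ) t x := by
    rw [du, mul_add, Finset.mul_sum]
    rw [show ∑ i : Fin 3, ew a 1 t * (u t x i.succ * dx i (fun t x => u t x j.succ) t x) =
      ∑ i : Fin 3, (ew a 1 t * u t x i.succ) * dx i (fun t x => u t x j.succ) t x from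
        Finset.sum_congr rfl fun i _ => by ring]
    ring
  have h4 := abs_sub (ew a 1 t * du u (fun t x => u t x j.succ) t x)
    (∑ i : Fin 3, (ew a 1 t * u t x i.succ) * dx i (fun t x => u t x j.succ) t x)
  rw [← h3, abs_mul, abs_of_pos (by linarith [hu.1] : 0 < u t x 0)] at h4
  have h5 : d * ew a (-q) t * (d * ew a (-q) t) ≤ 1 * (d * ew a (-q) t) := by
    gcongr
    exact mul_le_one₀ (by linarith) hqpos.le hq1
  have h6 : d * ew a (-q) t ≤ 1 / 100 * ew a (-q) t := by gcongr
  nlinarith [abs_nonneg (ew a 1 t * dt (fun t x => u t x j.succ) t x), hu.1]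

include ha hr hq hc hdc hf hb ht hp in
theorem abs_dt_vel_zero_le (x : T3) :
    |dt (fun t x => u t x 0) t x| ≤ velConst Λ rhoBar c * ew a (-q) t := by
  have hh := comparable_hRes hf hb ht x
  have hd := (small_of_small hc hp.nonneg hdc).1
  have hd0 := hp.nonneg
  have hw := hp.weight_le ha hq ht
  have hqpos := ew_pos a (-q) t
  have hwq : d * ew a (-q) t ≤ ew a (-q) t := mul_le_of_le_one_left hqpos.le (by linarith)
  have hκ := ha.sqrt_le hr ht.1
  have hnb := Ico_mem_nhdsWithin_Ici ht
  refine hh.abs_deriv_le hc hdc (hp.abs_g00_le ha hq ht x)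
    (b := fun j => ew a (-1) t * g t x 0 j.succ) (U := fun j => ew a 1 t * u t x j.succ)
    (fun j => (hp.abs_shift_le j x).trans hw) (fun j => (hp.abs_vel_le j x).trans hw)
    (abs_four_velocity ha hq hc hdc hf hb ht hp x)
    (g₀' := dt (fun t x => g t x 0 0) t x)
    (b' := fun j => ew a (-1) t * dt (fun t x => g t x 0 j.succ) t x)
    (U' := fun j => ew a 1 t * dt (fun t x => u t x j.succ) t x)
    (h' := fun i j => ew a (-2) t * dt (fun t x => g t x i.succ j.succ) t x)
    (by positivity) (fun j => (hp.abs_vel_le j x).trans hwq) ((hp.dt_g00 x).trans hwq)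
    (fun j => ?_) (fun i j => ?_) (fun j => abs_dt_vel_le ha hq hc hdc hf hb ht hp j x) ?_
  · refine le_trans ?_ hwq
    rw [abs_mul, abs_of_pos (ew_pos _ _ _), ← ew_mul_eq (by ring : -1 + -(q - 1) = -q)]
    nlinarith [hp.dt_g0 j x, ew_pos a (-1) t]
  -- The quantity `e^{-2Ω} ∂_t g_{ij} = ∂_t h_{ij} + 2 Ω' h_{ij}` is bounded but not small, since
  -- the background expands. This is the source of the Hubble term in `velConst`.
  · have h1 := hp.dt_h i j x
    have h2 : ew a (-2) t * dt (fun t x => g t x i.succ j.succ) t x =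
        dt (hRes a g i j) t x +
          2 * Real.sqrt (Λ / 3 + rhoBar / (3 * a t ^ 3)) * hRes a g i j t x := by
      rw [dt_hRes ha hf.g_C2 ht]; ring
    rw [h2]
    refine (abs_add_le _ _).trans (add_le_add (h1.trans (by linarith)) ?_)
    rw [abs_mul, abs_mul, abs_two, abs_of_nonneg (Real.sqrt_nonneg _)]
    gcongr
    exact hh.abs_le hc i j
  -- The weights are frozen at time `t`, so they act as constants under the time derivative.
  · refine deriv_normalization (S := Ici 0) (r := t) (uniqueDiffOn_Ici 0 _ ht.1)
      (g₀ := fun s => g s x 0 0) (u₀ := fun s => u s x 0)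
      (b := fun j s => ew a (-1) t * g s x 0 j.succ) (U := fun j s => ew a 1 t * u s x j.succ)
      (h := fun i j s => ew a (-2) t * g s x i.succ j.succ)
      (ContDiffSlab.hasDerivWithinAt (n := 1) (hf.g_C2 0 0) ht x)
      (ContDiffSlab.hasDerivWithinAt (n := 0) (hf.u_C1 0) ht x)
      (fun j => (ContDiffSlab.hasDerivWithinAt (n := 1) (hf.g_C2 0 j.succ) ht x).const_mul _)
      (fun j => (ContDiffSlab.hasDerivWithinAt (n := 0) (hf.u_C1 j.succ) ht x).const_mul _)
      (fun i j => (ContDiffSlab.hasDerivWithinAt (n := 1) (hf.g_C2 i.succ j.succ) ht x).const_mul _)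
      (fun i j => hh.symm i j) ?_ (unit_rescaled hf ht t x)
    filter_upwards [hnb] with s hs
    exact unit_rescaled hf hs t x

include ha hq hc hdc ht hp in
theorem abs_dx_vel_le (i j : Fin 3) (x : T3) : |dx i (fun t x => u t x j.succ) t x| ≤ 1 := by
  have hd := (small_of_small hc hp.nonneg hdc).1
  exact (hp.dx_vel i j x).trans ((hp.weight_le ha hq ht).trans (by linarith))

include ha hq hc hdc hf hb ht hp in
-- Growth like `e^{Ω}` is affordable: in the final estimate this term is multiplied by `e^{(1-q)Ω}`,
-- which yields exactly the weight `e^{(2-q)Ω}` of `∂_t v`.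
theorem abs_dx_vel_zero_le (i : Fin 3) (x : T3) :
    |dx i (fun t x => u t x 0) t x| ≤ velConst Λ rhoBar c * ew a 1 t := by
  have hh := comparable_hRes hf hb ht x
  have hd := (small_of_small hc hp.nonneg hdc).1
  have hd0 := hp.nonneg
  have hw := hp.weight_le ha hq ht
  have hw1 : d * ew a (-(q - 1)) t ≤ ew a 1 t :=
    (mul_le_of_le_one_left (ew_pos _ _ _).le (by linarith)).trans (ha.ew_mono ht.1 (by linarith))
  have h1w := ha.one_le_ew ht.1 (zero_le_one)
  refine hh.abs_deriv_le hc hdc (hp.abs_g00_le ha hq ht x)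
    (b := fun j => ew a (-1) t * g t x 0 j.succ) (U := fun j => ew a 1 t * u t x j.succ)
    (fun j => (hp.abs_shift_le j x).trans hw) (fun j => (hp.abs_vel_le j x).trans hw)
    (abs_four_velocity ha hq hc hdc hf hb ht hp x)
    (g₀' := dx i (fun t x => g t x 0 0) t x)
    (b' := fun j => ew a (-1) t * dx i (fun t x => g t x 0 j.succ) t x)
    (U' := fun j => ew a 1 t * dx i (fun t x => u t x j.succ) t x)
    (h' := fun k l => dx i (hRes a g k l) t x)
    (by positivity) (fun j => ((hp.abs_vel_le j x).trans hw).trans (by linarith))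
    ((hp.dx_g00 i x).trans hw1) (fun j => ?_) (fun k l => ?_) (fun j => ?_) ?_
  · refine le_trans ?_ hw1
    rw [abs_mul, abs_of_pos (ew_pos _ _ _), ← ew_mul_eq (by ring : -1 + -(q - 2) = -(q - 1))]
    nlinarith [hp.dx_g0 i j x, ew_pos a (-1) t]
  · refine (hp.dx_h i k l x).trans ?_
    have : 0 ≤ Real.sqrt (Λ / 3 + rhoBar) * c := mul_nonneg (Real.sqrt_nonneg _) (by linarith)
    linarith
  · rw [abs_mul, abs_of_pos (ew_pos _ _ _)]
    nlinarith [abs_dx_vel_le ha hq hc hdc ht hp i j x]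
  · have hD : ∀ μ ν, HasDerivAt
        (fun s : ℝ => g t (x + Pi.single i (s : AddCircle (2 * Real.pi))) μ ν)
        (dx i (fun t x => g t x μ ν) t x) 0 := fun μ ν =>
      C1T.hasDerivAt_zero (φ := fun x => g t x μ ν)
        (ContDiffSlab.c1T (n := 1) (hf.g_C2 μ ν) ht) i x
    have hV : ∀ μ, HasDerivAt
        (fun s : ℝ => u t (x + Pi.single i (s : AddCircle (2 * Real.pi))) μ)
        (dx i (fun t x => u t x μ) t x) 0 := fun μ =>
      C1T.hasDerivAt_zero (φ := fun x => u t x μ) (ContDiffSlab.c1T (n := 0) (hf.u_C1 μ) ht) i x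
    have hHd : ∀ k l, HasDerivAt
        (fun s : ℝ => hRes a g k l t (x + Pi.single i (s : AddCircle (2 * Real.pi))))
        (dx i (hRes a g k l) t x) 0 := fun k l => (c1T_hRes hf.g_C2 ht k l).hasDerivAt_zero i x
    have key := deriv_normalization (S := univ) (r := (0 : ℝ)) uniqueDiffWithinAt_univ
      (b := fun j s => ew a (-1) t * g t (x + Pi.single i (s : AddCircle (2 * Real.pi))) 0 j.succ)
      (U := fun j s => ew a 1 t * u t (x + Pi.single i (s : AddCircle (2 * Real.pi))) j.succ)
      (h := fun k l s => hRes a g k l t (x + Pi.single i (s : AddCircle (2 * Real.pi))))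
      (hD 0 0).hasDerivWithinAt (hV 0).hasDerivWithinAt
      (fun j => ((hD 0 j.succ).const_mul (ew a (-1) t)).hasDerivWithinAt)
      (fun j => ((hV j.succ).const_mul (ew a 1 t)).hasDerivWithinAt)
      (fun k l => (hHd k l).hasDerivWithinAt)
      (fun k l => (comparable_hRes hf hb ht
        (x + Pi.single i ((0 : ℝ) : AddCircle (2 * Real.pi)))).symm k l)
      (Eventually.of_forall fun s =>
        unit_rescaled hf ht t (x + Pi.single i (s : AddCircle (2 * Real.pi))))
      (unit_rescaled hf ht t (x + Pi.single i ((0 : ℝ) : AddCircle (2 * Real.pi))))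
    simpa only [QuotientAddGroup.mk_zero, AddCircle.coe_zero, Pi.single_zero, add_zero] using! key

end Geometry

/-! ### Curves in `H²` -/

/-- The component of an element of `H²` of multi-index `α` as a continuous linear map. -/
noncomputable def H2.component (α : multiIdx 2) : H2 →L[ℝ] L2 :=
  (PiLp.proj 2 (fun _ : multiIdx 2 => L2) α).comp (sobolevSpace 2).subtypeL

section Curves

variable {T : ℝ} {v : ℝ → H2} {t : ℝ}

theorem hasDerivWithinAt_vt (hv : ContDiffOn ℝ 2 v (Ico 0 T)) (ht : t ∈ Ico 0 T) :
    HasDerivWithinAt v (vt v t) (Ici 0) t := by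
  have h := (hv.differentiableOn (by simp) t ht).hasDerivWithinAt.mono_of_mem_nhdsWithin
    (Ico_mem_nhdsWithin_Ici ht)
  exact h.differentiableWithinAt.hasDerivWithinAt

theorem hasDerivWithinAt_vt_vt (hv : ContDiffOn ℝ 2 v (Ico 0 T)) (ht : t ∈ Ico 0 T) :
    HasDerivWithinAt (vt v) (vt (vt v) t) (Ici 0) t := by
  have h1 : ContDiffOn ℝ 1 (vt v) (Ico 0 T) := by
    refine (hv.derivWithin (uniqueDiffOn_Ico 0 T) (m := 1) (by norm_num)).congr fun s hs => ?_
    exact (((hasDerivWithinAt_vt hv hs).mono fun r hr => hr.1).derivWithin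
      (uniqueDiffOn_Ico 0 T s hs)).symm
  have h := (h1.differentiableOn (by simp) t ht).hasDerivWithinAt.mono_of_mem_nhdsWithin
    (Ico_mem_nhdsWithin_Ici ht)
  exact h.differentiableWithinAt.hasDerivWithinAt

theorem hasDerivWithinAt_D1 (hv : ContDiffOn ℝ 2 v (Ico 0 T)) (ht : t ∈ Ico 0 T) (ν : Fin 4) :
    HasDerivWithinAt (D1 v ν) (D2 v 0 ν t) (Ici 0) t := by
  refine Fin.cases ?_ (fun b => ?_) ν
  · exact (H2.component (zeroIdx 2)).hasFDerivAt.comp_hasDerivWithinAt t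
      (hasDerivWithinAt_vt_vt hv ht)
  · exact (H2.component ⟨Pi.single b 1, mem_multiIdx.mpr (by simp)⟩).hasFDerivAt.comp_hasDerivWithinAt
      t (hasDerivWithinAt_vt hv ht)

theorem isWeakDeriv_D1 (v : ℝ → H2) (t : ℝ) (i : Fin 3) (ν : Fin 4) :
    IsWeakDeriv (Pi.single i 1) (D1 v ν t) (D2 v i.succ ν t) := by
  refine Fin.cases ?_ (fun b => ?_) ν
  · exact (vt v t).isWeakDeriv_val i
  · exact (v t).isWeakDeriv_d1 i b

theorem D2_symm (v : ℝ → H2) (t : ℝ) (μ ν : Fin 4) : D2 v μ ν t = D2 v ν μ t := by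
  refine Fin.cases ?_ (fun a => ?_) μ
  · refine Fin.cases rfl (fun b => rfl) ν
  · refine Fin.cases rfl (fun b => (v t).d2_comm a b) ν

theorem IsWeakDeriv.sum {ι : Type*} {α : Fin 3 → ℕ} (s : Finset ι) {f f' : ι → L2}
    (h : ∀ i ∈ s, IsWeakDeriv α (f i) (f' i)) : IsWeakDeriv α (∑ i ∈ s, f i) (∑ i ∈ s, f' i) := by
  classical
  induction s using Finset.induction_on with
  | empty => simpa using isWeakDeriv_zero α
  | insert i s hi ih =>
    rw [Finset.sum_insert hi, Finset.sum_insert hi]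
    exact (h i (Finset.mem_insert_self i s)).add
      (ih fun j hj => h j (Finset.mem_insert_of_mem hj))

variable {u : ℝ → T3 → Fin 4 → ℝ}

/-- By the product rule and the symmetry of second derivatives, the commutator of `∂_t` and `∂_𝐮` is
the first-order operator `(∂_t u^ν) ∂_ν`. Only first derivatives of `u` and second derivatives of
`v` occur, so third derivatives are never needed. -/
theorem hasDerivWithinAt_duV (hu : ∀ μ, ContDiffSlab 1 T fun t x => u t x μ)
    (hv : ContDiffOn ℝ 2 v (Ico 0 T)) (ht : t ∈ Ico 0 T) :
    HasDerivWithinAt (duV u v)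
      (∑ ν, mulL2 (dt (fun t x => u t x ν) t) (D1 v ν t) + duDV u v 0 t) (Ici 0) t := by
  have h := HasDerivWithinAt.fun_sum fun ν (_ : ν ∈ (Finset.univ : Finset (Fin 4))) =>
    (hu ν).hasDerivWithinAt_mulL2 ht (hasDerivWithinAt_D1 hv ht ν)
  refine h.congr_deriv ?_
  rw [Finset.sum_add_distrib, duDV]
  simp only [D2_symm v t 0]

theorem isWeakDeriv_duV (hu : ∀ μ, ContDiffSlab 1 T fun t x => u t x μ) (ht : t ∈ Ico 0 T)
    (i : Fin 3) :
    IsWeakDeriv (Pi.single i 1) (duV u v t)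
      (∑ ν, mulL2 (dx i (fun t x => u t x ν) t) (D1 v ν t) + duDV u v i.succ t) := by
  have h := IsWeakDeriv.sum Finset.univ fun ν _ => IsWeakDeriv.mulL2
    (ContDiffSlab.c1T (n := 0) (hu ν) ht) (isWeakDeriv_D1 v t i ν)
  rw [Finset.sum_add_distrib] at h
  simp only [duDV, D2_symm v t _ i.succ]
  exact h

end Curves

/-! ### The identity for the elliptic operator -/

theorem coeFn_sum {ι : Type*} (s : Finset ι) {F : ι → L2} {φ : ι → T3 → ℝ}
    (h : ∀ i ∈ s, F i =ᵐ[volume] φ i) :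
    ((∑ i ∈ s, F i : L2) : T3 → ℝ) =ᵐ[volume] fun x => ∑ i ∈ s, φ i x := by
  classical
  induction s using Finset.induction_on with
  | empty =>
    simp only [Finset.sum_empty]
    filter_upwards [Lp.coeFn_zero ℝ 2 (volume : Measure T3)] with x hx
    rw [hx]; rfl
  | insert i s hi ih =>
    simp only [Finset.sum_insert hi]
    filter_upwards [Lp.coeFn_add (F i) (∑ i ∈ s, F i), h i (Finset.mem_insert_self i s),
      ih fun j hj => h j (Finset.mem_insert_of_mem hj)] with x h1 h2 h3
    rw [h1, Pi.add_apply, h2, h3]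

/-- With `X` in the role of the Hessian of `v`, this eliminates `X 0 0` and `X 0 i` through the
contractions `U^ν X_{νμ}`; symmetry of `G` and `X` makes the two sides agree. -/
theorem elliptic_identity_pointwise {G X : Fin 4 → Fin 4 → ℝ} {U : Fin 4 → ℝ} (E : ℝ)
    (hG : ∀ μ ν, G μ ν = G ν μ) (hX : ∀ μ ν, X μ ν = X ν μ) (hU : U 0 ≠ 0) :
    ∑ i : Fin 3, ∑ j : Fin 3, (E * G i.succ j.succ + E * (G 0 0 * U i.succ * U j.succ / (U 0) ^ 2)
        - E * G 0 i.succ * (U j.succ / U 0) - E * G 0 j.succ * (U i.succ / U 0)) * X i.succ j.succ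
      = E * ∑ α, ∑ β, G α β * X α β - E * (G 0 0 / U 0 * ∑ ν, U ν * X ν 0)
        + E * ∑ i : Fin 3, (G 0 0 * U i.succ / (U 0) ^ 2 - 2 * (G 0 i.succ / U 0))
          * ∑ ν, U ν * X ν i.succ := by
  simp only [Fin.sum_univ_succ (n := 3), hG (Fin.succ _) 0, hX (Fin.succ _) 0]
  simp only [Fin.sum_univ_three, hX (Fin.succ 1) (Fin.succ 0), hX (Fin.succ 2) (Fin.succ 0),
    hX (Fin.succ 2) (Fin.succ 1), hG (Fin.succ 1) (Fin.succ 0), hG (Fin.succ 2) (Fin.succ 0),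
    hG (Fin.succ 2) (Fin.succ 1)]
  field_simp
  ring

theorem continuous_Hup {a : ℝ → ℝ} {g : MetricField} {u : ℝ → T3 → Fin 4 → ℝ} {t : ℝ}
    (hG : ∀ μ ν, Continuous (gInv g μ ν t)) (hu : ∀ μ, Continuous fun x => u t x μ)
    (hu0 : ∀ x, u t x 0 ≠ 0) (i j : Fin 3) : Continuous fun x => Hup a g u t x i j := by
  have hu02 : ∀ x, u t x 0 ^ 2 ≠ 0 := fun x => pow_ne_zero 2 (hu0 x)
  simp only [Hup, Matrix.of_apply]
  exact (((continuous_const.mul (hG _ _)).add (continuous_const.mul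
    ((((hG 0 0).mul (hu _)).mul (hu _)).div ((hu 0).pow 2) hu02))).sub
    ((continuous_const.mul (hG _ _)).mul ((hu _).div (hu 0) hu0))).sub
    ((continuous_const.mul (hG _ _)).mul ((hu _).div (hu 0) hu0))

theorem elliptic_identity {a : ℝ → ℝ} {g : MetricField} {u : ℝ → T3 → Fin 4 → ℝ} {t : ℝ}
    (hG : ∀ μ ν x, gInv g μ ν t x = gInv g ν μ t x) (hGc : ∀ μ ν, Continuous (gInv g μ ν t))
    (hu : ∀ μ, Continuous fun x => u t x μ) (hu0 : ∀ x, u t x 0 ≠ 0) (v : ℝ → H2) :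
    ∑ i : Fin 3, ∑ j : Fin 3, mulL2 (fun x => Hup a g u t x i j) (D2 v i.succ j.succ t)
      = ew a 2 t • boxHat g v t
        - ew a 2 t • mulL2 (fun x => gInv g 0 0 t x / u t x 0) (duDV u v 0 t)
        + ew a 2 t • ∑ i : Fin 3,
            mulL2 (fun x => gInv g 0 0 t x * u t x i.succ / (u t x 0) ^ 2
              - 2 * (gInv g 0 i.succ t x / u t x 0)) (duDV u v i.succ t) := by
  have hu02 : ∀ x, u t x 0 ^ 2 ≠ 0 := fun x => pow_ne_zero 2 (hu0 x)
  have cH := continuous_Hup (a := a) hGc hu hu0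
  have c0 : Continuous fun x => gInv g 0 0 t x / u t x 0 := (hGc 0 0).div (hu 0) hu0
  have ci : ∀ i : Fin 3, Continuous fun x => gInv g 0 0 t x * u t x i.succ / (u t x 0) ^ 2
      - 2 * (gInv g 0 i.succ t x / u t x 0) := fun i =>
    (((hGc 0 0).mul (hu _)).div ((hu 0).pow 2) hu02).sub
      (continuous_const.mul ((hGc _ _).div (hu 0) hu0))
  have eL := coeFn_sum Finset.univ fun i (_ : i ∈ (Finset.univ : Finset (Fin 3))) =>
    coeFn_sum Finset.univ fun j (_ : j ∈ (Finset.univ : Finset (Fin 3))) =>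
      coeFn_mulL2 (cH i j) (D2 v i.succ j.succ t)
  have eB := coeFn_sum Finset.univ fun α (_ : α ∈ (Finset.univ : Finset (Fin 4))) =>
    coeFn_sum Finset.univ fun β (_ : β ∈ (Finset.univ : Finset (Fin 4))) =>
      coeFn_mulL2 (hGc α β) (D2 v α β t)
  have eD := fun μ => coeFn_sum Finset.univ fun ν (_ : ν ∈ (Finset.univ : Finset (Fin 4))) =>
    coeFn_mulL2 (hu ν) (D2 v ν μ t)
  have eS := coeFn_sum Finset.univ fun i (_ : i ∈ (Finset.univ : Finset (Fin 3))) =>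
    (coeFn_mulL2 (ci i) (duDV u v i.succ t))
  apply Lp.ext
  filter_upwards [eL, eB, eS, coeFn_mulL2 c0 (duDV u v 0 t), ae_all_iff.2 eD,
    Lp.coeFn_add (ew a 2 t • boxHat g v t
        - ew a 2 t • mulL2 (fun x => gInv g 0 0 t x / u t x 0) (duDV u v 0 t))
      (ew a 2 t • ∑ i : Fin 3,
            mulL2 (fun x => gInv g 0 0 t x * u t x i.succ / (u t x 0) ^ 2
              - 2 * (gInv g 0 i.succ t x / u t x 0)) (duDV u v i.succ t)),
    Lp.coeFn_sub (ew a 2 t • boxHat g v t)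
      (ew a 2 t • mulL2 (fun x => gInv g 0 0 t x / u t x 0) (duDV u v 0 t)),
    Lp.coeFn_smul (ew a 2 t) (boxHat g v t),
    Lp.coeFn_smul (ew a 2 t) (mulL2 (fun x => gInv g 0 0 t x / u t x 0) (duDV u v 0 t)),
    Lp.coeFn_smul (ew a 2 t) (∑ i : Fin 3,
            mulL2 (fun x => gInv g 0 0 t x * u t x i.succ / (u t x 0) ^ 2
              - 2 * (gInv g 0 i.succ t x / u t x 0)) (duDV u v i.succ t))]
    with x h1 h2 h3 h4 h5 h6 h7 h8 h9 h10
  rw [h1, h6, Pi.add_apply, h7, Pi.sub_apply, h8, h9, h10]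
  simp only [Pi.smul_apply, smul_eq_mul]
  rw [h3, h4]
  have h2' : (boxHat g v t : T3 → ℝ) x = _ := h2
  have h5' : ∀ μ, (duDV u v μ t : T3 → ℝ) x = ∑ ν, u t x ν * D2 v ν μ t x := h5
  simp only [h2', h5']
  exact elliptic_identity_pointwise (G := fun μ ν => gInv g μ ν t x)
    (X := fun μ ν => D2 v μ ν t x) (U := fun μ => u t x μ) _ (fun μ ν => hG μ ν x)
    (fun μ ν => by rw [D2_symm]) (hu0 x)

/-! ### The variable coefficient elliptic estimate -/

/-- The elliptic estimate for an operator whose coefficients oscillate little. -/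
theorem H2.sum_norm_d2_le (w : H2) {A : Fin 3 → Fin 3 → T3 → ℝ} (hA : ∀ i j, Continuous (A i j))
    {l o : ℝ} (hl : 0 < l) (x₀ : T3)
    (hpos : ∀ X : Fin 3 → ℝ, l * ∑ i, X i ^ 2 ≤ ∑ i, ∑ j, A i j x₀ * X i * X j)
    (hosc : ∀ i j x, |A i j x - A i j x₀| ≤ o) (hlo : 18 * o ≤ l) :
    ∑ a, ∑ b, ‖w.d2 a b‖ ≤ 18 * l⁻¹ * ‖∑ i, ∑ j, mulL2 (A i j) (w.d2 i j)‖ := by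
  set S := ∑ a, ∑ b, ‖w.d2 a b‖
  set L : L2 := ∑ i, ∑ j, mulL2 (A i j) (w.d2 i j)
  have hS0 : 0 ≤ S := by positivity
  -- Freezing of the coefficients: the constant coefficient operator at `x₀` differs from the given
  -- one by coefficients of size `o`.
  have hsplit : ∀ i j, A i j x₀ • w.d2 i j =
      mulL2 (A i j) (w.d2 i j) - mulL2 (fun x => A i j x - A i j x₀) (w.d2 i j) := by
    intro i j
    apply Lp.ext
    filter_upwards [Lp.coeFn_smul (A i j x₀) (w.d2 i j), coeFn_mulL2 (hA i j) (w.d2 i j),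
      coeFn_mulL2 (f := fun x => A i j x - A i j x₀) ((hA i j).sub continuous_const) (w.d2 i j),
      Lp.coeFn_sub (mulL2 (A i j) (w.d2 i j)) (mulL2 (fun x => A i j x - A i j x₀) (w.d2 i j))]
      with x h1 h2 h3 h4
    rw [h1, h4, Pi.sub_apply, h2, h3, Pi.smul_apply, smul_eq_mul]
    ring
  have hfrozen : ‖∑ i, ∑ j, A i j x₀ • w.d2 i j‖ ≤ ‖L‖ + o * S := by
    simp only [hsplit, Finset.sum_sub_distrib]
    refine (norm_sub_le _ _).trans (add_le_add le_rfl ?_)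
    simp only [S, Finset.mul_sum]
    refine (norm_sum_le _ _).trans (Finset.sum_le_sum fun i _ => ?_)
    refine (norm_sum_le _ _).trans (Finset.sum_le_sum fun j _ => ?_)
    exact norm_mulL2_le ((hA i j).sub continuous_const) _ (hosc i j)
  have hS : S ≤ 9 * (l⁻¹ * (‖L‖ + o * S)) := by
    calc S ≤ ∑ _a : Fin 3, ∑ _b : Fin 3, l⁻¹ * (‖L‖ + o * S) := by
          refine Finset.sum_le_sum fun a _ => Finset.sum_le_sum fun b _ =>
            (w.norm_d2_le (A := fun i j => A i j x₀) hl hpos a b).trans ?_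
          gcongr
      _ = _ := by simp; ring
  -- Summing over the nine pairs `(a, b)` costs a factor `9`, so `18 o ≤ l` lets half of `S` be
  -- absorbed.
  have h1 : 9 * (l⁻¹ * (o * S)) ≤ 1 / 2 * S := by
    have : l⁻¹ * (18 * o) ≤ 1 := by
      rw [inv_mul_le_iff₀ hl]; linarith
    nlinarith
  nlinarith

section Estimate

variable {Λ rhoBar a q c d} {T : ℝ} {g : MetricField} {u : ℝ → T3 → Fin 4 → ℝ} {rho : ℝ → T3 → ℝ}
  {t : ℝ} {v : ℝ → H2}

variable (ha : IsScaleFactor Λ rhoBar a) (hr : 0 ≤ rhoBar) (hq : 0 < q) (hc : 1 ≤ c)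
  (hdc : 100 * c ^ 2 * d ≤ 1)
  (hf : IsDustField T g u rho) (hb : SpatialBootstrap a T c g) (ht : t ∈ Ico 0 T)
  (hp : PointBounds a q d g u t)

theorem norm_le_add_of_sum {ι : Type*} (s : Finset ι) (w : L2) {f : ι → L2} {B : ι → ℝ}
    (h : ∀ i ∈ s, ‖f i‖ ≤ B i) : ‖w‖ ≤ ‖∑ i ∈ s, f i + w‖ + ∑ i ∈ s, B i := by
  have h1 := norm_sub_le (∑ i ∈ s, f i + w) (∑ i ∈ s, f i)
  rw [add_sub_cancel_left] at h1
  exact h1.trans (add_le_add le_rfl ((norm_sum_le _ _).trans (Finset.sum_le_sum h)))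

include ha hr hq hc hdc hf hb ht hp in
theorem norm_duDV_zero_le :
    ‖duDV u v 0 t‖ ≤ ‖∑ ν, mulL2 (dt (fun t x => u t x ν) t) (D1 v ν t) + duDV u v 0 t‖
      + (velConst Λ rhoBar c * ew a (-q) t * ‖D1 v 0 t‖
        + ∑ j : Fin 3, 3 * ew a (-1 - q) t * ‖D1 v j.succ t‖) := by
  refine (norm_le_add_of_sum Finset.univ _ (f := fun ν => mulL2 (dt (fun t x => u t x ν) t) (D1 v ν t))
    (B := Fin.cons (velConst Λ rhoBar c * ew a (-q) t * ‖D1 v 0 t‖)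
      fun j => 3 * ew a (-1 - q) t * ‖D1 v j.succ t‖) fun ν _ => ?_).trans (le_of_eq ?_)
  · refine Fin.cases ?_ (fun j => ?_) ν
    · exact norm_mulL2_le ((ContDiffSlab.dt (n := 0) (hf.u_C1 0)).continuous ht) _
        (abs_dt_vel_zero_le ha hr hq hc hdc hf hb ht hp)
    · refine norm_mulL2_le ((ContDiffSlab.dt (n := 0) (hf.u_C1 j.succ)).continuous ht) _ fun x => ?_
      have h1 := abs_dt_vel_le ha hq hc hdc hf hb ht hp j x
      rw [abs_mul, abs_of_pos (ew_pos _ _ _)] at h1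
      rw [← ew_mul_eq (show -1 + -q = -1 - q by ring)]
      have h2 := mul_le_mul_of_nonneg_left h1 (ew_pos a (-1) t).le
      rw [← mul_assoc, ew_neg_one_mul, one_mul] at h2
      linarith
  · rw [Fin.sum_univ_succ (n := 3)
      (f := Fin.cons (velConst Λ rhoBar c * ew a (-q) t * ‖D1 v 0 t‖) _)]
    simp only [Fin.cons_zero, Fin.cons_succ]

include ha hq hc hdc hf hb ht hp in
theorem norm_duDV_succ_le (i : Fin 3) :
    ‖duDV u v i.succ t‖ ≤
      ‖∑ ν, mulL2 (dx i (fun t x => u t x ν) t) (D1 v ν t) + duDV u v i.succ t‖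
      + (velConst Λ rhoBar c * ew a 1 t * ‖D1 v 0 t‖ + ∑ j : Fin 3, ‖D1 v j.succ t‖) := by
  refine (norm_le_add_of_sum Finset.univ _
    (f := fun ν => mulL2 (dx i (fun t x => u t x ν) t) (D1 v ν t))
    (B := Fin.cons (velConst Λ rhoBar c * ew a 1 t * ‖D1 v 0 t‖)
      fun j => ‖D1 v j.succ t‖) fun ν _ => ?_).trans (le_of_eq ?_)
  · refine Fin.cases ?_ (fun j => ?_) ν
    · exact norm_mulL2_le ((ContDiffSlab.dx (n := 0) (hf.u_C1 0) i).continuous ht) _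
        (abs_dx_vel_zero_le ha hq hc hdc hf hb ht hp i)
    · have := norm_mulL2_le ((ContDiffSlab.dx (n := 0) (hf.u_C1 j.succ) i).continuous ht)
        (D1 v j.succ t) (abs_dx_vel_le ha hq hc hdc ht hp i j)
      rw [one_mul] at this
      exact this
  · rw [Fin.sum_univ_succ (n := 3)
      (f := Fin.cons (velConst Λ rhoBar c * ew a 1 t * ‖D1 v 0 t‖) _)]
    simp only [Fin.cons_zero, Fin.cons_succ]

include ha hq hc hdc hf hb ht hp in
theorem abs_coeff_zero_le (x : T3) : |gInv g 0 0 t x / u t x 0| ≤ 4 := by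
  have hu := (abs_four_velocity ha hq hc hdc hf hb ht hp x).1
  have h := abs_gInv_zero_zero_le ha hq hc hdc hf hb ht hp x
  rw [abs_div, abs_of_pos (by linarith : 0 < u t x 0), div_le_iff₀ (by linarith)]
  linarith

include ha hq hc hdc hf hb ht hp in
-- Both `u^i` and `g^{0i}` are of size `e^{(-1-q)Ω}` with a small constant, and that smallness
-- compensates all numerical factors.
theorem abs_coeff_succ_le (i : Fin 3) (x : T3) :
    |gInv g 0 0 t x * u t x i.succ / (u t x 0) ^ 2 - 2 * (gInv g 0 i.succ t x / u t x 0)|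
      ≤ ew a (-1 - q) t := by
  have hu := (abs_four_velocity ha hq hc hdc hf hb ht hp x).1
  have hupos : 0 < u t x 0 := by linarith
  have h0 := abs_coeff_zero_le ha hq hc hdc hf hb ht hp x
  have h1 := hp.abs_vel_le i x
  have h2 := abs_gInv_zero_le ha hq hc hdc hf hb ht hp i x
  have hd0 := hp.nonneg
  have hcd := (small_of_small hc hd0 hdc).2
  have hd := (small_of_small hc hd0 hdc).1
  have hw := ew_pos a (-q) t
  have e : gInv g 0 0 t x * u t x i.succ / (u t x 0) ^ 2 - 2 * (gInv g 0 i.succ t x / u t x 0) =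
      ew a (-1) t * ((gInv g 0 0 t x / u t x 0 * (ew a 1 t * u t x i.succ)
        - 2 * (ew a 1 t * gInv g 0 i.succ t x)) / u t x 0) := by
    have hk := ew_neg_one_mul a t
    field_simp
    linear_combination -(gInv g 0 0 t x * u t x i.succ - u t x 0 * 2 * gInv g 0 i.succ t x) * hk
  rw [e, abs_mul, abs_of_pos (ew_pos _ _ _), ← ew_mul_eq (show -1 + -q = -1 - q by ring)]
  refine mul_le_mul_of_nonneg_left ?_ (ew_pos _ _ _).le
  rw [abs_div, abs_of_pos hupos, div_le_iff₀ hupos]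
  have h3 : |gInv g 0 0 t x / u t x 0 * (ew a 1 t * u t x i.succ)| ≤ 4 * (d * ew a (-q) t) := by
    rw [abs_mul]; gcongr
  have h4 : |2 * (ew a 1 t * gInv g 0 i.succ t x)| ≤ 2 * (4 * c * (d * ew a (-q) t)) := by
    rw [abs_mul, abs_two]; gcongr
  have h5 := abs_sub (gInv g 0 0 t x / u t x 0 * (ew a 1 t * u t x i.succ))
    (2 * (ew a 1 t * gInv g 0 i.succ t x))
  have h6 : d * ew a (-q) t ≤ 1 / 100 * ew a (-q) t := by gcongr
  have h7 : c * d * ew a (-q) t ≤ 1 / 100 * ew a (-q) t := by gcongr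
  nlinarith

include ha hr hq hc hdc hf hb ht hp in
/-- The elliptic estimate under pointwise bounds on the coefficients. -/
theorem sum_norm_D2_le (hdc' : 18 * (600 * c ^ 2 * d) ≤ (144 * c ^ 3)⁻¹) :
    ∑ i : Fin 3, ∑ j : Fin 3, ‖D2 v i.succ j.succ t‖ ≤
      18 * (144 * c ^ 3) * (15 * velConst Λ rhoBar c) *
        (ew a 2 t * ‖boxHat g v t‖
          + ew a 2 t * ‖∑ ν, mulL2 (dt (fun t x => u t x ν) t) (D1 v ν t) + duDV u v 0 t‖
          + ∑ i : Fin 3, ew a (1 - q) t *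
            ‖∑ ν, mulL2 (dx i (fun t x => u t x ν) t) (D1 v ν t) + duDV u v i.succ t‖
          + ew a (2 - q) t * ‖D1 v 0 t‖
          + ∑ i : Fin 3, ew a (1 - q) t * ‖D1 v i.succ t‖) := by
  have hGc := continuous_gInv ha hq hc hdc hf hb ht hp
  have hu : ∀ μ, Continuous fun x => u t x μ := fun μ => (hf.u_C1 μ).continuous ht
  have hu0 : ∀ x, u t x 0 ≠ 0 := fun x => (hf.u_future t ht x).ne'
  have hu02 : ∀ x, u t x 0 ^ 2 ≠ 0 := fun x => pow_ne_zero 2 (hu0 x)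
  have cH := continuous_Hup (a := a) hGc hu hu0
  -- The oscillation bound is global on the torus, so any base point will do; `0` is used.
  have hell := (v t).sum_norm_d2_le (A := fun i j x => Hup a g u t x i j) cH
    (l := (144 * c ^ 3)⁻¹) (by positivity) 0
    (le_quad_Hup ha hq hc hdc hf hb ht hp 0)
    (fun i j x => abs_Hup_sub_le ha hq hc hdc hf hb ht hp x 0 i j) hdc'
  rw [inv_inv] at hell
  have hid := elliptic_identity (fun μ ν x => gInv_symm (hf.g_symm t ht x) μ ν) hGc hu hu0 v
    (a := a)
  refine hell.trans ?_
  rw [mul_assoc (18 * (144 * c ^ 3))]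
  refine mul_le_mul_of_nonneg_left ?_ (by positivity)
  change ‖∑ i : Fin 3, ∑ j : Fin 3, mulL2 (fun x => Hup a g u t x i j) (D2 v i.succ j.succ t)‖ ≤ _
  rw [hid]
  have hV := velConst_nonneg (Λ := Λ) (rhoBar := rhoBar) hc
  set V := velConst Λ rhoBar c
  have c0 : Continuous fun x => gInv g 0 0 t x / u t x 0 := (hGc 0 0).div (hu 0) hu0
  have ci : ∀ i : Fin 3, Continuous fun x => gInv g 0 0 t x * u t x i.succ / (u t x 0) ^ 2
      - 2 * (gInv g 0 i.succ t x / u t x 0) := fun i =>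
    (((hGc 0 0).mul (hu _)).div ((hu 0).pow 2) hu02).sub
      (continuous_const.mul ((hGc _ _).div (hu 0) hu0))
  have n0 := norm_mulL2_le c0 (duDV u v 0 t) (abs_coeff_zero_le ha hq hc hdc hf hb ht hp)
  have ni := fun i : Fin 3 => norm_mulL2_le (ci i) (duDV u v i.succ t)
    (abs_coeff_succ_le ha hq hc hdc hf hb ht hp i)
  have m0 := norm_duDV_zero_le ha hr hq hc hdc hf hb ht hp (v := v)
  have mi := fun i : Fin 3 => norm_duDV_succ_le ha hq hc hdc hf hb ht hp (v := v) i
  set b := ‖boxHat g v t‖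
  set W := ‖∑ ν, mulL2 (dt (fun t x => u t x ν) t) (D1 v ν t) + duDV u v 0 t‖
  set Y : Fin 3 → ℝ := fun i =>
    ‖∑ ν, mulL2 (dx i (fun t x => u t x ν) t) (D1 v ν t) + duDV u v i.succ t‖
  set y0 := ‖D1 v 0 t‖
  have hE2 := ew_pos a 2 t
  have hEq := ew_pos a (-1 - q) t
  -- These products match the commutator terms with the weights of the right-hand side: `∂_t u^0`
  -- and `∂_i u^0` lead to `e^{(2-q)Ω} ∂_t v`, while `∂_t u^j` and `∂_i u^j` lead to `e^{(1-q)Ω} ∂_j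
  -- v`.
  have k1 : ew a 2 t * ew a (-q) t = ew a (2 - q) t := ew_mul_eq (by ring)
  have k2 : ew a 2 t * ew a (-1 - q) t = ew a (1 - q) t := ew_mul_eq (by ring)
  have k3 : ew a (1 - q) t * ew a 1 t = ew a (2 - q) t := ew_mul_eq (by ring)
  set D := ∑ j : Fin 3, ew a (1 - q) t * ‖D1 v j.succ t‖ with hD
  have t0 : ‖ew a 2 t • mulL2 (fun x => gInv g 0 0 t x / u t x 0) (duDV u v 0 t)‖ ≤
      4 * (ew a 2 t * W) + 4 * V * (ew a (2 - q) t * y0) + 12 * D := by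
    rw [norm_smul, Real.norm_of_nonneg hE2.le]
    calc _ ≤ ew a 2 t * (4 * (W + (V * ew a (-q) t * y0
          + ∑ j : Fin 3, 3 * ew a (-1 - q) t * ‖D1 v j.succ t‖))) := by
          gcongr
          exact n0.trans (by gcongr)
      _ = _ := by
          rw [hD, ← k1, ← k2]
          simp only [Fin.sum_univ_three]
          ring
  have ti : ‖ew a 2 t • ∑ i : Fin 3,
      mulL2 (fun x => gInv g 0 0 t x * u t x i.succ / (u t x 0) ^ 2
        - 2 * (gInv g 0 i.succ t x / u t x 0)) (duDV u v i.succ t)‖ ≤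
      ∑ i : Fin 3, ew a (1 - q) t * Y i + 3 * V * (ew a (2 - q) t * y0) + 3 * D := by
    rw [norm_smul, Real.norm_of_nonneg hE2.le]
    calc _ ≤ ew a 2 t * ∑ i : Fin 3, ew a (-1 - q) t *
          (Y i + (V * ew a 1 t * y0 + ∑ j : Fin 3, ‖D1 v j.succ t‖)) := by
          gcongr
          refine (norm_sum_le _ _).trans (Finset.sum_le_sum fun i _ => (ni i).trans ?_)
          gcongr
          exact mi i
      _ = _ := by
          rw [hD, ← k3, ← k2]
          simp only [Fin.sum_univ_three]
          ring
  have tb : ‖ew a 2 t • boxHat g v t‖ = ew a 2 t * b := by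
    rw [norm_smul, Real.norm_of_nonneg hE2.le]
  have htri := norm_add_le (ew a 2 t • boxHat g v t
        - ew a 2 t • mulL2 (fun x => gInv g 0 0 t x / u t x 0) (duDV u v 0 t))
      (ew a 2 t • ∑ i : Fin 3,
            mulL2 (fun x => gInv g 0 0 t x * u t x i.succ / (u t x 0) ^ 2
              - 2 * (gInv g 0 i.succ t x / u t x 0)) (duDV u v i.succ t))
  have htri2 := norm_sub_le (ew a 2 t • boxHat g v t)
    (ew a 2 t • mulL2 (fun x => gInv g 0 0 t x / u t x 0) (duDV u v 0 t))
  refine htri.trans ?_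
  have p1 : 0 ≤ ew a 2 t * b := mul_nonneg hE2.le (norm_nonneg _)
  have p2 : 0 ≤ ew a 2 t * W := mul_nonneg hE2.le (norm_nonneg _)
  have p3 : 0 ≤ ∑ i : Fin 3, ew a (1 - q) t * Y i :=
    Finset.sum_nonneg fun i _ => mul_nonneg (ew_pos _ _ _).le (norm_nonneg _)
  have p4 : 0 ≤ ew a (2 - q) t * y0 := mul_nonneg (ew_pos _ _ _).le (norm_nonneg _)
  have p5 : 0 ≤ D := Finset.sum_nonneg fun i _ => mul_nonneg (ew_pos _ _ _).le (norm_nonneg _)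
  -- Since `1 ≤ V`, the factor `15 V` dominates every coefficient: `1` for the wave operator, `4`
  -- and `1` for the `∂_𝐮` terms, `7 V` for `∂_t v`, and `12 + 3` for the spatial gradient.
  have q1 := mul_le_mul_of_nonneg_right hV p1
  have q2 := mul_le_mul_of_nonneg_right hV p2
  have q3 := mul_le_mul_of_nonneg_right hV p3
  have q4 := mul_le_mul_of_nonneg_right hV p4
  have q5 := mul_le_mul_of_nonneg_right hV p5
  linarith

end Estimate

end DustEinstein

/-! ### The key elliptic estimate -/

theorem lemma7p1 (Λ : ℝ) (hΛ : 0 < Λ) (rhoBar : ℝ) (hrhoBar : 0 ≤ rhoBar)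
    (q : ℝ) (hq : 0 < q) (hq' : q ≤ 1 / 8) (N : ℕ) (hN : 4 ≤ N) (c₁ : ℝ) (hc₁ : 1 ≤ c₁) :
    ∃ ε > (0 : ℝ), ∃ C > (0 : ℝ),
      ∀ (a : ℝ → ℝ), IsScaleFactor Λ rhoBar a →
      ∀ (T : ℝ) (g : MetricField) (u : ℝ → T3 → Fin 4 → ℝ) (rho : ℝ → T3 → ℝ),
        IsDustField T g u rho →
        SpatialBootstrap a T c₁ g →
        (∀ t ∈ Ico 0 T, totalNorm a q N rhoBar g u rho t ≤ ENNReal.ofReal ε) →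
        -- `H^{ij}` is an inverse Riemannian metric
        (∀ t ∈ Ico 0 T, ∀ x, (Hup a g u t x).PosDef) ∧
        ∀ v : ℝ → H2, ContDiffOn ℝ 2 v (Ico 0 T) →
        ∀ t ∈ Ico 0 T,
          -- the identity
          (∑ i : Fin 3, ∑ j : Fin 3,
              mulL2 (fun x => Hup a g u t x i j) (D2 v i.succ j.succ t)
            = ew a 2 t • boxHat g v t
              - ew a 2 t • mulL2 (fun x => gInv g 0 0 t x / u t x 0) (duDV u v 0 t)
              + ew a 2 t • ∑ i : Fin 3,
                  mulL2 (fun x => gInv g 0 0 t x * u t x i.succ / (u t x 0) ^ 2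
                    - 2 * (gInv g 0 i.succ t x / u t x 0)) (duDV u v i.succ t)) ∧
          -- the estimate, with `dtdu` for `∂_t ∂_𝐮 v` and `dadu i` for `∂_i ∂_𝐮 v`
          ∃ (dtdu : L2) (dadu : Fin 3 → L2),
            HasDerivWithinAt (duV u v) dtdu (Ici 0) t ∧
            (∀ i, IsWeakDeriv (Pi.single i 1) (duV u v t) (dadu i)) ∧
            ∑ i : Fin 3, ∑ j : Fin 3, ‖D2 v i.succ j.succ t‖ ≤
              C * (ew a 2 t * ‖boxHat g v t‖
                + ew a 2 t * ‖dtdu‖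
                + ∑ i : Fin 3, ew a (1 - q) t * ‖dadu i‖
                + ew a (2 - q) t * ‖D1 v 0 t‖
                + ∑ i : Fin 3, ew a (1 - q) t * ‖D1 v i.succ t‖) := by
  have hK := sobConst_pos
  have hc0 : 0 < c₁ := by linarith
  have hV := velConst_nonneg (Λ := Λ) (rhoBar := rhoBar) hc₁
  -- Dividing by the Sobolev constant makes the pointwise parameter `d = (2000000 c₁⁵)⁻¹`. The
  -- binding requirement is absorption, `18 * 600 c₁² d ≤ (144 c₁³)⁻¹`, where `18 * 600 * 144 =
  -- 1555200`; the condition `100 c₁² d ≤ 1` is far weaker.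
  refine ⟨(2000000 * c₁ ^ 5)⁻¹ / sobConst, by positivity,
    18 * (144 * c₁ ^ 3) * (15 * velConst Λ rhoBar c₁), by positivity, ?_⟩
  intro a ha T g u rho hf hb hS
  have hp : ∀ t ∈ Ico 0 T, PointBounds a q (2000000 * c₁ ^ 5)⁻¹ g u t := by
    intro t ht
    have := pointBounds_of_totalNorm ha hN hf ht (by positivity) (hS t ht)
    rwa [mul_div_cancel₀ _ hK.ne'] at this
  have hdc : 100 * c₁ ^ 2 * (2000000 * c₁ ^ 5)⁻¹ ≤ 1 := by
    rw [← div_eq_mul_inv, div_le_one (by positivity)]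
    have : c₁ ^ 2 ≤ c₁ ^ 5 := pow_le_pow_right₀ hc₁ (by norm_num)
    have : 0 < c₁ ^ 2 := by positivity
    linarith
  have hdc' : 18 * (600 * c₁ ^ 2 * (2000000 * c₁ ^ 5)⁻¹) ≤ (144 * c₁ ^ 3)⁻¹ := by
    rw [show 18 * (600 * c₁ ^ 2 * (2000000 * c₁ ^ 5)⁻¹) = 27 / 5000 * (c₁ ^ 3)⁻¹ by
      field_simp; norm_num, mul_inv]
    have : 0 < (c₁ ^ 3)⁻¹ := by positivity
    linarith
  refine ⟨fun t ht x => Hup_posDef ha hq hc₁ hdc hf hb ht (hp t ht) x, fun v hv t ht => ⟨?_, ?_⟩⟩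
  · exact elliptic_identity (fun μ ν x => gInv_symm (hf.g_symm t ht x) μ ν)
      (continuous_gInv ha hq hc₁ hdc hf hb ht (hp t ht)) (fun μ => (hf.u_C1 μ).continuous ht)
      (fun x => (hf.u_future t ht x).ne') v
  · exact ⟨_, _, hasDerivWithinAt_duV hf.u_C1 hv ht, isWeakDeriv_duV hf.u_C1 ht,
      sum_norm_D2_le ha hrhoBar hq hc₁ hdc hf hb ht (hp t ht) hdc'⟩
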